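/- Conventions. Von Neumann algebras act on a complex Hilbert space and contain its identity operator. Let $\mathcal M$ be a factor of type II$_1$ with its faithful normal tracial state $\tau$. For a matrix $A\in\mathcal M_k(\mathbb C)$ let $\|A\|$ be its operator norm, $\tau_k=\frac1k\mathrm{Tr}$, and $\|(A_j)\|_2^2=\sum_j\tau_k(A_j^*A_j)$ for tuples. For $x_1,\dots,x_n\in\mathcal M$ let $\Gamma_R(x_1,\dots,x_n;m,k,\epsilon)$ be the set of $(A_1,\dots,A_n)\in\mathcal M_k(\mathbb C)^n$ with $\|A_j\|\le R$ and $|\tau_k(A_{i_1}^{\eta_1}\cdots A_{i_q}^{\eta_q})-\tau(x_{i_1}^{\eta_1}\cdots x_{i_q}^{\eta_q})|<\epsilon$ for all $1\le q\le m$, all indices $i_1,\dots,i_q$ and all $\eta_1,\dots,\eta_q\in\{1,*\}$. For $\Gamma\subseteq\mathcal M_k(\mathbb C)^n$ let $\nu(\Gamma,\omega)$ be the minimal number of $\omega$-orbit-balls $\{(A_j): \|(A_j-WB_jW^*)_j\|_2<\omega \text{ for some unitary } W\}$ with centres $(B_j)\in\Gamma$ that cover $\Gamma$. Put $$\mathfrak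 K_2(x_1,\dots,x_n)=\sup_{0<\omega<1}\ \sup_{R>0}\ \inf_{m\in\mathbb N,\ \epsilon>0}\ \limsup_{k\to\infty}\frac{\log\nu(\Gamma_R(x_1,\dots,x_n;m,k,\epsilon),\omega)}{-k^2\log\omega}\in[0,\infty],$$ where an empty microstate space contributes $0$ (instead of $\log 0=-\infty$). For a von Neumann subalgebra $\mathcal N\subseteq\mathcal M$ let $\mathfrak K_2(\mathcal N)$ be the supremum of $\mathfrak K_2(x_1,\dots,x_n)$ over all finite tuples generating $\mathcal N$ as a von Neumann algebra, and let $\delta_0(\mathcal N)$ be the supremum of Voiculescu's (modified) free entropy dimension $$\delta_0(x_1,\dots,x_n)=n+\limsup_{\varepsilon\to0^+}\frac{\chi(x_1+\varepsilon s_1,\dots,x_n+\varepsilon s_n:s_1,\dots,s_n)}{|\log\varepsilon|}$$ over all finite tuples of self-adjoint elements generating $\mathcal N$; here $\chi(\cdot:\cdot)$ is Voiculescu's microstates free entropy of one family in the presence of another, $s_1,\dots,s_n$ are standard semicircular elements, and $\{x_1,\dots,x_n\},\{s_1\},\dots,\{s_n\}$ are free. (If there are no finite generating tuples, the suprema are $0$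 and $-\infty$ respectively.) For a von Neumann subalgebra $\mathcal A\subseteq\mathcal M$ let $\mathcal N_1(\mathcal A)=\{u\in\mathcal U(\mathcal M):u^*\mathcal Au\subseteq\mathcal A\}''$, $\mathcal N_{k+1}(\mathcal A)=\mathcal N_1(\mathcal N_k(\mathcal A))$ for $k\ge1$, and $\mathcal N_\infty(\mathcal A)=\left(\bigcup_{1\le k<\infty}\mathcal N_k(\mathcal A)\right)''$. A Cartan subalgebra of $\mathcal M$ is a maximal abelian self-adjoint subalgebra $\mathcal A$ of $\mathcal M$ with $\mathcal N_1(\mathcal A)=\mathcal M$. Corollary. (1) Let $\mathcal A$ be a finitely generated diffuse (i.e. without minimal projections) von Neumann subalgebra of $\mathcal M$ with $\mathfrak K_2(\mathcal A)=0$. If $\mathcal M=\mathcal N_k(\mathcal A)$ for some $k$ with $1\le k\le\infty$, then $\mathfrak K_2(\mathcal M)=0$ and $\delta_0(\mathcal M)\le1$. (2) In particular these conclusions cover factors with Cartan subalgebras: if $\mathcal M$ has a Cartan subalgebra, then $\mathfrak K_2(\mathcal M)=0$ and $\delta_0(\mathcal M)\le1$. -/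

import Mathlib

noncomputable section

namespace FreeOrbit

open Filter Topology MeasureTheory
open scoped ENNReal ComplexOrder

/-! ### Von Neumann algebras -/

section VonNeumann

variable {H : Type*} [NormedAddCommGroup H] [InnerProductSpace ℂ H] [CompleteSpace H]

/-- The von Neumann algebra on `H` generated by a set `S` of bounded operators: the bicommutant
of `S ∪ S*`. -/
def vnGen (S : Set (H →L[ℂ] H)) : VonNeumannAlgebra H where
  toStarSubalgebra :=
    StarSubalgebra.centralizer ℂ (StarSubalgebra.centralizer ℂ S : Set (H →L[ℂ] H))
  centralizer_centralizer' := by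
    simp

/-- A factor: the centre consists of the scalars. -/
def IsFactor (M : VonNeumannAlgebra H) : Prop :=
  ∀ z ∈ M, (∀ y ∈ M, z * y = y * z) → ∃ c : ℂ, z = c • (1 : H →L[ℂ] H)

/-- A von Neumann algebra is finite if each of its isometries is unitary. -/
def IsFiniteVN (M : VonNeumannAlgebra H) : Prop :=
  ∀ v ∈ M, star v * v = 1 → v * star v = 1

/-- A von Neumann algebra is diffuse if it has no minimal projection, i.e. each nonzero projection
in it strictly dominates another nonzero projection in it. -/
def IsDiffuse (M : VonNeumannAlgebra H) : Prop :=
  ∀ p ∈ M, IsStarProjection p → p ≠ 0 →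
    ∃ q ∈ M, IsStarProjection q ∧ p * q = q ∧ q ≠ 0 ∧ q ≠ p

/-- A factor of type `II₁`: a nonzero finite factor without minimal projections. -/
structure IsTypeII1Factor (M : VonNeumannAlgebra H) : Prop where
  nontrivial : Nontrivial H
  factor : IsFactor M
  finite : IsFiniteVN M
  no_minimal : IsDiffuse M

/-- `τ` is a faithful normal tracial state on `M`. Normality of a state is expressed as its
ultraweak continuity: it is a countable sum of vector functionals. -/
structure IsTracialState (M : VonNeumannAlgebra H) (τ : M.toStarSubalgebra →ₗ[ℂ] ℂ) : Prop where
  map_one : τ 1 = 1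
  nonneg : ∀ x, 0 ≤ τ (star x * x)
  tracial : ∀ x y, τ (x * y) = τ (y * x)
  faithful : ∀ x, τ (star x * x) = 0 → x = 0
  normal : ∃ ξ : ℕ → H, Summable (fun i => ‖ξ i‖ ^ 2) ∧
    ∀ x : M.toStarSubalgebra, HasSum (fun i => inner ℂ (ξ i) ((x : H →L[ℂ] H) (ξ i))) (τ x)

/-- The normalizer algebra `N₁(A)` of `A` in `M`: the von Neumann algebra generated by the
unitaries `u` of `M` with `u* A u ⊆ A`. -/
def normalizerAlgebra (M A : VonNeumannAlgebra H) : VonNeumannAlgebra H :=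
  vnGen {u | u ∈ M ∧ u ∈ unitary (H →L[ℂ] H) ∧ ∀ a ∈ A, star u * a * u ∈ A}

/-- The iterated normalizer algebras: `N_{k+1}(A) = N₁(N_k(A))` for finite `k` (with
`N₀(A) = A`), and `N_∞(A)` is generated by all `N_k(A)`, `1 ≤ k < ∞`. -/
def iteratedNormalizer (M A : VonNeumannAlgebra H) : ℕ∞ → VonNeumannAlgebra H
  | some k => (normalizerAlgebra M)^[k] A
  | none => vnGen (⋃ k : ℕ, ⋃ _ : 1 ≤ k, ((normalizerAlgebra M)^[k] A : Set (H →L[ℂ] H)))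

/-- `A` is a Cartan subalgebra of `M`: a maximal abelian self-adjoint subalgebra of `M` (it equals
its own relative commutant in `M`) whose normalizer algebra is `M`. -/
structure IsCartan (M A : VonNeumannAlgebra H) : Prop where
  le : A ≤ M
  masa : ∀ x ∈ M, x ∈ A ↔ ∀ a ∈ A, x * a = a * x
  regular : normalizerAlgebra M A = M

/-- The tuple `x` of elements of `M` generates the von Neumann algebra `N`. -/
def Generates {M : VonNeumannAlgebra H} {n : ℕ} (x : Fin n → M.toStarSubalgebra)
    (N : VonNeumannAlgebra H) : Prop :=
  vnGen (Set.range fun i => (x i : H →L[ℂ] H)) = N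

/-- `N` is generated, as a von Neumann algebra, by finitely many elements. -/
def IsFinitelyGenerated (N : VonNeumannAlgebra H) : Prop :=
  ∃ S : Set (H →L[ℂ] H), S.Finite ∧ vnGen S = N

end VonNeumann

/-! ### Matricial microstates and the upper free orbit-dimension -/

/-- The normalized trace on `k × k` matrices. -/
def ntr {k : ℕ} (A : Matrix (Fin k) (Fin k) ℂ) : ℂ := (k : ℂ)⁻¹ * A.trace

/-- The operator norm of a matrix acting on Euclidean space. -/
def opNorm {k : ℕ} (A : Matrix (Fin k) (Fin k) ℂ) : ℝ :=
  ‖Matrix.toEuclideanCLM (n := Fin k) (𝕜 := ℂ) A‖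

/-- The trace norm on tuples: `‖A‖₂² = ∑ j, τ_k (A_j* A_j)`. -/
def norm2 {ι : Type*} [Fintype ι] {k : ℕ} (A : ι → Matrix (Fin k) (Fin k) ℂ) : ℝ :=
  Real.sqrt (∑ j, (ntr (star (A j) * A j)).re)

/-- The value at `a` of a `*`-word; the letter `(i, true)` stands for `a_i*`, the letter
`(i, false)` for `a_i`. -/
def starWord {ι R : Type*} [Monoid R] [Star R] (a : ι → R) (w : List (ι × Bool)) : R :=
  (w.map fun p => if p.2 then star (a p.1) else a p.1).prod

/-- The microstate space `Γ_R(x₁, …, x_n; m, k, ε)`, where `law w` is the value of the trace at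
the `*`-word `w` in `x₁, …, x_n`. -/
def microstates {ι : Type*} (law : List (ι × Bool) → ℂ) (R : ℝ) (m k : ℕ) (ε : ℝ) :
    Set (ι → Matrix (Fin k) (Fin k) ℂ) :=
  {A | (∀ j, opNorm (A j) ≤ R) ∧
    ∀ w : List (ι × Bool), 1 ≤ w.length → w.length ≤ m → ‖ntr (starWord A w) - law w‖ < ε}

/-- The `ω`-orbit-ball centred at `B`. -/
def orbitBall {ι : Type*} [Fintype ι] {k : ℕ} (B : ι → Matrix (Fin k) (Fin k) ℂ) (ω : ℝ) :
    Set (ι → Matrix (Fin k) (Fin k) ℂ) :=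
  {A | ∃ W ∈ Matrix.unitaryGroup (Fin k) ℂ, norm2 (fun j => A j - W * B j * star W) < ω}

/-- The `ω`-orbit covering number of `Γ`: the minimal number of `ω`-orbit-balls with centres in
`Γ` that cover `Γ`. -/
def orbitCoveringNumber {ι : Type*} [Fintype ι] {k : ℕ}
    (Γ : Set (ι → Matrix (Fin k) (Fin k) ℂ)) (ω : ℝ) : ℕ∞ :=
  ⨅ (F : Finset (ι → Matrix (Fin k) (Fin k) ℂ)) (_ : (F : Set _) ⊆ Γ)
    (_ : Γ ⊆ ⋃ B ∈ F, orbitBall B ω), (F.card : ℕ∞)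

/-- `𝔎(x₁, …, x_n; ω, R)` for `0 < ω < 1`, with values in `[0, ∞]`: an empty microstate space,
whose covering number is `0`, contributes `0` instead of `log 0 = -∞`. -/
def orbitDimAt {ι : Type*} [Fintype ι] (law : List (ι × Bool) → ℂ) (ω R : ℝ) : ℝ≥0∞ :=
  ⨅ (m : ℕ) (ε : ℝ) (_ : 0 < ε),
    limsup (fun k : ℕ =>
      (ENNReal.log (orbitCoveringNumber (microstates law R m k ε) ω : ℝ≥0∞)).toENNReal /
        ENNReal.ofReal ((k : ℝ) ^ 2 * (-Real.log ω))) atTop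

/-- The upper free orbit-dimension `𝔎₂(x₁, …, x_n)`, with `𝔎(x; ω) = sup_R 𝔎(x; ω, R)`. -/
def upperOrbitDimTuple {ι : Type*} [Fintype ι] (law : List (ι × Bool) → ℂ) : ℝ≥0∞ :=
  ⨆ (ω : ℝ) (_ : 0 < ω) (_ : ω < 1) (R : ℝ) (_ : 0 < R), orbitDimAt law ω R

section

variable {H : Type*} [NormedAddCommGroup H] [InnerProductSpace ℂ H] [CompleteSpace H]

/-- The upper free orbit-dimension `𝔎₂(N)` of a von Neumann subalgebra `N` of `M`, with respect
to the restriction to `N` of the trace `τ` of `M`: the supremum over all finite tuples that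
generate `N` (so it is meaningful when `N` is finitely generated). -/
def upperOrbitDim {M : VonNeumannAlgebra H} (τ : M.toStarSubalgebra →ₗ[ℂ] ℂ)
    (N : VonNeumannAlgebra H) : ℝ≥0∞ :=
  ⨆ (n : ℕ) (x : Fin n → M.toStarSubalgebra) (_ : Generates x N),
    upperOrbitDimTuple fun w => τ (starWord x w)

end

/-! ### Voiculescu's free entropy and (modified) free entropy dimension -/

/-- Free independence of a family of unital subalgebras with respect to `φ`: alternating products
of centred elements are centred. -/
def IsFreeFamily {B κ : Type*} [Ring B] [Algebra ℂ B] (φ : B →ₗ[ℂ] ℂ)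
    (P : κ → Subalgebra ℂ B) : Prop :=
  ∀ l : List (κ × B), l ≠ [] → (∀ q ∈ l, q.2 ∈ P q.1 ∧ φ q.2 = 0) →
    l.IsChain (fun a b => a.1 ≠ b.1) → φ (l.map Prod.snd).prod = 0

/-- The formal variable `X_i`. -/
def varX {n : ℕ} (i : Fin n) : FreeAlgebra ℂ (Fin n ⊕ Fin n) := FreeAlgebra.ι ℂ (Sum.inl i)

/-- The formal variable `S_i`. -/
def varS {n : ℕ} (i : Fin n) : FreeAlgebra ℂ (Fin n ⊕ Fin n) := FreeAlgebra.ι ℂ (Sum.inr i)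

/-- `φ` is the joint law of `(x₁, …, x_n, s₁, …, s_n)`, where `s₁, …, s_n` are standard (centred,
variance one) semicircular elements and `{x₁, …, x_n}, {s₁}, …, {s_n}` are free. Given `x` there is
exactly one such `φ`. -/
structure IsSemicircularExtension {B : Type*} [Ring B] [Algebra ℂ B] (τ : B →ₗ[ℂ] ℂ) {n : ℕ}
    (x : Fin n → B) (φ : FreeAlgebra ℂ (Fin n ⊕ Fin n) →ₗ[ℂ] ℂ) : Prop where
  law_x : ∀ p : FreeAlgebra ℂ (Fin n),
    φ (FreeAlgebra.lift ℂ varX p) = τ (FreeAlgebra.lift ℂ x p)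
  semicircular_even : ∀ (i : Fin n) (r : ℕ), φ (varS i ^ (2 * r)) = (catalan r : ℂ)
  semicircular_odd : ∀ (i : Fin n) (r : ℕ), φ (varS i ^ (2 * r + 1)) = 0
  free : IsFreeFamily φ fun j : Option (Fin n) =>
    match j with
    | none => Algebra.adjoin ℂ (Set.range varX)
    | some i => Algebra.adjoin ℂ {varS i}

/-- The space of self-adjoint microstates `Γ_R(a; m, k, δ)` of a family of self-adjoint variables,
where `law w` is the trace of the word `w` in the variables. -/
def saMicrostates {ι : Type*} (law : List ι → ℂ) (R : ℝ) (m k : ℕ) (δ : ℝ) :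
    Set (ι → Matrix (Fin k) (Fin k) ℂ) :=
  {A | (∀ j, (A j).IsHermitian ∧ opNorm (A j) ≤ R) ∧
    ∀ w : List ι, 1 ≤ w.length → w.length ≤ m → ‖ntr (w.map A).prod - law w‖ < δ}

/-- The real inner product space of `n`-tuples of self-adjoint `k × k` matrices, with the
Hilbert–Schmidt inner product `∑ j, Tr (A_j B_j)` (unnormalized trace); its `volume` is the
corresponding Lebesgue measure. -/
def hermTuples (n k : ℕ) : Submodule ℝ (EuclideanSpace ℂ (Fin n × Fin k × Fin k)) where
  carrier := {v | ∀ j a b, v (j, b, a) = star (v (j, a, b))}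
  add_mem' := by
    intro u v hu hv j a b
    simp [hu j a b, hv j a b]
  zero_mem' := by
    intro j a b
    simp
  smul_mem' := by
    intro c v hv j a b
    simp [hv j a b]

/-- The `n`-tuple of matrices represented by an element of `hermTuples n k`. -/
def toMatrices {n k : ℕ} (v : hermTuples n k) : Fin n → Matrix (Fin k) (Fin k) ℂ :=
  fun j => Matrix.of fun a b => (v : EuclideanSpace ℂ (Fin n × Fin k × Fin k)) (j, a, b)

/-- The Lebesgue measure of `Γ_R(a₁, …, a_n : b₁, …, b_n; m, k, δ)`, the projection to the first
`n` components of the self-adjoint microstates of `(a₁, …, a_n, b₁, …, b_n)`. -/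
def microstateVolume {n : ℕ} (law : List (Fin n ⊕ Fin n) → ℂ) (R : ℝ) (m k : ℕ) (δ : ℝ) :
    ℝ≥0∞ :=
  volume {v : hermTuples n k | ∃ B : Fin n → Matrix (Fin k) (Fin k) ℂ,
    Sum.elim (toMatrices v) B ∈ saMicrostates law R m k δ}

/-- Voiculescu's free entropy `χ(a₁, …, a_n : b₁, …, b_n)` of `a` in the presence of `b`. -/
def freeEntropy {n : ℕ} (law : List (Fin n ⊕ Fin n) → ℂ) : EReal :=
  ⨆ (R : ℝ) (_ : 0 < R), ⨅ (m : ℕ) (δ : ℝ) (_ : 0 < δ),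
    limsup (fun k : ℕ =>
      ENNReal.log (microstateVolume law R m k δ) / (((k : ℝ) ^ 2 : ℝ) : EReal) +
        (((n : ℝ) / 2 * Real.log k : ℝ) : EReal)) atTop

/-- The law of `(x₁ + ε s₁, …, x_n + ε s_n, s₁, …, s_n)`, if `φ` is that of `(x, s)`. -/
def perturbedLaw {n : ℕ} (φ : FreeAlgebra ℂ (Fin n ⊕ Fin n) →ₗ[ℂ] ℂ) (ε : ℝ)
    (w : List (Fin n ⊕ Fin n)) : ℂ :=
  φ (w.map (Sum.elim (fun i => varX i + (ε : ℂ) • varS i) varS)).prod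

/-- Voiculescu's free entropy dimension of a tuple of self-adjoint elements,
`δ₀(x) = n + limsup_{ε → 0} χ(x₁ + ε s₁, …, x_n + ε s_n : s₁, …, s_n) / |log ε|`, for a standard
free semicircular family `s` free from `x` (the law `φ` of `(x, s)` is unique). -/
def freeEntropyDimTuple {B : Type*} [Ring B] [Algebra ℂ B] (τ : B →ₗ[ℂ] ℂ) {n : ℕ}
    (x : Fin n → B) : EReal :=
  ⨆ (φ : FreeAlgebra ℂ (Fin n ⊕ Fin n) →ₗ[ℂ] ℂ) (_ : IsSemicircularExtension τ x φ),
    (n : EReal) +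
      limsup (fun ε : ℝ => freeEntropy (perturbedLaw φ ε) / ((|Real.log ε| : ℝ) : EReal)) (𝓝[>] 0)

section

variable {H : Type*} [NormedAddCommGroup H] [InnerProductSpace ℂ H] [CompleteSpace H]

/-- The free entropy dimension `δ₀(N)` of a von Neumann subalgebra `N` of `M`: the supremum over
all finite tuples of self-adjoint elements that generate `N`. -/
def freeEntropyDim {M : VonNeumannAlgebra H} (τ : M.toStarSubalgebra →ₗ[ℂ] ℂ)
    (N : VonNeumannAlgebra H) : EReal :=
  ⨆ (n : ℕ) (x : Fin n → M.toStarSubalgebra) (_ : ∀ i, IsSelfAdjoint (x i))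
    (_ : Generates x N), freeEntropyDimTuple τ x

end

end FreeOrbit

end

/-!
The vanishing of `𝔎₂` is a smallness property of microstate spaces that passes from a diffuse
subalgebra to its normalizer; the dimension count behind this is the whole reason for the theorem.

*Smallness.* Fix generators `x` of `M` and bounded matrix-valued functions `coord j` on index sets
`X k` that model `x` along a filter `l` (`IsModel`). Every element of `M` is then represented by a
bounded matrix-valued function (`Represents`): a Kaplansky-type cut-off by `t ↦ 2t / (1 + t²)`,
which is bounded and 2-norm Lipschitz, turns 2-norm approximation by `*`-polynomials, available by
the bicommutant theorem (`exists_adjoin_approx`), into approximation by uniformly bounded ones. A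
family of functions is `Small` if, up to unitary conjugation and a 2-norm error, its finite subsets
take at most `exp(η k²)` values at size `k`, for each `η > 0`. Smallness passes to the generated von
Neumann algebra (`small_repSet_vnGen`) and to increasing unions. For the universal model, whose
index sets are the microstates themselves, smallness of `M` says that `𝔎₂(M) = 0`
(`upperOrbitDim_eq_zero_of_small`); conversely `𝔎₂(A) = 0` makes the representatives of a finitely
generated `A ≤ M` small in each model of `M`, because representatives of generators of `A` are
themselves microstates of these generators (`small_repSet_of_upperOrbitDim`).

*Normalizers.* Suppose that `y = ∑ j, p_j y q_j`, where the `p_j`, `q_j` are in a small family and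
`∑ |τ(p_l* p_j)| |τ(q_j q_l*)| ≤ θ`. In matrices, the map `Z ↦ ∑ j, P_j Z Q_j` has Hilbert–Schmidt
norm squared at most `θ k²`, so it has at most `O(θ k²)` singular values which are not small. Once
the `P_j`, `Q_j` are fixed, the matrix `Y` therefore lies near a space of dimension `O(θ k²)` and
has at most `exp(O(θ k²))` values; letting `θ → 0`, `y` may be adjoined to the family
(`small_union_of_sandwich`, `small_repSet_union`). If `u` is a unitary with `u* N u ⊆ N` and `A ≤ N`
is diffuse, take a partition of unity `(p_j)` in `A` into projections of small trace
(`IsDiffuse.exists_partition`) and write `u = ∑ j, p_j u (u* p_j u)`, where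
`∑ τ(p_j)² ≤ θ`. So smallness of `N` implies that of its normalizer algebra, and iteration gives the
first assertion (`small_repSet_iteratedNormalizer`).

*Cartan subalgebras.* A masa `A` of the diffuse algebra `M` is diffuse (`isDiffuse_of_masa`). The
same dimension count, with `y = ∑ j, p_j y p_j` for `y ∈ A`, shows that a diffuse abelian algebra is
small (`small_repSet_of_abelian`): the partition `(p_j)` is generated by one self-adjoint element,
whose microstates are determined up to conjugation by their eigenvalues. No finite generation of `A`
is needed here.

*Free entropy dimension.* If `(B, S)` is a microstate of `(x + ε s, s)`, then `B - ε S` is one of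
`x`, and `B` is within `O(ε)` of it. If `𝔎₂(x) = 0`, the microstates of `x` are covered by
`exp(k²)` orbit-balls of radius `ε`; with an `ε`-net of `(C / ε)^(k²)` unitaries, those of `x + ε s`
are covered by `exp(k²) (C / ε)^(k²)` balls of radius `O(ε)` in a space of dimension `n k²`
(`exists_volume_bound`). The volume of these balls gives
`χ(x + ε s : s) ≤ (n - 1) log ε + O(1)`, hence `δ₀(x) ≤ 1` (`freeEntropyDimTuple_le_one`).
-/

namespace FreeOrbit

open scoped ComplexOrder

/-! ### Traces on C⋆-algebras and their 2-norms -/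

section Trace

/-- A positive tracial functional `t` with `t 1 ≤ 1`. The inequality leaves room for the zero
functional on the algebra of `0 × 0` matrices. -/
structure IsTrace {B : Type*} [CStarAlgebra B] (t : B →ₗ[ℂ] ℂ) : Prop where
  nonneg : ∀ x, 0 ≤ t (star x * x)
  tracial : ∀ x y, t (x * y) = t (y * x)
  one_le : (t 1).re ≤ 1

/-- The 2-norm `‖x‖₂ = t(x* x)^{1/2}` of a tracial functional. -/
noncomputable def tnorm {B : Type*} [CStarAlgebra B] (t : B →ₗ[ℂ] ℂ) (x : B) : ℝ :=
  Real.sqrt (t (star x * x)).re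

variable {B : Type*} [CStarAlgebra B] {t : B →ₗ[ℂ] ℂ}

lemma tnorm_nonneg (x : B) : 0 ≤ tnorm t x := Real.sqrt_nonneg _

@[simp] lemma tnorm_zero : tnorm t (0 : B) = 0 := by simp [tnorm]

@[simp] lemma tnorm_neg (x : B) : tnorm t (-x) = tnorm t x := by
  simp [tnorm]

namespace IsTrace

lemma re_nonneg (ht : IsTrace t) (x : B) : 0 ≤ (t (star x * x)).re :=
  (Complex.nonneg_iff.1 (ht.nonneg x)).1

lemma im_eq_zero (ht : IsTrace t) (x : B) : (t (star x * x)).im = 0 :=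
  (Complex.nonneg_iff.1 (ht.nonneg x)).2.symm

lemma sq_tnorm (ht : IsTrace t) (x : B) : tnorm t x ^ 2 = (t (star x * x)).re :=
  Real.sq_sqrt (ht.re_nonneg x)

lemma apply_star_mul_self (ht : IsTrace t) (x : B) :
    t (star x * x) = ((tnorm t x ^ 2 : ℝ) : ℂ) := by
  rw [ht.sq_tnorm]
  apply Complex.ext
  · simp
  · simp [ht.im_eq_zero]

lemma im_of_isSelfAdjoint (ht : IsTrace t) {a : B} (ha : IsSelfAdjoint a) : (t a).im = 0 := by
  have h : (4 : ℂ) • a = star (1 + a) * (1 + a) - star (1 - a) * (1 - a) := by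
    simp only [star_add, star_sub, star_one, ha.star_eq]
    have : (4 : ℂ) • a = a + a + a + a := by
      rw [show (4 : ℂ) = 1 + 1 + 1 + 1 by norm_num]; simp only [add_smul, one_smul]
    rw [this]; noncomm_ring
  have h2 : (4 : ℂ) * t a = t (star (1 + a) * (1 + a)) - t (star (1 - a) * (1 - a)) := by
    rw [← smul_eq_mul, ← map_smul, h, map_sub]
  have h3 := congrArg Complex.im h2
  simp only [Complex.sub_im, ht.im_eq_zero, Complex.mul_im] at h3
  norm_num at h3
  exact h3

lemma map_star (ht : IsTrace t) (x : B) : t (star x) = star (t x) := by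
  have h1 := ht.im_of_isSelfAdjoint (IsSelfAdjoint.add_star_self x)
  have h2 := ht.im_of_isSelfAdjoint (a := Complex.I • (x - star x)) (by
    rw [isSelfAdjoint_iff]; simp [smul_sub, neg_add_eq_sub])
  simp only [map_add, map_smul, map_sub, Complex.add_im, smul_eq_mul, Complex.mul_im,
    Complex.I_re, Complex.I_im, Complex.sub_re] at h1 h2
  apply Complex.ext <;> simp <;> linarith

/-- The (possibly degenerate) inner product `⟪x, y⟫ = t(x* y)`. -/
@[reducible] noncomputable def core (ht : IsTrace t) : PreInnerProductSpace.Core ℂ B where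
  inner x y := t (star x * y)
  conj_inner_symm x y := by
    change star (t (star y * x)) = _
    rw [← ht.map_star]; simp
  re_inner_nonneg x := ht.re_nonneg x
  add_left x y z := by simp [add_mul]
  smul_left x y r := by simp

lemma norm_apply_star_mul_le (ht : IsTrace t) (x y : B) :
    ‖t (star x * y)‖ ≤ tnorm t x * tnorm t y :=
  let := ht.core
  InnerProductSpace.Core.norm_inner_le_norm (𝕜 := ℂ) x y

lemma tnorm_add_le (ht : IsTrace t) (x y : B) : tnorm t (x + y) ≤ tnorm t x + tnorm t y := by
  let := ht.core
  let := InnerProductSpace.Core.toSeminormedAddCommGroup (𝕜 := ℂ) (F := B)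
  exact norm_add_le x y

lemma tnorm_smul (ht : IsTrace t) (c : ℂ) (x : B) : tnorm t (c • x) = ‖c‖ * tnorm t x := by
  have h : tnorm t (c • x) ^ 2 = (‖c‖ * tnorm t x) ^ 2 := by
    rw [ht.sq_tnorm, mul_pow, ht.sq_tnorm]
    simp only [star_smul, smul_mul_assoc, mul_smul_comm, map_smul, smul_eq_mul]
    rw [← mul_assoc, ← starRingEnd_apply, Complex.mul_conj, Complex.re_ofReal_mul,
      Complex.normSq_eq_norm_sq]
  exact (pow_left_inj₀ (tnorm_nonneg _) (mul_nonneg (norm_nonneg _) (tnorm_nonneg _))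
    two_ne_zero).1 h

lemma tnorm_sub_le (ht : IsTrace t) (x y : B) : tnorm t (x - y) ≤ tnorm t x + tnorm t y := by
  rw [sub_eq_add_neg, ← tnorm_neg (t := t) y]; exact ht.tnorm_add_le _ _

lemma tnorm_sub_comm (_ : IsTrace t) (x y : B) : tnorm t (x - y) = tnorm t (y - x) := by
  rw [← neg_sub, tnorm_neg]

lemma tnorm_sub_le_add (ht : IsTrace t) (x y z : B) :
    tnorm t (x - z) ≤ tnorm t (x - y) + tnorm t (y - z) := by
  rw [← sub_add_sub_cancel x y z]; exact ht.tnorm_add_le _ _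

lemma tnorm_sum_le (ht : IsTrace t) {ι : Type*} (s : Finset ι) (f : ι → B) :
    tnorm t (∑ i ∈ s, f i) ≤ ∑ i ∈ s, tnorm t (f i) := by
  classical
  induction s using Finset.induction_on with
  | empty => simp
  | insert a s ha ih =>
    rw [Finset.sum_insert ha, Finset.sum_insert ha]
    exact (ht.tnorm_add_le _ _).trans (by gcongr)

lemma tnorm_star (ht : IsTrace t) (x : B) : tnorm t (star x) = tnorm t x := by
  simp only [tnorm, star_star]; rw [ht.tracial]

lemma tnorm_mul_le_left (ht : IsTrace t) (a x : B) : tnorm t (a * x) ≤ ‖a‖ * tnorm t x := by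
  let := CStarAlgebra.spectralOrder B
  let := CStarAlgebra.spectralOrderedRing B
  have h1 : 0 ≤ algebraMap ℝ B (‖a‖ ^ 2) - star a * a :=
    sub_nonneg.2 CStarAlgebra.star_mul_le_algebraMap_norm_sq
  obtain ⟨c, hc⟩ := CStarAlgebra.nonneg_iff_eq_star_mul_self.1 h1
  have h2 : (t (star (c * x) * (c * x))).re = ‖a‖ ^ 2 * (t (star x * x)).re
      - (t (star (a * x) * (a * x))).re := by
    have : star (c * x) * (c * x) = ((‖a‖ ^ 2 : ℝ) : ℂ) • (star x * x)
        - star (a * x) * (a * x) := by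
      rw [star_mul, mul_assoc, ← mul_assoc (star c), ← hc, star_mul]
      simp only [sub_mul, mul_sub, mul_assoc, Algebra.algebraMap_eq_smul_one, smul_mul_assoc,
        one_mul, mul_smul_comm, Complex.coe_smul]
    rw [this, map_sub, map_smul, Complex.sub_re, smul_eq_mul, Complex.re_ofReal_mul]
  have h3 := ht.re_nonneg (c * x)
  refine (abs_le_of_sq_le_sq' ?_ (mul_nonneg (norm_nonneg _) (tnorm_nonneg _))).2
  rw [mul_pow, ht.sq_tnorm, ht.sq_tnorm]; linarith

lemma tnorm_mul_le_right (ht : IsTrace t) (x a : B) : tnorm t (x * a) ≤ tnorm t x * ‖a‖ := by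
  rw [← ht.tnorm_star, star_mul, mul_comm, ← norm_star a, ← ht.tnorm_star x]
  exact ht.tnorm_mul_le_left _ _

lemma tnorm_one_le (ht : IsTrace t) : tnorm t (1 : B) ≤ 1 := by
  rw [tnorm, Real.sqrt_le_one]; simpa using ht.one_le

lemma tnorm_le_norm (ht : IsTrace t) (x : B) : tnorm t x ≤ ‖x‖ := by
  have := ht.tnorm_mul_le_left x 1
  rw [mul_one] at this
  exact this.trans (mul_le_of_le_one_right (norm_nonneg _) ht.tnorm_one_le)

lemma norm_apply_le (ht : IsTrace t) (x : B) : ‖t x‖ ≤ tnorm t x := by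
  have := ht.norm_apply_star_mul_le 1 x
  rw [star_one, one_mul] at this
  exact this.trans (mul_le_of_le_one_left (tnorm_nonneg _) ht.tnorm_one_le)

lemma tnorm_mul_mul_le (ht : IsTrace t) (a x b : B) :
    tnorm t (a * x * b) ≤ ‖a‖ * tnorm t x * ‖b‖ :=
  (ht.tnorm_mul_le_right _ _).trans (by gcongr; exact ht.tnorm_mul_le_left _ _)

lemma norm_le_one_of_mem_unitary {u : B} (hu : u ∈ unitary B) : ‖u‖ ≤ 1 := by
  rcases subsingleton_or_nontrivial B with h | h
  · simp [Subsingleton.elim u 0]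
  · exact (CStarRing.norm_of_mem_unitary hu).le

lemma tnorm_conj_unitary (ht : IsTrace t) {u : B} (hu : u ∈ unitary B) (x : B) :
    tnorm t (u * x * star u) = tnorm t x := by
  have h1 := Unitary.star_mul_self_of_mem hu
  have : star (u * x * star u) * (u * x * star u) = u * (star x * x * star u) := by
    simp only [star_mul, star_star]
    calc u * (star x * star u) * (u * x * star u)
        = u * (star x * (star u * u) * x * star u) := by noncomm_ring
      _ = _ := by rw [h1]; noncomm_ring
  rw [tnorm, tnorm, this, ht.tracial, mul_assoc, h1, mul_one]

end IsTrace

end Trace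

/-! ### The normalized trace of matrices -/

section MatrixTrace

open scoped Matrix.Norms.L2Operator

/-- The normalized trace of `k × k` matrices as a linear functional. -/
noncomputable def ntrLin (k : ℕ) : Matrix (Fin k) (Fin k) ℂ →ₗ[ℂ] ℂ :=
  (k : ℂ)⁻¹ • Matrix.traceLinearMap (Fin k) ℂ ℂ

lemma ntrLin_apply {k : ℕ} (A : Matrix (Fin k) (Fin k) ℂ) : ntrLin k A = ntr A := rfl

lemma trace_star_mul_self {k : ℕ} (A : Matrix (Fin k) (Fin k) ℂ) :
    (star A * A).trace = ((∑ i, ∑ j, ‖A i j‖ ^ 2 : ℝ) : ℂ) := by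
  rw [Matrix.trace, Finset.sum_comm]
  push_cast
  refine Finset.sum_congr rfl fun i _ => ?_
  rw [Matrix.diag_apply, Matrix.mul_apply]
  refine Finset.sum_congr rfl fun j _ => ?_
  rw [Matrix.star_apply, ← starRingEnd_apply, Complex.conj_mul']

lemma isTrace_ntrLin (k : ℕ) : IsTrace (ntrLin k) where
  nonneg A := by
    rw [ntrLin_apply, ntr, trace_star_mul_self]
    have : (0 : ℝ) ≤ (k : ℝ)⁻¹ * ∑ i, ∑ j, ‖A i j‖ ^ 2 := by positivity
    rw [Complex.nonneg_iff, show (k : ℂ)⁻¹ = ((k : ℝ)⁻¹ : ℝ) by push_cast; rfl,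
      ← Complex.ofReal_mul,
      Complex.ofReal_re, Complex.ofReal_im]
    exact ⟨this, rfl⟩
  tracial A B := by
    rw [ntrLin_apply, ntrLin_apply, ntr, ntr, Matrix.trace_mul_comm]
  one_le := by
    rw [ntrLin_apply, ntr, Matrix.trace_one]
    rcases eq_or_ne k 0 with rfl | h
    · simp
    · have : (k : ℂ) ≠ 0 := by exact_mod_cast h
      simp [this]

/-- The normalized Hilbert–Schmidt norm `‖A‖₂ = (τ_k(A* A))^{1/2}` of a matrix. -/
noncomputable abbrev hsnorm {k : ℕ} (A : Matrix (Fin k) (Fin k) ℂ) : ℝ := tnorm (ntrLin k) A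

lemma sq_hsnorm {k : ℕ} (A : Matrix (Fin k) (Fin k) ℂ) :
    hsnorm A ^ 2 = (k : ℝ)⁻¹ * ∑ i, ∑ j, ‖A i j‖ ^ 2 := by
  rw [hsnorm, (isTrace_ntrLin k).sq_tnorm, ntrLin_apply, ntr, trace_star_mul_self]
  rw [show (k : ℂ)⁻¹ = ((k : ℝ)⁻¹ : ℝ) by push_cast; rfl,
      ← Complex.ofReal_mul, Complex.ofReal_re]

lemma ntr_one {k : ℕ} (hk : k ≠ 0) : ntr (1 : Matrix (Fin k) (Fin k) ℂ) = 1 := by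
  have : (k : ℂ) ≠ 0 := by exact_mod_cast hk
  simp [ntr, this]

lemma sq_norm2 {ι : Type*} [Fintype ι] {k : ℕ} (A : ι → Matrix (Fin k) (Fin k) ℂ) :
    norm2 A ^ 2 = ∑ j, hsnorm (A j) ^ 2 := by
  simp only [(isTrace_ntrLin k).sq_tnorm]
  exact Real.sq_sqrt (Finset.sum_nonneg fun j _ => (isTrace_ntrLin k).re_nonneg (A j))

lemma norm2_nonneg {ι : Type*} [Fintype ι] {k : ℕ} (A : ι → Matrix (Fin k) (Fin k) ℂ) :
    0 ≤ norm2 A := Real.sqrt_nonneg _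

lemma norm2_le_sum {ι : Type*} [Fintype ι] {k : ℕ} (A : ι → Matrix (Fin k) (Fin k) ℂ) :
    norm2 A ≤ ∑ j, hsnorm (A j) := by
  refine abs_le_of_sq_le_sq' ?_ (Finset.sum_nonneg fun j _ => tnorm_nonneg _) |>.2
  rw [sq_norm2]
  exact Finset.sum_sq_le_sq_sum_of_nonneg fun j _ => tnorm_nonneg _

lemma hsnorm_le_norm2 {ι : Type*} [Fintype ι] {k : ℕ} (A : ι → Matrix (Fin k) (Fin k) ℂ) (j : ι) :
    hsnorm (A j) ≤ norm2 A := by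
  refine abs_le_of_sq_le_sq' ?_ (norm2_nonneg A) |>.2
  rw [sq_norm2]
  exact Finset.single_le_sum (f := fun j => hsnorm (A j) ^ 2) (fun j _ => sq_nonneg _)
    (Finset.mem_univ j)

lemma opNorm_eq_norm {k : ℕ} (A : Matrix (Fin k) (Fin k) ℂ) : opNorm A = ‖A‖ := rfl

end MatrixTrace

/-! ### Volumetric covering estimates -/

section Covering

open MeasureTheory Metric Module
open scoped ENNReal

lemma card_le_of_separated {E : Type*} [NormedAddCommGroup E] [NormedSpace ℝ E]
    [FiniteDimensional ℝ E] {r s : ℝ} (hr : 0 ≤ r) (hs : 0 < s) (T : Finset E)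
    (hT : ∀ c ∈ T, ‖c‖ ≤ r) (h : ∀ c ∈ T, ∀ d ∈ T, c ≠ d → s < ‖c - d‖) :
    (T.card : ℝ) ≤ (1 + 2 * r / s) ^ finrank ℝ E := by
  borelize E
  let μ : Measure E := Measure.addHaar
  have hδ : 0 < s / 2 := by positivity
  have hρ : 0 < r + s / 2 := by positivity
  have D : Set.Pairwise (T : Set E) (Function.onFun Disjoint fun c => ball (c : E) (s / 2)) := by
    rintro c hc d hd hcd
    apply ball_disjoint_ball
    rw [dist_eq_norm, add_halves]
    exact (h c hc d hd hcd).le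
  have hsub : (⋃ c ∈ T, ball (c : E) (s / 2)) ⊆ ball (0 : E) (r + s / 2) := by
    refine Set.iUnion₂_subset fun x hx => ball_subset_ball' ?_
    rw [dist_zero_right]; linarith [hT x hx]
  have I : (T.card : ℝ≥0∞) * ENNReal.ofReal ((s / 2) ^ finrank ℝ E) * μ (ball 0 1) ≤
      ENNReal.ofReal ((r + s / 2) ^ finrank ℝ E) * μ (ball 0 1) :=
    calc
      _ = μ (⋃ c ∈ T, ball (c : E) (s / 2)) := by
        rw [measure_biUnion_finset D fun c _ => measurableSet_ball]
        simp only [μ.addHaar_ball_of_pos _ hδ, Finset.sum_const, nsmul_eq_mul, mul_assoc]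
      _ ≤ μ (ball (0 : E) (r + s / 2)) := measure_mono hsub
      _ = _ := by simp only [μ.addHaar_ball_of_pos _ hρ]
  have J : (T.card : ℝ≥0∞) * ENNReal.ofReal ((s / 2) ^ finrank ℝ E) ≤
      ENNReal.ofReal ((r + s / 2) ^ finrank ℝ E) :=
    (ENNReal.mul_le_mul_iff_left (measure_ball_pos _ _ zero_lt_one).ne' measure_ball_lt_top.ne).1 I
  have K := ENNReal.toReal_le_of_le_ofReal (pow_nonneg hρ.le _) J
  rw [ENNReal.toReal_mul, ENNReal.toReal_natCast, ENNReal.toReal_ofReal (by positivity)] at K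
  rw [show 1 + 2 * r / s = (r + s / 2) / (s / 2) by field_simp; ring, div_pow,
    le_div_iff₀ (by positivity)]
  exact K

/-- The ball of radius `r` of a `d`-dimensional real normed space can be partitioned into at most
`(1 + 4r/s)^d` classes of diameter at most `s`. -/
lemma exists_partition_ball (E : Type*) [NormedAddCommGroup E] [NormedSpace ℝ E]
    [FiniteDimensional ℝ E] {r s : ℝ} (hr : 0 ≤ r) (hs : 0 < s) :
    ∃ (N : ℕ) (c : E → Fin N), (N : ℝ) ≤ (1 + 4 * r / s) ^ finrank ℝ E ∧
      ∀ v w, ‖v‖ ≤ r → ‖w‖ ≤ r → c v = c w → ‖v - w‖ ≤ s := by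
  classical
  let P : ℕ → Prop := fun m => ∃ T : Finset E, T.card = m ∧ (∀ c ∈ T, ‖c‖ ≤ r) ∧
    ∀ c ∈ T, ∀ d ∈ T, c ≠ d → s / 2 < ‖c - d‖
  have hbound : ∀ m, P m → m ≤ ⌊(1 + 4 * r / s) ^ finrank ℝ E⌋₊ := by
    rintro m ⟨T, rfl, h1, h2⟩
    apply Nat.le_floor
    have := card_le_of_separated hr (half_pos hs) T h1 h2
    rwa [show 2 * r / (s / 2) = 4 * r / s by field_simp; ring] at this
  have hP0 : P 0 := ⟨∅, by simp⟩
  obtain ⟨T, hTc, hT1, hT2⟩ : P (Nat.findGreatest P ⌊(1 + 4 * r / s) ^ finrank ℝ E⌋₊) :=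
    Nat.findGreatest_spec (Nat.zero_le _) hP0
  have hnear : ∀ v : E, ‖v‖ ≤ r → ∃ t : T, ‖v - t‖ ≤ s / 2 := by
    intro v hv
    by_contra! hcon
    have hvT : v ∉ T := fun hvT => by
      have := hcon ⟨v, hvT⟩
      simp at this; linarith
    have hPs : P (T.card + 1) := by
      refine ⟨insert v T, Finset.card_insert_of_notMem hvT, ?_, ?_⟩
      · intro c hc
        rcases Finset.mem_insert.1 hc with rfl | hc
        exacts [hv, hT1 c hc]
      · intro c hc d hd hcd
        rcases Finset.mem_insert.1 hc with rfl | hc <;> rcases Finset.mem_insert.1 hd with rfl | hd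
        · exact absurd rfl hcd
        · exact hcon ⟨d, by assumption⟩
        · rw [norm_sub_rev]; exact hcon ⟨c, by assumption⟩
        · exact hT2 c hc d hd hcd
    have := Nat.le_findGreatest (hbound _ hPs) hPs
    omega
  obtain ⟨t0, -⟩ := hnear 0 (by simpa using hr)
  have hch : ∀ v : E, ∃ t : T, ‖v‖ ≤ r → ‖v - t‖ ≤ s / 2 := fun v => by
    by_cases hv : ‖v‖ ≤ r
    · obtain ⟨t, ht⟩ := hnear v hv
      exact ⟨t, fun _ => ht⟩
    · exact ⟨t0, fun h => absurd h hv⟩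
  choose f hf using hch
  refine ⟨T.card, fun v => T.equivFin (f v), ?_, ?_⟩
  · exact (Nat.cast_le.2 (hbound _ ⟨T, rfl, hT1, hT2⟩)).trans
      (Nat.floor_le (by positivity))
  · intro v w hv hw hvw
    have hvw' : f v = f w := T.equivFin.injective hvw
    have h1 := hf v hv
    have h2 := hf w hw
    rw [← hvw'] at h2
    calc ‖v - w‖ = ‖(v - f v) - (w - f v)‖ := by congr 1; abel
      _ ≤ _ := norm_sub_le _ _
      _ ≤ s := by linarith

/-- If the Hilbert–Schmidt norm of `L` is at most `K^{1/2}`, then up to an error of operator norm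
`t` the range of `L` is contained in a subspace of dimension at most `K / t²`: the span of the
eigenvectors of `L L*` whose eigenvalues are at least `t²`. -/
lemma exists_submodule_of_hilbertSchmidt {V ι : Type*} [NormedAddCommGroup V]
    [InnerProductSpace ℂ V] [FiniteDimensional ℂ V] [Fintype ι] (b : OrthonormalBasis ι ℂ V)
    (L : V →ₗ[ℂ] V) {K t : ℝ} (ht : 0 < t) (hK : ∑ i, ‖L (b i)‖ ^ 2 ≤ K) :
    ∃ E : Submodule ℂ V, (finrank ℂ E : ℝ) ≤ K / t ^ 2 ∧
      ∀ v, ‖L v - E.starProjection (L v)‖ ≤ t * ‖v‖ := by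
  classical
  have hsymm : (L ∘ₗ L.adjoint).IsSymmetric := fun x y => by
    simp only [LinearMap.comp_apply]
    rw [← LinearMap.adjoint_inner_right L, ← LinearMap.adjoint_inner_right L.adjoint,
      LinearMap.adjoint_adjoint]
  set n := finrank ℂ V with hn
  let e := hsymm.eigenvectorBasis hn.symm
  let μ := hsymm.eigenvalues hn.symm
  have hadj : ∀ v, ‖L.adjoint v‖ ^ 2 = ∑ i, μ i * ‖inner ℂ (e i) v‖ ^ 2 := by
    intro v
    have h1 : inner ℂ (L.adjoint v) (L.adjoint v) = inner ℂ ((L ∘ₗ L.adjoint) v) v := by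
      rw [LinearMap.comp_apply, LinearMap.adjoint_inner_right]
    have h2 : inner ℂ ((L ∘ₗ L.adjoint) v) v = ((∑ i, μ i * ‖inner ℂ (e i) v‖ ^ 2 : ℝ) : ℂ) := by
      rw [← e.sum_inner_mul_inner]
      push_cast
      refine Finset.sum_congr rfl fun i _ => ?_
      change inner ℂ ((L ∘ₗ L.adjoint) v) (e i) * _ = _
      rw [hsymm v (e i), hsymm.apply_eigenvectorBasis, inner_smul_right, mul_assoc]
      congr 1
      rw [← inner_conj_symm, Complex.conj_mul']
    have h3 := inner_self_eq_norm_sq_to_K (𝕜 := ℂ) (L.adjoint v)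
    rw [h1, h2] at h3
    apply Complex.ofReal_injective
    rw [h3]; simp
  have hμ : ∀ i, μ i = ‖L.adjoint (e i)‖ ^ 2 := by
    intro i
    rw [hadj, Finset.sum_eq_single i]
    · rw [e.inner_eq_one]; simp
    · intro j _ hj
      rw [e.inner_eq_zero hj]; simp
    · simp
  -- the trace of `L L*` is the squared Hilbert–Schmidt norm of `L`
  have hsum : ∑ i, μ i ≤ K := by
    refine le_trans (le_of_eq ?_) hK
    simp only [hμ]
    calc ∑ i, ‖L.adjoint (e i)‖ ^ 2 = ∑ i, ∑ j, ‖inner ℂ (b j) (L.adjoint (e i))‖ ^ 2 := by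
          refine Finset.sum_congr rfl fun i _ => ?_
          rw [b.sum_sq_norm_inner_right]
      _ = ∑ j, ∑ i, ‖inner ℂ (b j) (L.adjoint (e i))‖ ^ 2 := Finset.sum_comm
      _ = ∑ j, ‖L (b j)‖ ^ 2 := by
          refine Finset.sum_congr rfl fun j _ => ?_
          simp only [LinearMap.adjoint_inner_right]
          rw [e.sum_sq_norm_inner_left]
  let J : Finset (Fin n) := Finset.univ.filter fun i => t ^ 2 ≤ μ i
  let E : Submodule ℂ V := Submodule.span ℂ (Set.range fun i : J => e i)
  have hE : finrank ℂ E = J.card := by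
    have hli : LinearIndependent ℂ (fun i : J => e i) :=
      e.orthonormal.linearIndependent.comp _ Subtype.val_injective
    rw [finrank_span_eq_card hli, Fintype.card_coe]
  refine ⟨E, ?_, fun v => ?_⟩
  · rw [hE, le_div_iff₀ (by positivity)]
    calc (J.card : ℝ) * t ^ 2 = ∑ i ∈ J, t ^ 2 := by simp
      _ ≤ ∑ i ∈ J, μ i := Finset.sum_le_sum fun i hi => (Finset.mem_filter.1 hi).2
      _ ≤ ∑ i, μ i := Finset.sum_le_sum_of_subset_of_nonneg (Finset.subset_univ _)
          fun i _ _ => by rw [hμ]; positivity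
      _ ≤ K := hsum
  · set w := L v - E.starProjection (L v) with hw
    have hwE : w ∈ Eᗮ := Submodule.sub_starProjection_mem_orthogonal _
    have hwi : ∀ i ∈ J, inner ℂ (e i) w = 0 := fun i hi =>
      (Submodule.mem_orthogonal _ _).1 hwE _ (Submodule.subset_span ⟨⟨i, hi⟩, rfl⟩)
    -- on the remaining eigenvectors `L L* ≤ t²`, that is, `L*` has norm at most `t` there
    have h1 : ‖L.adjoint w‖ ≤ t * ‖w‖ := by
      refine abs_le_of_sq_le_sq' ?_ (by positivity) |>.2
      rw [hadj, mul_pow, ← e.sum_sq_norm_inner_right, Finset.mul_sum]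
      refine Finset.sum_le_sum fun i _ => ?_
      by_cases hi : i ∈ J
      · rw [hwi i hi]; simp
      · have : μ i ≤ t ^ 2 := by
          simp only [J, Finset.mem_filter, Finset.mem_univ, true_and, not_le] at hi
          exact hi.le
        gcongr
    have h2 : ‖w‖ ^ 2 ≤ t * ‖w‖ * ‖v‖ := by
      have h3 : inner ℂ w w = inner ℂ (L.adjoint w) v := by
        rw [LinearMap.adjoint_inner_left]
        nth_rewrite 2 [hw]
        rw [inner_sub_right, (Submodule.mem_orthogonal' _ _).1 hwE _
          (Submodule.starProjection_apply_mem E (L v)), sub_zero]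
      have h4 : ‖w‖ ^ 2 = ‖inner ℂ (L.adjoint w) v‖ := by
        rw [← h3, inner_self_eq_norm_sq_to_K]; simp
      rw [h4]
      exact (norm_inner_le_norm _ _).trans (by gcongr)
    rcases (norm_nonneg w).eq_or_lt with h0 | h0
    · rw [← h0]; positivity
    · nlinarith

/-- Approximate fixed points, in the ball of radius `ρ`, of an operator with small Hilbert–Schmidt
norm can be partitioned into few classes of small diameter. -/
lemma exists_partition_of_hilbertSchmidt {V ι : Type*} [NormedAddCommGroup V]
    [InnerProductSpace ℂ V] [FiniteDimensional ℂ V] [Fintype ι] (b : OrthonormalBasis ι ℂ V)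
    (L : V →ₗ[ℂ] V) {K t s ρ : ℝ} (ht : 0 < t) (hs : 0 < s) (hρ : 0 ≤ ρ)
    (hK : ∑ i, ‖L (b i)‖ ^ 2 ≤ K) (δ : ℝ) :
    ∃ (N : ℕ) (c : V → Fin N), (N : ℝ) ≤ Real.exp (2 * K / t ^ 2 * Real.log (1 + 4 * ρ / s)) ∧
      ∀ v w, ‖v‖ ≤ ρ → ‖w‖ ≤ ρ → ‖v - L v‖ ≤ δ → ‖w - L w‖ ≤ δ → c v = c w →
        ‖v - w‖ ≤ s + 2 * δ + 2 * t * ρ := by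
  obtain ⟨E, hE, hL⟩ := exists_submodule_of_hilbertSchmidt b L ht hK
  obtain ⟨N, c, hN, hc⟩ := exists_partition_ball E hρ hs
  have hone : 1 ≤ 1 + 4 * ρ / s := by
    have : 0 ≤ 4 * ρ / s := by positivity
    linarith
  refine ⟨N, fun v => c (E.orthogonalProjectionOnto v), hN.trans ?_, ?_⟩
  · rw [finrank_real_of_complex, ← Real.rpow_natCast, Real.rpow_def_of_pos (by linarith), mul_comm]
    refine Real.exp_le_exp.2 (mul_le_mul_of_nonneg_right ?_ (Real.log_nonneg hone))
    push_cast
    calc 2 * (finrank ℂ E : ℝ) ≤ 2 * (K / t ^ 2) := by gcongr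
      _ = _ := by ring
  · intro v w hv hw hv' hw' hvw
    have hnorm : ∀ z : V, ‖E.orthogonalProjectionOnto z‖ ≤ ‖z‖ := fun z =>
      E.norm_orthogonalProjectionOnto_apply_le z
    have h1 := hc _ _ ((hnorm v).trans hv) ((hnorm w).trans hw) hvw
    have h2 : ∀ z : V, ‖z‖ ≤ ρ → ‖z - L z‖ ≤ δ → ‖z - E.starProjection z‖ ≤ δ + t * ρ := by
      intro z hz hz'
      have hdec : z - E.starProjection z = Eᗮ.starProjection (z - L z)
          + (L z - E.starProjection (L z)) := by
        rw [Submodule.starProjection_orthogonal]; simp; abel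
      rw [hdec]
      refine (norm_add_le _ _).trans (add_le_add ?_ ((hL z).trans (by gcongr)))
      exact (Eᗮ.norm_starProjection_apply_le _).trans hz'
    have h3 : ‖E.starProjection v - E.starProjection w‖ ≤ s := by
      have : E.starProjection v - E.starProjection w =
        ((E.orthogonalProjectionOnto v - E.orthogonalProjectionOnto w : E) : V) := rfl
      rw [this]; exact h1
    calc ‖v - w‖ = ‖(v - E.starProjection v) + (E.starProjection v - E.starProjection w)
          - (w - E.starProjection w)‖ := by congr 1; abel
      _ ≤ ‖v - E.starProjection v‖ + ‖E.starProjection v - E.starProjection w‖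
          + ‖w - E.starProjection w‖ := (norm_sub_le _ _).trans (by gcongr; exact norm_add_le _ _)
      _ ≤ _ := by linarith [h2 v hv hv', h2 w hw hw']

end Covering

section MatrixCovering

open Module
open scoped Matrix.Norms.L2Operator

/-- The coordinate vector of a matrix. -/
noncomputable def vecEquiv (k : ℕ) :
    Matrix (Fin k) (Fin k) ℂ ≃ₗ[ℂ] EuclideanSpace ℂ (Fin k × Fin k) where
  toFun A := WithLp.toLp 2 fun p => A p.1 p.2
  invFun v := Matrix.of fun i j => v (i, j)
  map_add' A B := by ext; simp
  map_smul' c A := by ext; simp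
  left_inv A := by ext; simp
  right_inv v := by ext; simp

lemma norm_vecEquiv {k : ℕ} (A : Matrix (Fin k) (Fin k) ℂ) :
    ‖vecEquiv k A‖ = Real.sqrt k * hsnorm A := by
  have h1 : ‖vecEquiv k A‖ ^ 2 = ∑ i, ∑ j, ‖A i j‖ ^ 2 := by
    rw [EuclideanSpace.norm_sq_eq, Fintype.sum_prod_type]; rfl
  have h2 : (Real.sqrt k * hsnorm A) ^ 2 = ∑ i, ∑ j, ‖A i j‖ ^ 2 := by
    rw [mul_pow, Real.sq_sqrt (Nat.cast_nonneg _), sq_hsnorm]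
    rcases eq_or_ne k 0 with rfl | hk
    · simp
    · have : (k : ℝ) ≠ 0 := by exact_mod_cast hk
      field_simp
  exact (pow_left_inj₀ (norm_nonneg _) (mul_nonneg (Real.sqrt_nonneg _) (tnorm_nonneg _))
    two_ne_zero).1 (h1.trans h2.symm)

lemma hsnorm_of_zero (A : Matrix (Fin 0) (Fin 0) ℂ) : hsnorm A = 0 := by
  rw [Subsingleton.elim A 0, hsnorm, tnorm_zero]

/-- The map `T ↦ ∑ j, P_j T Q_j`. -/
noncomputable def sandwich {k : ℕ} {ι : Type*} [Fintype ι] (P Q : ι → Matrix (Fin k) (Fin k) ℂ) :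
    Matrix (Fin k) (Fin k) ℂ →ₗ[ℂ] Matrix (Fin k) (Fin k) ℂ where
  toFun T := ∑ j, P j * T * Q j
  map_add' S T := by simp [mul_add, add_mul, Finset.sum_add_distrib]
  map_smul' c T := by simp [Finset.smul_sum]

lemma sandwich_apply {k : ℕ} {ι : Type*} [Fintype ι] (P Q : ι → Matrix (Fin k) (Fin k) ℂ)
    (T : Matrix (Fin k) (Fin k) ℂ) : sandwich P Q T = ∑ j, P j * T * Q j := rfl

/-- The Hilbert–Schmidt norm of the map `T ↦ ∑ j, P_j T Q_j` in terms of traces. -/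
lemma sum_sq_norm_sandwich {k : ℕ} {ι : Type*} [Fintype ι] (P Q : ι → Matrix (Fin k) (Fin k) ℂ) :
    ((∑ i, ‖vecEquiv k (sandwich P Q ((vecEquiv k).symm
      (EuclideanSpace.basisFun (Fin k × Fin k) ℂ i)))‖ ^ 2 : ℝ) : ℂ) =
      ∑ j, ∑ l, (star (P l) * P j).trace * (Q j * star (Q l)).trace := by
  have h1 : ∀ a b c d, sandwich P Q ((vecEquiv k).symm
      (EuclideanSpace.basisFun (Fin k × Fin k) ℂ (a, b))) c d = ∑ j, P j c a * Q j b d := by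
    intro a b c d
    rw [sandwich_apply, Matrix.sum_apply]
    refine Finset.sum_congr rfl fun j _ => ?_
    have : (vecEquiv k).symm (EuclideanSpace.basisFun (Fin k × Fin k) ℂ (a, b))
        = Matrix.single a b 1 := by
      ext i j
      simp [vecEquiv, Matrix.single_apply, Prod.ext_iff, eq_comm]
    rw [this]
    simp only [Matrix.mul_apply, Matrix.single_apply]
    rw [Finset.sum_eq_single b]
    · rw [Finset.sum_eq_single a]
      · simp
      · intro x _ hx; simp [hx.symm]
      · simp
    · intro y _ hy; simp [hy.symm]
    · simp
  have h2 : ∀ a b, ((‖vecEquiv k (sandwich P Q ((vecEquiv k).symm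
      (EuclideanSpace.basisFun (Fin k × Fin k) ℂ (a, b))))‖ ^ 2 : ℝ) : ℂ) =
      ∑ c, ∑ d, ∑ j, ∑ l, (star (P l c a) * P j c a) * (Q j b d * star (Q l b d)) := by
    intro a b
    rw [EuclideanSpace.norm_sq_eq, Fintype.sum_prod_type]
    push_cast
    refine Finset.sum_congr rfl fun c _ => Finset.sum_congr rfl fun d _ => ?_
    change ((‖sandwich P Q _ c d‖ : ℂ)) ^ 2 = _
    rw [← Complex.mul_conj', h1, map_sum, Finset.sum_mul_sum]
    refine Finset.sum_congr rfl fun j _ => Finset.sum_congr rfl fun l _ => ?_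
    simp only [map_mul, starRingEnd_apply]
    ring
  push_cast
  simp only [← Complex.ofReal_pow]
  rw [Fintype.sum_prod_type]
  simp only [h2]
  simp only [Matrix.trace, Matrix.diag_apply, Matrix.mul_apply, Matrix.star_apply]
  calc ∑ a, ∑ b, ∑ c, ∑ d, ∑ j, ∑ l, star (P l c a) * P j c a * (Q j b d * star (Q l b d))
      = ∑ a, ∑ b, ∑ c, ∑ j, ∑ l, ∑ d,
          star (P l c a) * P j c a * (Q j b d * star (Q l b d)) := by
        refine Finset.sum_congr rfl fun a _ => Finset.sum_congr rfl fun b _ =>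
          Finset.sum_congr rfl fun c _ => ?_
        rw [Finset.sum_comm]
        exact Finset.sum_congr rfl fun j _ => Finset.sum_comm
    _ = ∑ a, ∑ b, ∑ j, ∑ l, ∑ c, ∑ d,
          star (P l c a) * P j c a * (Q j b d * star (Q l b d)) := by
        refine Finset.sum_congr rfl fun a _ => Finset.sum_congr rfl fun b _ => ?_
        rw [Finset.sum_comm]
        exact Finset.sum_congr rfl fun j _ => Finset.sum_comm
    _ = ∑ a, ∑ j, ∑ l, ∑ b, ∑ c, ∑ d,
          star (P l c a) * P j c a * (Q j b d * star (Q l b d)) := by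
        refine Finset.sum_congr rfl fun a _ => ?_
        rw [Finset.sum_comm]
        exact Finset.sum_congr rfl fun j _ => Finset.sum_comm
    _ = ∑ j, ∑ l, ∑ a, ∑ b, ∑ c, ∑ d,
          star (P l c a) * P j c a * (Q j b d * star (Q l b d)) := by
        rw [Finset.sum_comm]
        exact Finset.sum_congr rfl fun j _ => Finset.sum_comm
    _ = _ := by
        refine Finset.sum_congr rfl fun j _ => Finset.sum_congr rfl fun l _ => ?_
        rw [Finset.sum_mul_sum]
        refine Finset.sum_congr rfl fun a _ => Finset.sum_congr rfl fun b _ => ?_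
        rw [Finset.sum_mul_sum]

/-- If `∑_{j,l} |τ(P_l* P_j)| |τ(Q_j Q_l*)| ≤ θ`, then the matrices `Z` of 2-norm at most `ρ` with
`Z ≈ ∑ j, P_j Z Q_j` form at most `exp(C θ k²)` classes of small diameter. -/
lemma exists_partition_sandwich {k : ℕ} {ι : Type*} [Fintype ι]
    (P Q : ι → Matrix (Fin k) (Fin k) ℂ) {θ t s ρ δ : ℝ} (ht : 0 < t) (hs : 0 < s) (hρ : 0 ≤ ρ)
    (hθ : ∑ j, ∑ l, ‖ntr (star (P l) * P j)‖ * ‖ntr (Q j * star (Q l))‖ ≤ θ) :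
    ∃ (N : ℕ) (c : Matrix (Fin k) (Fin k) ℂ → Fin N),
      (N : ℝ) ≤ Real.exp (2 * θ / t ^ 2 * Real.log (1 + 4 * ρ / s) * (k : ℝ) ^ 2) ∧
      ∀ Z Z', hsnorm Z ≤ ρ → hsnorm Z' ≤ ρ → hsnorm (Z - ∑ j, P j * Z * Q j) ≤ δ →
        hsnorm (Z' - ∑ j, P j * Z' * Q j) ≤ δ → c Z = c Z' →
        hsnorm (Z - Z') ≤ s + 2 * δ + 2 * t * ρ := by
  rcases Nat.eq_zero_or_pos k with rfl | hk
  · refine ⟨1, fun _ => 0, by simp, fun Z Z' _ _ h _ _ => ?_⟩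
    rw [hsnorm_of_zero] at h ⊢
    positivity
  have hk' : (0 : ℝ) < k := by exact_mod_cast hk
  have hsq : 0 < Real.sqrt k := Real.sqrt_pos.2 hk'
  have hHS : ∑ i, ‖((vecEquiv k).toLinearMap ∘ₗ sandwich P Q ∘ₗ (vecEquiv k).symm.toLinearMap)
      (EuclideanSpace.basisFun (Fin k × Fin k) ℂ i)‖ ^ 2 ≤ θ * (k : ℝ) ^ 2 := by
    have h1 := congrArg norm (sum_sq_norm_sandwich P Q)
    rw [Complex.norm_real, Real.norm_of_nonneg (by positivity)] at h1
    refine (le_of_eq h1).trans ?_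
    have h2 : ∀ A : Matrix (Fin k) (Fin k) ℂ, ‖A.trace‖ = k * ‖ntr A‖ := fun A => by
      rw [ntr, norm_mul, norm_inv, Complex.norm_natCast, mul_inv_cancel_left₀ hk'.ne']
    calc _ ≤ ∑ j, ∑ l, ‖(star (P l) * P j).trace * (Q j * star (Q l)).trace‖ :=
          (norm_sum_le _ _).trans (Finset.sum_le_sum fun j _ => norm_sum_le _ _)
      _ = (∑ j, ∑ l, ‖ntr (star (P l) * P j)‖ * ‖ntr (Q j * star (Q l))‖) * (k : ℝ) ^ 2 := by
          simp only [Finset.sum_mul, norm_mul, h2]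
          exact Finset.sum_congr rfl fun j _ => Finset.sum_congr rfl fun l _ => by ring
      _ ≤ _ := by gcongr
  obtain ⟨N, c, hN, hc⟩ := exists_partition_of_hilbertSchmidt _ _ ht (mul_pos hsq hs)
    (mul_nonneg hsq.le hρ) hHS (Real.sqrt k * δ)
  refine ⟨N, fun Z => c (vecEquiv k Z), hN.trans (le_of_eq ?_), ?_⟩
  · congr 1
    rw [show 4 * (Real.sqrt k * ρ) / (Real.sqrt k * s) = 4 * ρ / s by field_simp]
    ring
  · intro Z Z' h1 h2 h3 h4 h5
    have key : ∀ A : Matrix (Fin k) (Fin k) ℂ, vecEquiv k A - ((vecEquiv k).toLinearMap ∘ₗ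
        sandwich P Q ∘ₗ (vecEquiv k).symm.toLinearMap) (vecEquiv k A) =
        vecEquiv k (A - ∑ j, P j * A * Q j) := fun A => by
      simp [sandwich_apply]
    have := hc (vecEquiv k Z) (vecEquiv k Z') ?_ ?_ ?_ ?_ h5
    · rw [← map_sub, norm_vecEquiv] at this
      refine le_of_mul_le_mul_left (this.trans (le_of_eq ?_)) hsq
      ring
    · rw [norm_vecEquiv]; gcongr
    · rw [norm_vecEquiv]; gcongr
    · rw [key, norm_vecEquiv]; gcongr
    · rw [key, norm_vecEquiv]; gcongr

/-- A real form of a complex vector space, i.e. the fixed points of a conjugation, has real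
dimension equal to the complex dimension of the space. -/
lemma finrank_fixedPoints_conj {V : Type*} [AddCommGroup V] [Module ℂ V]
    (σ : V →ₗ[ℝ] V) (h1 : ∀ v, σ (σ v) = v) (h2 : ∀ v, σ (Complex.I • v) = -(Complex.I • σ v))
    (W : Submodule ℝ V) (hW : ∀ v, v ∈ W ↔ σ v = v) [FiniteDimensional ℂ V] :
    finrank ℝ W = finrank ℂ V := by
  have hI : ∀ v : V, Complex.I • Complex.I • v = -v := fun v => by
    rw [smul_smul, Complex.I_mul_I, neg_one_smul]
  have : FiniteDimensional ℝ V := FiniteDimensional.trans ℝ ℂ V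
  let f : W × W →ₗ[ℝ] V :=
    { toFun := fun p => (p.1 : V) + Complex.I • (p.2 : V)
      map_add' := fun p q => by
        simp only [Prod.fst_add, Prod.snd_add, Submodule.coe_add, smul_add]
        abel
      map_smul' := fun c p => by
        simp only [Prod.smul_fst, Prod.smul_snd, Submodule.coe_smul, smul_add, RingHom.id_apply]
        rw [smul_comm] }
  have hσ : ∀ p : W × W, σ (f p) = p.1 - Complex.I • (p.2 : V) := fun p => by
    change σ ((p.1 : V) + Complex.I • (p.2 : V)) = _
    rw [map_add, h2, (hW _).1 p.1.2, (hW _).1 p.2.2, sub_eq_add_neg]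
  have hinj : Function.Injective f := by
    rw [← LinearMap.ker_eq_bot, LinearMap.ker_eq_bot']
    intro p hp
    have e1 : (p.1 : V) + Complex.I • (p.2 : V) = 0 := hp
    have e2 : (p.1 : V) - Complex.I • (p.2 : V) = 0 := by rw [← hσ, hp, map_zero]
    have e3 : (2 : ℝ) • (p.1 : V) = 0 := by
      rw [two_smul]
      calc (p.1 : V) + p.1
          = (p.1 + Complex.I • (p.2 : V)) + (p.1 - Complex.I • (p.2 : V)) := by abel
        _ = 0 := by rw [e1, e2, add_zero]
    have e4 : (p.1 : V) = 0 := (smul_eq_zero.1 e3).resolve_left two_ne_zero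
    have e5 : (p.2 : V) = 0 := by
      rw [e4, zero_add] at e1
      exact (smul_eq_zero.1 e1).resolve_left Complex.I_ne_zero
    exact Prod.ext (Subtype.ext e4) (Subtype.ext e5)
  have hsurj : Function.Surjective f := by
    intro v
    have m1 : (2⁻¹ : ℝ) • (v + σ v) ∈ W := by
      rw [hW, map_smul, map_add, h1, add_comm]
    have m2 : (2⁻¹ : ℝ) • (Complex.I • (σ v - v)) ∈ W := by
      rw [hW, map_smul, h2, map_sub, h1, ← smul_neg, neg_sub]
    refine ⟨(⟨_, m1⟩, ⟨_, m2⟩), ?_⟩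
    change (2⁻¹ : ℝ) • (v + σ v) + Complex.I • ((2⁻¹ : ℝ) • (Complex.I • (σ v - v))) = v
    rw [smul_comm Complex.I (2⁻¹ : ℝ), hI, ← smul_add, neg_sub, add_add_sub_cancel, ← two_smul ℝ v,
      smul_smul]
    norm_num
  have h3 := (LinearEquiv.ofBijective f ⟨hinj, hsurj⟩).finrank_eq
  rw [finrank_prod, finrank_real_of_complex] at h3
  omega

lemma exists_selfAdjoint_exp_of_unitary {k : ℕ} {U : Matrix (Fin k) (Fin k) ℂ}
    (hU : U ∈ unitary (Matrix (Fin k) (Fin k) ℂ)) :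
    ∃ a : selfAdjoint (Matrix (Fin k) (Fin k) ℂ), ‖(a : Matrix (Fin k) (Fin k) ℂ)‖ ≤ Real.pi ∧
      NormedSpace.exp (Complex.I • (a : Matrix (Fin k) (Fin k) ℂ)) = U := by
  have hn : IsStarNormal U := isStarNormal_of_mem_unitary hU
  have hcont : ContinuousOn (fun z : ℂ => (z.arg : ℂ)) (spectrum ℂ U) :=
    (Matrix.finite_spectrum U).continuousOn _
  refine ⟨⟨cfc (fun z : ℂ => (z.arg : ℂ)) U, IsSelfAdjoint.cfc_arg U⟩, ?_, ?_⟩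
  · exact norm_cfc_le (by positivity) fun y hy => by simpa using Complex.abs_arg_le_pi y
  · change NormedSpace.exp (Complex.I • cfc (fun z : ℂ => (z.arg : ℂ)) U) = U
    rw [← cfc_smul Complex.I (fun z : ℂ => (z.arg : ℂ)) U hcont,
      ← CFC.exp_eq_normedSpace_exp (𝕜 := ℂ) (cfc_predicate _ _),
      ← cfc_comp' NormedSpace.exp (fun z : ℂ => Complex.I • (z.arg : ℂ)) U
        (by rw [← Complex.exp_eq_exp_ℂ]; fun_prop) ((Matrix.finite_spectrum U).continuousOn _)]
    conv_rhs => rw [← cfc_id' ℂ U]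
    refine cfc_congr fun y hy => ?_
    have hy₁ : ‖y‖ = 1 := spectrum.norm_eq_one_of_unitary hU hy
    have h0 : y ≠ 0 := fun h => by simp [h] at hy₁
    have : Complex.I * y.arg = Complex.log y :=
      Complex.ext (by simp [Complex.log_re, hy₁]) (by simp [Complex.log_im])
    simpa [← Complex.exp_eq_exp_ℂ, this] using Complex.exp_log h0

lemma norm_pow_sub_pow_le {A : Type*} [NormedRing A] {a b : A} {r : ℝ} (hr : 0 ≤ r)
    (ha : ‖a‖ ≤ r) (hb : ‖b‖ ≤ r) (n : ℕ) :
    ‖a ^ (n + 1) - b ^ (n + 1)‖ ≤ (n + 1) * r ^ n * ‖a - b‖ := by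
  induction n with
  | zero => simp
  | succ n ih =>
    have h1 : ‖b ^ (n + 1)‖ ≤ r ^ (n + 1) :=
      (norm_pow_le' b n.succ_pos).trans (pow_le_pow_left₀ (norm_nonneg _) hb _)
    calc ‖a ^ (n + 2) - b ^ (n + 2)‖
        = ‖a * (a ^ (n + 1) - b ^ (n + 1)) + (a - b) * b ^ (n + 1)‖ := by
          rw [pow_succ' a, pow_succ' b (n + 1)]; congr 1; noncomm_ring
      _ ≤ r * ((n + 1) * r ^ n * ‖a - b‖) + ‖a - b‖ * r ^ (n + 1) := by
          refine (norm_add_le _ _).trans (add_le_add ?_ ?_)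
          · exact (norm_mul_le _ _).trans (by gcongr)
          · exact (norm_mul_le _ _).trans (by gcongr)
      _ = _ := by push_cast; ring

lemma norm_exp_sub_exp_le {A : Type*} [NormedRing A] [NormedAlgebra ℂ A] [CompleteSpace A]
    {a b : A} {r : ℝ} (hr : 0 ≤ r) (ha : ‖a‖ ≤ r) (hb : ‖b‖ ≤ r) :
    ‖NormedSpace.exp a - NormedSpace.exp b‖ ≤ Real.exp r * ‖a - b‖ := by
  have hs := fun x : A => NormedSpace.expSeries_summable' (𝕂 := ℂ) x
  have he : ∀ x : A, NormedSpace.exp x = ∑' n : ℕ, ((n.factorial : ℂ)⁻¹) • x ^ n := fun x =>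
    congrFun (NormedSpace.exp_eq_tsum ℂ) x
  rw [he, he, ← (hs a).tsum_sub (hs b),
    ((hs a).sub (hs b)).tsum_eq_zero_add]
  simp only [pow_zero, sub_self, zero_add]
  have hr' : HasSum (fun n : ℕ => (r ^ n / n.factorial) * ‖a - b‖) (Real.exp r * ‖a - b‖) := by
    refine HasSum.mul_right _ ?_
    rw [Real.exp_eq_exp_ℝ]
    exact NormedSpace.expSeries_div_hasSum_exp r
  refine tsum_of_norm_bounded hr' fun n => ?_
  rw [← smul_sub, norm_smul, norm_inv, Complex.norm_natCast]
  calc ((n + 1).factorial : ℝ)⁻¹ * ‖a ^ (n + 1) - b ^ (n + 1)‖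
      ≤ ((n + 1).factorial : ℝ)⁻¹ * ((n + 1) * r ^ n * ‖a - b‖) := by
        gcongr; exact norm_pow_sub_pow_le hr ha hb n
    _ = _ := by
        rw [Nat.factorial_succ]; push_cast
        have : (n.factorial : ℝ) ≠ 0 := by positivity
        have : (n + 1 : ℝ) ≠ 0 := by positivity
        field_simp

/-- The unitary group of `k × k` matrices can be partitioned into at most `(1 + C/s)^{k²}` classes
of diameter at most `s` in the operator norm: it is the image, under the exponential map, of a ball
in the `k²`-dimensional real space of Hermitian matrices. -/
lemma exists_partition_unitary : ∃ C : ℝ, 0 < C ∧ ∀ (k : ℕ) (s : ℝ), 0 < s →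
    ∃ (N : ℕ) (c : Matrix (Fin k) (Fin k) ℂ → Fin N), (N : ℝ) ≤ (1 + C / s) ^ (k ^ 2) ∧
      ∀ U V, U ∈ Matrix.unitaryGroup (Fin k) ℂ → V ∈ Matrix.unitaryGroup (Fin k) ℂ →
        c U = c V → ‖U - V‖ ≤ s := by
  classical
  refine ⟨4 * Real.pi * Real.exp Real.pi, by positivity, fun k s hs => ?_⟩
  let W : Submodule ℝ (Matrix (Fin k) (Fin k) ℂ) := selfAdjoint.submodule ℝ _
  have hW : finrank ℝ W = k ^ 2 := by
    rw [finrank_fixedPoints_conj (V := Matrix (Fin k) (Fin k) ℂ)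
      { toFun := star, map_add' := star_add, map_smul' := fun c v => by simp } star_star
      (fun v => by simp) W (fun v => Iff.rfl)]
    simp [Module.finrank_matrix, sq]
  obtain ⟨N, c, hN, hc⟩ := exists_partition_ball W Real.pi_pos.le
    (show 0 < s / Real.exp Real.pi by positivity)
  have hex : ∀ U : Matrix (Fin k) (Fin k) ℂ, ∃ a : W, U ∈ Matrix.unitaryGroup (Fin k) ℂ →
      ‖a‖ ≤ Real.pi ∧ NormedSpace.exp (Complex.I • (a : Matrix (Fin k) (Fin k) ℂ)) = U := by
    intro U
    by_cases hU : U ∈ Matrix.unitaryGroup (Fin k) ℂ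
    · obtain ⟨a, ha⟩ := exists_selfAdjoint_exp_of_unitary hU
      exact ⟨⟨a, a.2⟩, fun _ => ha⟩
    · exact ⟨0, fun h => absurd h hU⟩
  choose f hf using hex
  refine ⟨N, fun U => c (f U), ?_, ?_⟩
  · rw [hW] at hN
    refine hN.trans (le_of_eq ?_)
    congr 2
    field_simp
  · intro U V hU hV hUV
    have h1 := hc _ _ (hf U hU).1 (hf V hV).1 hUV
    have hI : ∀ a : W, ‖Complex.I • (a : Matrix (Fin k) (Fin k) ℂ)‖ = ‖a‖ := fun a => by
      rw [norm_smul]; simp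
    rw [← (hf U hU).2, ← (hf V hV).2]
    calc _ ≤ Real.exp Real.pi * ‖Complex.I • (f U : Matrix (Fin k) (Fin k) ℂ)
            - Complex.I • (f V : Matrix (Fin k) (Fin k) ℂ)‖ :=
          norm_exp_sub_exp_le Real.pi_pos.le ((hI _).trans_le (hf U hU).1)
            ((hI _).trans_le (hf V hV).1)
      _ = Real.exp Real.pi * ‖f U - f V‖ := by
          rw [← smul_sub, ← hI (f U - f V)]; simp
      _ ≤ Real.exp Real.pi * (s / Real.exp Real.pi) := by gcongr
      _ = s := by field_simp

end MatrixCovering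

/-! ### Orbit-small families of matrix-valued functions -/

section Small

open Filter Topology
open scoped Matrix.Norms.L2Operator

/-- Matrix-valued functions on a sequence of index sets `X k`, with values in `k × k` matrices
at size `k`. -/
abbrev Sec (X : ℕ → Type) : Type := ∀ k, X k → Matrix (Fin k) (Fin k) ℂ

variable {X : ℕ → Type} {l : Filter (Σ k, X k)}

/-- Uniform boundedness in the operator norm. -/
def IsBddSec (F : Sec X) : Prop := ∃ C, ∀ k a, ‖F k a‖ ≤ C

/-- Convergence to zero in the 2-norm along the filter `l`. -/
def IsNull (l : Filter (Σ k, X k)) (F : Sec X) : Prop :=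
  Tendsto (fun i : Σ k, X k => hsnorm (F i.1 i.2)) l (𝓝 0)

/-- `S` is orbit-small along `l`: for each finite subset `T` and all `ω, η > 0`, the indices of
size `k` in some member of `l` can be partitioned into at most `exp(η k²)` classes such that, within
a class, the values of `T` at two indices are simultaneously unitarily conjugate up to `ω`. -/
def Small (l : Filter (Σ k, X k)) (S : Set (Sec X)) : Prop :=
  ∀ T ⊆ S, T.Finite → ∀ ω > 0, ∀ η > 0, ∃ U ∈ l, ∀ k, ∃ (κ : Type) (_ : Fintype κ) (c : X k → κ),
    (Fintype.card κ : ℝ) ≤ Real.exp (η * (k : ℝ) ^ 2) ∧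
    ∀ a b, (⟨k, a⟩ : Σ k, X k) ∈ U → (⟨k, b⟩ : Σ k, X k) ∈ U → c a = c b →
      ∃ W ∈ Matrix.unitaryGroup (Fin k) ℂ, ∀ F ∈ T, hsnorm (F k a - W * F k b * star W) < ω

lemma Small.mono {S S' : Set (Sec X)} (h : Small l S) (hS : S' ⊆ S) : Small l S' :=
  fun T hT => h T (hT.trans hS)

lemma small_of_finite_subsets {S : Set (Sec X)} (h : ∀ T ⊆ S, T.Finite → Small l T) : Small l S :=
  fun T hT hf => h T hT hf T le_rfl hf

/-- `G` depends continuously, in the 2-norm and equivariantly for unitary conjugation, on finitely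
many elements of `S`. -/
def Controlled (l : Filter (Σ k, X k)) (S : Set (Sec X)) (G : Sec X) : Prop :=
  ∀ δ > 0, ∃ T ⊆ S, T.Finite ∧ ∃ ω > 0, ∃ U ∈ l, ∀ k a b W,
    (⟨k, a⟩ : Σ k, X k) ∈ U → (⟨k, b⟩ : Σ k, X k) ∈ U → W ∈ Matrix.unitaryGroup (Fin k) ℂ →
    (∀ F ∈ T, hsnorm (F k a - W * F k b * star W) < ω) → hsnorm (G k a - W * G k b * star W) < δ

lemma controlled_of_mem {S : Set (Sec X)} {F : Sec X} (hF : F ∈ S) : Controlled l S F :=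
  fun δ hδ => ⟨{F}, by simpa using hF, Set.finite_singleton F, δ, hδ, Set.univ, univ_mem,
    fun _ _ _ _ _ _ _ h => h F rfl⟩

/-- Two controlled functions can be controlled at the same time. -/
lemma Controlled.and {S : Set (Sec X)} {F G : Sec X} (hF : Controlled l S F)
    (hG : Controlled l S G) {δ δ' : ℝ} (hδ : 0 < δ) (hδ' : 0 < δ') :
    ∃ T ⊆ S, T.Finite ∧ ∃ ω > 0, ∃ U ∈ l, ∀ k a b W,
      (⟨k, a⟩ : Σ k, X k) ∈ U → (⟨k, b⟩ : Σ k, X k) ∈ U → W ∈ Matrix.unitaryGroup (Fin k) ℂ →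
      (∀ F ∈ T, hsnorm (F k a - W * F k b * star W) < ω) →
        hsnorm (F k a - W * F k b * star W) < δ ∧ hsnorm (G k a - W * G k b * star W) < δ' := by
  obtain ⟨T1, hT1, hf1, ω1, hω1, U1, hU1, h1⟩ := hF δ hδ
  obtain ⟨T2, hT2, hf2, ω2, hω2, U2, hU2, h2⟩ := hG δ' hδ'
  refine ⟨T1 ∪ T2, Set.union_subset hT1 hT2, hf1.union hf2, min ω1 ω2, lt_min hω1 hω2, U1 ∩ U2,
    inter_mem hU1 hU2, fun k a b W ha hb hW h => ⟨?_, ?_⟩⟩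
  · exact h1 k a b W ha.1 hb.1 hW fun F hF => (h F (Or.inl hF)).trans_le (min_le_left _ _)
  · exact h2 k a b W ha.2 hb.2 hW fun F hF => (h F (Or.inr hF)).trans_le (min_le_right _ _)

lemma Controlled.add {S : Set (Sec X)} {F G : Sec X} (hF : Controlled l S F)
    (hG : Controlled l S G) : Controlled l S (F + G) := by
  intro δ hδ
  obtain ⟨T, hT, hf, ω, hω, U, hU, h⟩ := hF.and hG (half_pos hδ) (half_pos hδ)
  refine ⟨T, hT, hf, ω, hω, U, hU, fun k a b W ha hb hW hT' => ?_⟩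
  obtain ⟨h1, h2⟩ := h k a b W ha hb hW hT'
  calc hsnorm ((F + G) k a - W * (F + G) k b * star W)
      = hsnorm ((F k a - W * F k b * star W) + (G k a - W * G k b * star W)) := by
        congr 1; simp only [Pi.add_apply]; noncomm_ring
    _ ≤ _ := (isTrace_ntrLin k).tnorm_add_le _ _
    _ < δ := by linarith

lemma Controlled.smul {S : Set (Sec X)} {F : Sec X} (hF : Controlled l S F) (c : ℂ) :
    Controlled l S (c • F) := by
  intro δ hδ
  obtain ⟨T, hT, hf, ω, hω, U, hU, h⟩ := hF (δ / (‖c‖ + 1)) (by positivity)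
  refine ⟨T, hT, hf, ω, hω, U, hU, fun k a b W ha hb hW hT' => ?_⟩
  have h1 := h k a b W ha hb hW hT'
  rw [lt_div_iff₀ (by positivity)] at h1
  calc hsnorm ((c • F) k a - W * (c • F) k b * star W)
      = ‖c‖ * hsnorm (F k a - W * F k b * star W) := by
        rw [← (isTrace_ntrLin k).tnorm_smul]; congr 1
        simp only [Pi.smul_apply, smul_sub, mul_smul_comm, smul_mul_assoc]
    _ ≤ hsnorm (F k a - W * F k b * star W) * (‖c‖ + 1) := by
        rw [mul_comm]; gcongr; · exact tnorm_nonneg _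
        · linarith
    _ < δ := h1

lemma controlled_star {S : Set (Sec X)} {F : Sec X} (hF : Controlled l S F) :
    Controlled l S (star F) := by
  intro δ hδ
  obtain ⟨T, hT, hf, ω, hω, U, hU, h⟩ := hF δ hδ
  refine ⟨T, hT, hf, ω, hω, U, hU, fun k a b W ha hb hW hT' => ?_⟩
  convert h k a b W ha hb hW hT' using 1
  rw [hsnorm, ← (isTrace_ntrLin k).tnorm_star]
  congr 1
  simp only [Pi.star_apply, star_sub, star_mul, star_star, mul_assoc]

lemma IsBddSec.pos {F : Sec X} (hF : IsBddSec F) : ∃ C > 0, ∀ k a, ‖F k a‖ ≤ C := by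
  obtain ⟨C, hC⟩ := hF
  exact ⟨max C 1, by positivity, fun k a => (hC k a).trans (le_max_left _ _)⟩

lemma Controlled.mul {S : Set (Sec X)} {F G : Sec X} (hF : Controlled l S F)
    (hG : Controlled l S G) (hbF : IsBddSec F) (hbG : IsBddSec G) : Controlled l S (F * G) := by
  obtain ⟨C, hC, hFC⟩ := hbF.pos
  obtain ⟨D, hD, hGD⟩ := hbG.pos
  intro δ hδ
  obtain ⟨T, hT, hf, ω, hω, U, hU, h⟩ := hF.and hG (δ := δ / (2 * D)) (δ' := δ / (2 * C))
    (by positivity) (by positivity)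
  refine ⟨T, hT, hf, ω, hω, U, hU, fun k a b W ha hb hW hT' => ?_⟩
  obtain ⟨h1, h2⟩ := h k a b W ha hb hW hT'
  have ht := isTrace_ntrLin k
  have hWW : star W * W = 1 := Unitary.star_mul_self_of_mem hW
  have e : (F * G) k a - W * (F * G) k b * star W = F k a * (G k a - W * G k b * star W)
      + (F k a - W * F k b * star W) * (W * G k b * star W) := by
    have : W * F k b * star W * (W * G k b * star W) = W * (F k b * G k b) * star W := by
      calc _ = W * F k b * (star W * W) * G k b * star W := by noncomm_ring
        _ = _ := by rw [hWW]; noncomm_ring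
    simp only [Pi.mul_apply, sub_mul, mul_sub, this]
    abel
  have hWn := IsTrace.norm_le_one_of_mem_unitary hW
  have hWG : ‖W * G k b * star W‖ ≤ D := by
    calc _ ≤ ‖W‖ * ‖G k b‖ * ‖star W‖ := (norm_mul_le _ _).trans (by gcongr; exact norm_mul_le _ _)
      _ ≤ 1 * D * 1 := by rw [norm_star]; gcongr; exact hGD _ _
      _ = D := by ring
  rw [e]
  calc _ ≤ ‖F k a‖ * hsnorm (G k a - W * G k b * star W)
        + hsnorm (F k a - W * F k b * star W) * ‖W * G k b * star W‖ :=
        (ht.tnorm_add_le _ _).trans (add_le_add (ht.tnorm_mul_le_left _ _)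
          (ht.tnorm_mul_le_right _ _))
    _ ≤ C * hsnorm (G k a - W * G k b * star W)
        + hsnorm (F k a - W * F k b * star W) * D := by
        gcongr
        · exact tnorm_nonneg _
        · exact hFC _ _
        · exact tnorm_nonneg _
    _ < C * (δ / (2 * C)) + (δ / (2 * D)) * D := by gcongr
    _ = δ := by field_simp; ring

lemma controlled_one {S : Set (Sec X)} : Controlled l S (1 : Sec X) := by
  intro δ hδ
  refine ⟨∅, Set.empty_subset _, Set.finite_empty, 1, one_pos, Set.univ, univ_mem,
    fun k a b W _ _ hW _ => ?_⟩
  have : W * star W = 1 := Unitary.mul_star_self_of_mem hW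
  simpa [this] using hδ

lemma Controlled.of_approx {S : Set (Sec X)} {G : Sec X}
    (h : ∀ δ > 0, ∃ G', Controlled l S G' ∧ ∀ᶠ i in l, hsnorm (G i.1 i.2 - G' i.1 i.2) < δ) :
    Controlled l S G := by
  intro δ hδ
  obtain ⟨G', hG', hU'⟩ := h (δ / 3) (by positivity)
  obtain ⟨T, hT, hf, ω, hω, U, hU, h⟩ := hG' (δ / 3) (by positivity)
  refine ⟨T, hT, hf, ω, hω, U ∩ {i | hsnorm (G i.1 i.2 - G' i.1 i.2) < δ / 3},
    inter_mem hU hU', fun k a b W ha hb hW hT' => ?_⟩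
  have h1 := h k a b W ha.1 hb.1 hW hT'
  have h2 : hsnorm (G k a - G' k a) < δ / 3 := ha.2
  have h3 : hsnorm (G k b - G' k b) < δ / 3 := hb.2
  have ht := isTrace_ntrLin k
  rw [hsnorm, ← ht.tnorm_conj_unitary hW] at h3
  calc hsnorm (G k a - W * G k b * star W) = hsnorm ((G k a - G' k a)
        + (G' k a - W * G' k b * star W) - W * (G k b - G' k b) * star W) := by
        congr 1; noncomm_ring
    _ ≤ hsnorm (G k a - G' k a) + hsnorm (G' k a - W * G' k b * star W)
        + hsnorm (W * (G k b - G' k b) * star W) :=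
        (ht.tnorm_sub_le _ _).trans (by gcongr; exact ht.tnorm_add_le _ _)
    _ < δ := by linarith

lemma Controlled.of_isNull {S : Set (Sec X)} {F G : Sec X} (hF : Controlled l S F)
    (h : IsNull l (G - F)) : Controlled l S G :=
  Controlled.of_approx fun _ hδ => ⟨F, hF, h.eventually (gt_mem_nhds hδ)⟩

lemma controlled_finite {S T' : Set (Sec X)} (hf' : T'.Finite) (h : ∀ G ∈ T', Controlled l S G)
    {δ : ℝ} (hδ : 0 < δ) : ∃ T ⊆ S, T.Finite ∧ ∃ ω > 0, ∃ U ∈ l, ∀ k a b W,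
      (⟨k, a⟩ : Σ k, X k) ∈ U → (⟨k, b⟩ : Σ k, X k) ∈ U → W ∈ Matrix.unitaryGroup (Fin k) ℂ →
      (∀ F ∈ T, hsnorm (F k a - W * F k b * star W) < ω) →
        ∀ G ∈ T', hsnorm (G k a - W * G k b * star W) < δ := by
  induction T', hf' using Set.Finite.induction_on with
  | empty =>
    exact ⟨∅, Set.empty_subset _, Set.finite_empty, 1, one_pos, Set.univ, univ_mem,
      fun k a b W _ _ _ _ G hG => absurd hG (Set.notMem_empty G)⟩
  | @insert G T' _ _ ih =>
    obtain ⟨T1, hT1, hf1, ω1, hω1, U1, hU1, h1⟩ :=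
      ih fun G' hG' => h G' (Set.mem_insert_of_mem _ hG')
    obtain ⟨T2, hT2, hf2, ω2, hω2, U2, hU2, h2⟩ := h G (Set.mem_insert _ _) δ hδ
    refine ⟨T1 ∪ T2, Set.union_subset hT1 hT2, hf1.union hf2, min ω1 ω2, lt_min hω1 hω2, U1 ∩ U2,
      inter_mem hU1 hU2, fun k a b W ha hb hW hT G' hG' => ?_⟩
    rcases Set.mem_insert_iff.1 hG' with rfl | hG'
    · exact h2 k a b W ha.2 hb.2 hW fun F hF => (hT F (Or.inr hF)).trans_le (min_le_right _ _)
    · exact h1 k a b W ha.1 hb.1 hW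
        (fun F hF => (hT F (Or.inl hF)).trans_le (min_le_left _ _)) G' hG'

/-- Functions controlled by an orbit-small family form an orbit-small family. -/
lemma Small.of_controlled {S S' : Set (Sec X)} (hS : Small l S)
    (h : ∀ G ∈ S', Controlled l S G) : Small l S' := by
  intro T' hT' hf' ω hω η hη
  obtain ⟨T, hT, hf, ω', hω', U, hU, h1⟩ := controlled_finite hf' (fun G hG => h G (hT' hG)) hω
  obtain ⟨U', hU', h2⟩ := hS T hT hf ω' hω' η hη
  refine ⟨U ∩ U', inter_mem hU hU', fun k => ?_⟩
  obtain ⟨κ, hκ, c, hcard, hc⟩ := h2 k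
  refine ⟨κ, hκ, c, hcard, fun a b ha hb hab => ?_⟩
  obtain ⟨W, hW, hWT⟩ := hc a b ha.2 hb.2 hab
  exact ⟨W, hW, h1 k a b W ha.1 hb.1 hW hWT⟩

lemma exists_diagonalization {k : ℕ} {A : Matrix (Fin k) (Fin k) ℂ} (hA : A.IsHermitian) :
    ∃ V ∈ Matrix.unitaryGroup (Fin k) ℂ, ∃ v : Fin k → ℝ,
      A = V * Matrix.diagonal (fun i => (v i : ℂ)) * star V ∧ ∀ i, ‖v i‖ ≤ ‖A‖ := by
  have hspec : A = hA.eigenvectorUnitary * Matrix.diagonal (fun i => (hA.eigenvalues i : ℂ)) *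
      star (hA.eigenvectorUnitary : Matrix (Fin k) (Fin k) ℂ) := by
    conv_lhs => rw [hA.spectral_theorem]
    rfl
  have hV := Unitary.star_mul_self_of_mem hA.eigenvectorUnitary.2
  have hV1 := IsTrace.norm_le_one_of_mem_unitary hA.eigenvectorUnitary.2
  have hV2 := hA.eigenvectorUnitary.2
  generalize hA.eigenvalues = v at hspec
  generalize (hA.eigenvectorUnitary : Matrix (Fin k) (Fin k) ℂ) = V at *
  refine ⟨V, hV2, v, hspec, fun i => ?_⟩
  have h1 : Matrix.diagonal (fun i => (v i : ℂ)) = star V * A * V := by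
    rw [hspec]
    generalize Matrix.diagonal (fun i => (v i : ℂ)) = D
    calc D = (star V * V) * D * (star V * V) := by rw [hV, one_mul, mul_one]
      _ = _ := by noncomm_ring
  have h2 : ‖Matrix.diagonal (fun i => (v i : ℂ))‖ ≤ ‖A‖ := by
    rw [h1]
    calc _ ≤ ‖star V‖ * ‖A‖ * ‖V‖ := (norm_mul_le _ _).trans (by gcongr; exact norm_mul_le _ _)
      _ ≤ 1 * ‖A‖ * 1 := by rw [norm_star]; gcongr
      _ = ‖A‖ := by ring
  rw [Matrix.l2_opNorm_diagonal] at h2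
  simpa using (norm_le_pi_norm (fun i => (v i : ℂ)) i).trans h2

/-- A single bounded Hermitian-valued function is orbit-small: after diagonalization there are only
`k` real parameters, and `k = o(k²)`. -/
lemma small_singleton_of_isHermitian (hl : Tendsto Sigma.fst l atTop) {F : Sec X}
    (hsa : ∀ k a, (F k a).IsHermitian) (hF : IsBddSec F) : Small l {F} := by
  classical
  obtain ⟨R, hR, hFR⟩ := hF.pos
  intro T hT _ ω hω η hη
  obtain ⟨N, c, -, hc⟩ := exists_partition_ball ℝ hR.le (half_pos hω)
  refine ⟨{i | Real.log N / η ≤ i.1}, hl.eventually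
    (tendsto_natCast_atTop_atTop.eventually_ge_atTop (Real.log N / η)), fun k => ?_⟩
  by_cases hk : Real.log N / η ≤ k
  swap
  · exact ⟨Unit, inferInstance, fun _ => (), by simpa using by positivity,
      fun a b ha => absurd ha hk⟩
  choose V hV v hv hvn using fun a => exists_diagonalization (hsa k a)
  refine ⟨Fin k → Fin N, inferInstance, fun a i => c (v a i), ?_, ?_⟩
  · rw [Fintype.card_fun, Fintype.card_fin, Fintype.card_fin]
    push_cast
    rw [div_le_iff₀ hη] at hk
    have hN : (0 : ℝ) < N := by exact_mod_cast Fin.pos (c 0)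
    rw [← Real.rpow_natCast, Real.rpow_def_of_pos hN]
    refine Real.exp_le_exp.2 ?_
    calc Real.log N * k ≤ k * η * k := by gcongr
      _ = _ := by ring
  · intro a b _ _ hab
    have ht := isTrace_ntrLin k
    refine ⟨V a * star (V b), mul_mem (hV a) (Unitary.star_mem (hV b)), fun G hG => ?_⟩
    rw [Set.mem_singleton_iff.1 (hT hG)]
    have hVb : star (V b) * V b = 1 := Unitary.star_mul_self_of_mem (hV b)
    have e : F k a - (V a * star (V b)) * F k b * star (V a * star (V b)) =
        V a * Matrix.diagonal (fun i => ((v a i - v b i : ℝ) : ℂ)) * star (V a) := by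
      have hd : Matrix.diagonal (fun i => ((v a i - v b i : ℝ) : ℂ)) =
          Matrix.diagonal (fun i => (v a i : ℂ)) - Matrix.diagonal (fun i => (v b i : ℂ)) := by
        rw [Matrix.diagonal_sub]; simp
      rw [hd, mul_sub, sub_mul, ← hv a]
      congr 1
      conv_lhs => rw [hv b, star_mul, star_star]
      generalize Matrix.diagonal (fun i => (v b i : ℂ)) = D
      calc _ = V a * (star (V b) * V b) * D * (star (V b) * V b) * star (V a) := by noncomm_ring
        _ = _ := by rw [hVb, mul_one, mul_one]
    rw [e, hsnorm, ht.tnorm_conj_unitary (hV a)]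
    refine ((ht.tnorm_le_norm _).trans ?_).trans_lt (half_lt_self hω)
    rw [Matrix.l2_opNorm_diagonal]
    refine (pi_norm_le_iff_of_nonneg (half_pos hω).le).2 fun i => ?_
    rw [Complex.norm_real]
    exact hc _ _ ((hvn a i).trans (hFR _ _)) ((hvn b i).trans (hFR _ _)) (congrFun hab i)

end Small

section Sandwich

open Filter Topology
open scoped Matrix.Norms.L2Operator

variable {X : ℕ → Type} {l : Filter (Σ k, X k)}

lemma exists_uniform_bound {N : ℕ} {P : Fin N → Sec X} (hP : ∀ j, IsBddSec (P j)) :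
    ∃ C > 0, ∀ j k a, ‖P j k a‖ ≤ C := by
  choose C hC hPC using fun j => (hP j).pos
  have hsum := Finset.sum_nonneg fun j (_ : j ∈ Finset.univ) => (hC j).le
  refine ⟨1 + ∑ j, C j, by linarith, fun j k a => (hPC j k a).trans ?_⟩
  have := Finset.single_le_sum (f := C) (fun j _ => (hC j).le) (Finset.mem_univ j)
  linarith

/-- Transport of an approximate intertwining relation to an approximately conjugate pair of
families. -/
lemma hsnorm_sub_sandwich_le {k N : ℕ} {P Q P' Q' : Fin N → Matrix (Fin k) (Fin k) ℂ}
    {Y W : Matrix (Fin k) (Fin k) ℂ} (hW : W ∈ Matrix.unitaryGroup (Fin k) ℂ) {C ρ ω : ℝ}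
    (hP : ∀ j, ‖P j‖ ≤ C) (hQ' : ∀ j, ‖Q' j‖ ≤ C) (hY : ‖Y‖ ≤ ρ)
    (hPP : ∀ j, hsnorm (P j - W * P' j * star W) ≤ ω)
    (hQQ : ∀ j, hsnorm (Q j - W * Q' j * star W) ≤ ω) :
    hsnorm (star W * Y * W - ∑ j, P' j * (star W * Y * W) * Q' j) ≤
      hsnorm (Y - ∑ j, P j * Y * Q j) + N * (2 * C * ρ * ω) := by
  have ht := isTrace_ntrLin k
  have h1 : star W * W = 1 := Unitary.star_mul_self_of_mem hW
  have h2 : W * star W = 1 := Unitary.mul_star_self_of_mem hW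
  have hWn := IsTrace.norm_le_one_of_mem_unitary hW
  have hρ : 0 ≤ ρ := (norm_nonneg _).trans hY
  have e : W * (star W * Y * W - ∑ j, P' j * (star W * Y * W) * Q' j) * star W =
      (Y - ∑ j, P j * Y * Q j) + ∑ j, (P j * Y * (Q j - W * Q' j * star W) +
        (P j - W * P' j * star W) * (Y * (W * Q' j * star W))) := by
    have e1 : W * (star W * Y * W) * star W = Y := by
      calc _ = (W * star W) * Y * (W * star W) := by noncomm_ring
        _ = Y := by rw [h2, one_mul, mul_one]
    have e2 : ∀ j, W * (P' j * (star W * Y * W) * Q' j) * star W =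
        (W * P' j * star W) * Y * (W * Q' j * star W) := fun j => by noncomm_ring
    rw [mul_sub, sub_mul, e1, Finset.mul_sum, Finset.sum_mul, sub_add, ← Finset.sum_sub_distrib]
    congr 1
    refine Finset.sum_congr rfl fun j _ => ?_
    rw [e2]; noncomm_ring
  rw [hsnorm, ← ht.tnorm_conj_unitary hW, e]
  refine (ht.tnorm_add_le _ _).trans (add_le_add le_rfl ((ht.tnorm_sum_le _ _).trans ?_))
  calc _ ≤ ∑ j : Fin N, 2 * C * ρ * ω := Finset.sum_le_sum fun j _ => ?_
    _ = N * (2 * C * ρ * ω) := by simp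
  have hC : 0 ≤ C := (norm_nonneg _).trans (hP j)
  have hω : 0 ≤ ω := (tnorm_nonneg _).trans (hPP j)
  have hWQ : ‖W * Q' j * star W‖ ≤ C := by
    calc _ ≤ ‖W‖ * ‖Q' j‖ * ‖star W‖ := (norm_mul_le _ _).trans (by gcongr; exact norm_mul_le _ _)
      _ ≤ 1 * C * 1 := by rw [norm_star]; gcongr; exact hQ' j
      _ = C := by ring
  calc _ ≤ ‖P j * Y‖ * hsnorm (Q j - W * Q' j * star W)
        + hsnorm (P j - W * P' j * star W) * ‖Y * (W * Q' j * star W)‖ :=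
        (ht.tnorm_add_le _ _).trans (add_le_add (ht.tnorm_mul_le_left _ _)
          (ht.tnorm_mul_le_right _ _))
    _ ≤ (C * ρ) * ω + ω * (ρ * C) := by
        gcongr
        · exact tnorm_nonneg _
        · exact (norm_mul_le _ _).trans (by gcongr; exact hP j)
        · exact hQQ j
        · exact hPP j
        · exact (norm_mul_le _ _).trans (by gcongr)
    _ = _ := by ring

/-- **Adjoining approximate intertwiners.** Suppose that, for each `θ`, each `Y_r` satisfies
`Y_r ≈ ∑ j, P_j Y_r Q_j` for families `P`, `Q` of a common orbit-small set with
`∑_{j,l} |τ(P_l* P_j)| |τ(Q_j Q_l*)| ≤ θ`. Then the `Y_r` may be adjoined without destroying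
orbit-smallness: given the orbit of the old family, `Y_r` is close to a space of dimension
`O(θ k²)`. -/
theorem small_union_of_sandwich {T₀ : Set (Sec X)} (hT₀ : T₀.Finite) {m : ℕ} (Y : Fin m → Sec X)
    (hY : ∀ r, IsBddSec (Y r))
    (h : ∀ θ > 0, ∃ (N : ℕ) (P Q : Fin N → Sec X), (∀ j, IsBddSec (P j)) ∧ (∀ j, IsBddSec (Q j)) ∧
      Small l (T₀ ∪ (Set.range P ∪ Set.range Q)) ∧ (∀ r, IsNull l (Y r - ∑ j, P j * Y r * Q j)) ∧
      ∀ᶠ i in l, ∑ j, ∑ j', ‖ntr (star (P j' i.1 i.2) * P j i.1 i.2)‖ *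
        ‖ntr (Q j i.1 i.2 * star (Q j' i.1 i.2))‖ ≤ θ) :
    Small l (T₀ ∪ Set.range Y) := by
  classical
  intro T hT _ ω hω η hη
  obtain ⟨ρ, hρ, hYρ⟩ := exists_uniform_bound hY
  -- with these `s`, `t` and the error `ω / 16`, the net estimate `s + 2 (ω / 16) + 2 t ρ` is less
  -- than `ω / 2`
  set s := ω / 8 with hs
  set t := ω / (16 * ρ) with ht'
  have hs0 : 0 < s := by positivity
  have ht0 : 0 < t := by positivity
  set L := Real.log (1 + 4 * ρ / s) with hL
  have hL0 : 0 ≤ L := Real.log_nonneg (by have : 0 ≤ 4 * ρ / s := by positivity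
                                          linarith)
  set θ := (η / 2) / ((m + 1) * (2 / t ^ 2) * (L + 1)) with hθ
  have hθ0 : 0 < θ := by positivity
  obtain ⟨N, P, Q, hPb, hQb, hsmall, hnull, htr⟩ := h θ hθ0
  obtain ⟨C₁, hC₁, hPC₁⟩ := exists_uniform_bound hPb
  obtain ⟨C₂, hC₂, hQC₂⟩ := exists_uniform_bound hQb
  set C := max C₁ C₂ with hC
  have hC0 : 0 < C := lt_max_of_lt_left hC₁
  -- conjugating the `P_j`, `Q_j` up to `ω'` changes `∑ j, P_j Y_r Q_j` by at most
  -- `N (2 C ρ ω') ≤ ω / 32`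
  set ω' := min (ω / 4) (ω / 32 / ((N + 1) * (2 * C * ρ))) with hω'
  have hω'0 : 0 < ω' := lt_min (by positivity) (by positivity)
  obtain ⟨U', hU', hcov⟩ := hsmall _ le_rfl
    (hT₀.union ((Set.finite_range P).union (Set.finite_range Q))) ω' hω'0 (η / 2) (half_pos hη)
  have hev : ∀ᶠ i in l, ∀ r, hsnorm ((Y r - ∑ j, P j * Y r * Q j) i.1 i.2) < ω / 32 :=
    eventually_all.2 fun r => (hnull r).eventually (gt_mem_nhds (by positivity))
  refine ⟨U' ∩ ({i | ∀ r, hsnorm ((Y r - ∑ j, P j * Y r * Q j) i.1 i.2) < ω / 32} ∩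
    {i | ∑ j, ∑ j', ‖ntr (star (P j' i.1 i.2) * P j i.1 i.2)‖ *
        ‖ntr (Q j i.1 i.2 * star (Q j' i.1 i.2))‖ ≤ θ}), inter_mem hU' (inter_mem hev htr),
    fun k => ?_⟩
  set U := U' ∩ ({i : Σ k, X k | ∀ r, hsnorm ((Y r - ∑ j, P j * Y r * Q j) i.1 i.2) < ω / 32} ∩
    {i | ∑ j, ∑ j', ‖ntr (star (P j' i.1 i.2) * P j i.1 i.2)‖ *
        ‖ntr (Q j i.1 i.2 * star (Q j' i.1 i.2))‖ ≤ θ}) with hU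
  obtain ⟨κ, hκ, c, hcard, hc⟩ := hcov k
  have htk := isTrace_ntrLin k
  set E := Real.exp (2 * θ / t ^ 2 * L * (k : ℝ) ^ 2) with hE
  -- for each base point in `U`, a net for the solutions of the intertwining relation over it
  have hnet : ∀ a₀ : X k, ∃ f : Matrix (Fin k) (Fin k) ℂ → Fin ⌊E⌋₊,
      (⟨k, a₀⟩ : Σ k, X k) ∈ U → ∀ Z Z', hsnorm Z ≤ ρ → hsnorm Z' ≤ ρ →
        hsnorm (Z - ∑ j, P j k a₀ * Z * Q j k a₀) ≤ ω / 16 →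
        hsnorm (Z' - ∑ j, P j k a₀ * Z' * Q j k a₀) ≤ ω / 16 → f Z = f Z' →
        hsnorm (Z - Z') ≤ s + 2 * (ω / 16) + 2 * t * ρ := by
    intro a₀
    have hE1 : 0 < ⌊E⌋₊ := Nat.floor_pos.2 (Real.one_le_exp (by positivity))
    by_cases ha : (⟨k, a₀⟩ : Σ k, X k) ∈ U
    · obtain ⟨N', f, hN', hf⟩ := exists_partition_sandwich (fun j => P j k a₀) (fun j => Q j k a₀)
        (δ := ω / 16) ht0 hs0 hρ.le ha.2.2
      refine ⟨fun Z => Fin.castLE (Nat.le_floor hN') (f Z), fun _ Z Z' h1 h2 h3 h4 h5 => ?_⟩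
      exact hf Z Z' h1 h2 h3 h4 (Fin.castLE_injective _ h5)
    · exact ⟨fun _ => ⟨0, hE1⟩, fun h => absurd h ha⟩
  choose f hf using hnet
  -- a base point for each class of the old family
  let rep : κ → Option (X k) := fun x =>
    if hx : ∃ b : X k, (⟨k, b⟩ : Σ k, X k) ∈ U ∧ c b = x then some hx.choose else none
  have hrep' : ∀ a : X k, (⟨k, a⟩ : Σ k, X k) ∈ U → ∃ b, rep (c a) = some b ∧
      (⟨k, b⟩ : Σ k, X k) ∈ U ∧ c b = c a := by
    intro a ha
    have hx : ∃ b : X k, (⟨k, b⟩ : Σ k, X k) ∈ U ∧ c b = c a := ⟨a, ha, rfl⟩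
    exact ⟨hx.choose, by simp only [rep]; rw [dif_pos hx], hx.choose_spec⟩
  have hconj : ∀ a : X k, ∃ W ∈ Matrix.unitaryGroup (Fin k) ℂ, (⟨k, a⟩ : Σ k, X k) ∈ U →
      ∀ b, rep (c a) = some b → ∀ F ∈ T₀ ∪ (Set.range P ∪ Set.range Q),
        hsnorm (F k a - W * F k b * star W) < ω' := by
    intro a
    by_cases ha : (⟨k, a⟩ : Σ k, X k) ∈ U
    · obtain ⟨b, hb, hbU, hbc⟩ := hrep' a ha
      obtain ⟨W, hW, hWF⟩ := hc a b ha.1 hbU.1 hbc.symm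
      refine ⟨W, hW, fun _ b' hb' => ?_⟩
      rw [hb] at hb'
      rw [← Option.some_injective _ hb']
      exact hWF
    · exact ⟨1, one_mem _, fun h => absurd h ha⟩
  choose W hW hWF using hconj
  -- the value of `Y_r` at `a`, moved to the base point of the class of `a`
  let Z : X k → Fin m → Matrix (Fin k) (Fin k) ℂ := fun a r => star (W a) * Y r k a * W a
  have hZρ : ∀ a r, hsnorm (Z a r) ≤ ρ := by
    intro a r
    refine (htk.tnorm_le_norm _).trans ?_
    have := IsTrace.norm_le_one_of_mem_unitary (hW a)
    calc _ ≤ ‖star (W a)‖ * ‖Y r k a‖ * ‖W a‖ :=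
          (norm_mul_le _ _).trans (by gcongr; exact norm_mul_le _ _)
      _ ≤ 1 * ρ * 1 := by rw [norm_star]; gcongr; exact hYρ _ _ _
      _ = ρ := by ring
  have hE0 : 0 < ⌊E⌋₊ := Nat.floor_pos.2 (Real.one_le_exp (by positivity))
  -- the new class of `a`: its old class, and the net classes of the transported values
  refine ⟨κ × (Fin m → Fin ⌊E⌋₊), inferInstance,
    fun a => (c a, fun r => match rep (c a) with
      | some b => f b (Z a r)
      | none => ⟨0, hE0⟩), ?_, ?_⟩
  · rw [Fintype.card_prod, Fintype.card_fun, Fintype.card_fin, Fintype.card_fin]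
    push_cast
    have h1 : (⌊E⌋₊ : ℝ) ^ m ≤ Real.exp (η / 2 * (k : ℝ) ^ 2) := by
      calc (⌊E⌋₊ : ℝ) ^ m ≤ E ^ m := by
            gcongr; exact Nat.floor_le (Real.exp_pos _).le
        _ = Real.exp (m * (2 * θ / t ^ 2 * L * (k : ℝ) ^ 2)) := by rw [hE, ← Real.exp_nat_mul]
        _ ≤ _ := by
          refine Real.exp_le_exp.2 ?_
          have : m * (2 * θ / t ^ 2 * L) ≤ η / 2 := by
            calc m * (2 * θ / t ^ 2 * L) ≤ (m + 1) * (2 * θ / t ^ 2 * (L + 1)) := by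
                  gcongr <;> linarith
              _ = θ * ((m + 1) * (2 / t ^ 2) * (L + 1)) := by ring
              _ = η / 2 := by rw [hθ]; field_simp
          calc _ = m * (2 * θ / t ^ 2 * L) * (k : ℝ) ^ 2 := by ring
            _ ≤ _ := by gcongr
    calc (Fintype.card κ : ℝ) * (⌊E⌋₊ : ℝ) ^ m
        ≤ Real.exp (η / 2 * (k : ℝ) ^ 2) * Real.exp (η / 2 * (k : ℝ) ^ 2) := by gcongr
      _ = _ := by rw [← Real.exp_add]; congr 1; ring
  · intro a a' ha ha' haa
    have hcaa : c a = c a' := congrArg Prod.fst haa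
    obtain ⟨b, hb, hbU, hbc⟩ := hrep' a ha
    have hb' : rep (c a') = some b := hcaa ▸ hb
    have hWa := hWF a ha b hb
    have hWa' := hWF a' ha' b hb'
    have hdefect : ∀ x : X k, (⟨k, x⟩ : Σ k, X k) ∈ U → rep (c x) = some b → ∀ r,
        hsnorm (Z x r - ∑ j, P j k b * Z x r * Q j k b) ≤ ω / 16 := by
      intro x hx hxb r
      have hWx := hWF x hx b hxb
      refine (hsnorm_sub_sandwich_le (hW x) (P := fun j => P j k x) (Q := fun j => Q j k x)
        (C := C) (ρ := ρ) (ω := ω')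
        (fun j => (hPC₁ _ _ _).trans (le_max_left _ _))
        (fun j => (hQC₂ _ _ _).trans (le_max_right _ _)) (hYρ r k x)
        (fun j => (hWx (P j) (Or.inr (Or.inl ⟨j, rfl⟩))).le)
        (fun j => (hWx (Q j) (Or.inr (Or.inr ⟨j, rfl⟩))).le)).trans ?_
      have h1 : hsnorm (Y r k x - ∑ j, P j k x * Y r k x * Q j k x) < ω / 32 := by
        have := hx.2.1 r
        simpa [Finset.sum_apply] using this
      have h2 : N * (2 * C * ρ * ω') ≤ ω / 32 := by
        have h3 : ω' ≤ ω / 32 / ((N + 1) * (2 * C * ρ)) := min_le_right _ _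
        rw [le_div_iff₀ (by positivity)] at h3
        calc N * (2 * C * ρ * ω') ≤ (N + 1) * (2 * C * ρ * ω') := by gcongr; linarith
          _ = ω' * ((N + 1) * (2 * C * ρ)) := by ring
          _ ≤ _ := h3
      linarith
    refine ⟨W a * star (W a'), mul_mem (hW a) (Unitary.star_mem (hW a')), fun F hF => ?_⟩
    have hstar : star (W a * star (W a')) = W a' * star (W a) := by simp
    have hVV : star (W a') * W a' = 1 := Unitary.star_mul_self_of_mem (hW a')
    have hVV' : W a' * star (W a') = 1 := Unitary.mul_star_self_of_mem (hW a')
    have hWW' : W a * star (W a) = 1 := Unitary.mul_star_self_of_mem (hW a)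
    rw [hstar]
    rcases hT hF with hF | ⟨r, rfl⟩
    · have e : F k a - W a * star (W a') * F k a' * (W a' * star (W a)) =
          (F k a - W a * F k b * star (W a)) - (W a * star (W a')) *
            (F k a' - W a' * F k b * star (W a')) * star (W a * star (W a')) := by
        rw [hstar]
        have : W a * star (W a') * (W a' * F k b * star (W a')) * (W a' * star (W a)) =
            W a * F k b * star (W a) := by
          calc _ = W a * (star (W a') * W a') * F k b * (star (W a') * W a') * star (W a) := by
                noncomm_ring
            _ = _ := by rw [hVV, mul_one, mul_one]
        rw [mul_sub, sub_mul, this]; abel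
      rw [e]
      refine (htk.tnorm_sub_le _ _).trans_lt ?_
      rw [htk.tnorm_conj_unitary (mul_mem (hW a) (Unitary.star_mem (hW a')))]
      have h1 := hWa F (Or.inl hF)
      have h2 := hWa' F (Or.inl hF)
      have h3 : ω' ≤ ω / 4 := min_le_left _ _
      change hsnorm _ + hsnorm _ < ω
      linarith
    · have e : Y r k a - W a * star (W a') * Y r k a' * (W a' * star (W a)) =
          W a * (Z a r - Z a' r) * star (W a) := by
        simp only [Z]
        calc _ = (W a * star (W a)) * Y r k a * (W a * star (W a))
              - W a * star (W a') * Y r k a' * (W a' * star (W a)) := by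
              rw [hWW', one_mul, mul_one]
          _ = _ := by noncomm_ring
      have hfr : f b (Z a r) = f b (Z a' r) := by
        have := congrFun (congrArg Prod.snd haa) r
        simpa only [hb, hb'] using this
      rw [e, hsnorm, htk.tnorm_conj_unitary (hW a)]
      have h1 := hf b hbU (Z a r) (Z a' r) (hZρ _ _) (hZρ _ _) (hdefect a ha hb r)
        (hdefect a' ha' hb' r) hfr
      have h2 : 2 * t * ρ = ω / 8 := by rw [ht']; field_simp; ring
      change hsnorm _ < ω
      linarith

end Sandwich

/-! ### Density in von Neumann algebras -/

/-- Norm-closedness makes the underlying `*`-subalgebra of a von Neumann algebra a C⋆-algebra. -/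
lemma isClosed_toStarSubalgebra {H : Type*} [NormedAddCommGroup H] [InnerProductSpace ℂ H]
    [CompleteSpace H] (M : VonNeumannAlgebra H) :
    IsClosed (M.toStarSubalgebra : Set (H →L[ℂ] H)) := by
  rw [VonNeumannAlgebra.coe_toStarSubalgebra, ← M.centralizer_centralizer]
  exact Set.isClosed_centralizer _

attribute [local instance] isClosed_toStarSubalgebra

section Density

open Filter Topology

/-- The Hilbert space of square-summable sequences in `H`. -/
abbrev EllTwo (H : Type*) [NormedAddCommGroup H] : Type _ := lp (fun _ : ℕ => H) 2

lemma summable_sq_norm {H : Type*} [NormedAddCommGroup H] (v : EllTwo H) :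
    Summable fun i => ‖v i‖ ^ 2 := by
  have := (lp.memℓp v).summable (by norm_num)
  simpa using this

lemma sq_norm_ellTwo {H : Type*} [NormedAddCommGroup H] (v : EllTwo H) :
    ‖v‖ ^ 2 = ∑' i, ‖v i‖ ^ 2 := by
  have := lp.norm_rpow_eq_tsum (p := 2) (by norm_num) v
  simpa using this

lemma memℓp_of_summable {H : Type*} [NormedAddCommGroup H] {v : ℕ → H}
    (h : Summable fun i => ‖v i‖ ^ 2) : Memℓp v 2 :=
  memℓp_gen (by simpa using h)

variable {H : Type*} [NormedAddCommGroup H] [InnerProductSpace ℂ H] [CompleteSpace H]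

lemma mem_vnGen {S : Set (H →L[ℂ] H)} {y : H →L[ℂ] H} :
    y ∈ vnGen S ↔ ∀ z, (∀ s ∈ S, s * z = z * s ∧ star s * z = z * star s) →
      z * y = y * z ∧ star z * y = y * star z := by
  change y ∈ StarSubalgebra.centralizer ℂ _ ↔ _
  simp only [StarSubalgebra.mem_centralizer_iff, SetLike.mem_coe]

lemma subset_vnGen (S : Set (H →L[ℂ] H)) : S ⊆ vnGen S := by
  intro s hs
  refine mem_vnGen.2 fun z hz => ⟨(hz s hs).1.symm, ?_⟩
  have := congrArg star (hz s hs).2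
  simpa using this

lemma vnGen_mono {S T : Set (H →L[ℂ] H)} (h : S ⊆ T) : vnGen S ≤ vnGen T := fun _ hy =>
  mem_vnGen.2 fun z hz => mem_vnGen.1 hy z fun s hs => hz s (h hs)

lemma vnGen_le {S : Set (H →L[ℂ] H)} {N : VonNeumannAlgebra H} (h : S ⊆ N) : vnGen S ≤ N := by
  intro y hy
  rw [← VonNeumannAlgebra.commutant_commutant N, VonNeumannAlgebra.mem_commutant_iff]
  intro z hz
  rw [VonNeumannAlgebra.mem_commutant_iff] at hz
  exact (mem_vnGen.1 hy z fun s hs => ⟨hz s (h hs), hz _ (star_mem (h hs))⟩).1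

/-- The operator on `ℓ²(ℕ, H)` acting as `a` in each coordinate. -/
noncomputable def amp (a : H →L[ℂ] H) : EllTwo H →L[ℂ] EllTwo H :=
  have hs : ∀ v : EllTwo H, Summable fun i => ‖a (v i)‖ ^ 2 := fun v =>
    ((summable_sq_norm v).mul_left (‖a‖ ^ 2)).of_nonneg_of_le (fun _ => by positivity) fun i => by
      rw [← mul_pow]; gcongr; exact a.le_opNorm _
  LinearMap.mkContinuous
    { toFun := fun v => ⟨fun i => a (v i), memℓp_of_summable (hs v)⟩
      map_add' := fun v w => by ext i; exact map_add a _ _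
      map_smul' := fun c v => by ext i; exact map_smul a _ _ } ‖a‖ (fun v => by
        refine (abs_le_of_sq_le_sq' ?_ (by positivity)).2
        rw [sq_norm_ellTwo, mul_pow, sq_norm_ellTwo, ← tsum_mul_left]
        refine (hs v).tsum_le_tsum (fun i => ?_) ((summable_sq_norm v).mul_left _)
        rw [← mul_pow]; gcongr; exact a.le_opNorm _)

@[simp] lemma amp_apply {H : Type*} [NormedAddCommGroup H] [InnerProductSpace ℂ H]
    (a : H →L[ℂ] H) (v : EllTwo H) (i : ℕ) : amp a v i = a (v i) := rfl

lemma inner_amp_left (a : H →L[ℂ] H) (v w : EllTwo H) :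
    inner ℂ (amp a v) w = inner ℂ v (amp (star a) w) := by
  rw [lp.inner_eq_tsum, lp.inner_eq_tsum]
  refine tsum_congr fun i => ?_
  rw [amp_apply, amp_apply, ContinuousLinearMap.star_eq_adjoint,
    ContinuousLinearMap.adjoint_inner_right]

lemma amp_single {H : Type*} [NormedAddCommGroup H] [InnerProductSpace ℂ H]
    (a : H →L[ℂ] H) (j : ℕ) (h : H) :
    amp a (lp.single 2 j h) = lp.single 2 j (a h) := by
  ext i
  rw [amp_apply]
  rcases eq_or_ne i j with rfl | hij
  · simp
  · simp [hij]

/-- A matrix entry of an operator on `ℓ²(ℕ, H)`. -/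
noncomputable def entry {H : Type*} [NormedAddCommGroup H] [InnerProductSpace ℂ H]
    (T : EllTwo H →L[ℂ] EllTwo H) (i j : ℕ) : H →L[ℂ] H :=
  lp.evalCLM ℂ (fun _ : ℕ => H) 2 i ∘L T ∘L lp.singleContinuousLinearMap ℂ (fun _ : ℕ => H) 2 j

lemma entry_apply {H : Type*} [NormedAddCommGroup H] [InnerProductSpace ℂ H]
    (T : EllTwo H →L[ℂ] EllTwo H) (i j : ℕ) (h : H) :
    entry T i j h = T (lp.single 2 j h) i := rfl

lemma entry_comm {H : Type*} [NormedAddCommGroup H] [InnerProductSpace ℂ H]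
    {T : EllTwo H →L[ℂ] EllTwo H} {a : H →L[ℂ] H}
    (h : ∀ v, T (amp a v) = amp a (T v)) (i j : ℕ) : a * entry T i j = entry T i j * a := by
  ext x
  rw [mul_apply_eq_comp, mul_apply_eq_comp, entry_apply, entry_apply,
    ← amp_single, h, amp_apply]

lemma amp_comm_of_entry {H : Type*} [NormedAddCommGroup H] [InnerProductSpace ℂ H]
    {T : EllTwo H →L[ℂ] EllTwo H} {a : H →L[ℂ] H}
    (h : ∀ i j, entry T i j * a = a * entry T i j) (v : EllTwo H) : T (amp a v) = amp a (T v) := by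
  have hv := lp.hasSum_single (p := 2) (by simp) v
  have h1 := hv.mapL (T ∘L amp a)
  have h2 := hv.mapL (amp a ∘L T)
  refine h1.unique (h2.congr_fun ?_)
  intro j
  ext i
  have := congrArg (fun f : H →L[ℂ] H => f (v j)) (h i j)
  simp only [ContinuousLinearMap.comp_apply, amp_single, amp_apply]
  exact this

variable {M : VonNeumannAlgebra H} {τ : M.toStarSubalgebra →ₗ[ℂ] ℂ}

lemma IsTracialState.isTrace (hτ : IsTracialState M τ) : IsTrace τ where
  nonneg := hτ.nonneg
  tracial := hτ.tracial
  one_le := by rw [hτ.map_one]; simp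

/-- **Double commutant theorem**, in the 2-norm: elements of the von Neumann algebra generated by
`S` are approximated by elements of the `*`-algebra generated by `S`. The trace is the vector
functional of a vector of `ℓ²(ℕ, H)`, to which the usual commutant argument is applied. -/
theorem exists_adjoin_approx (hτ : IsTracialState M τ) {S : Set M.toStarSubalgebra}
    {y : M.toStarSubalgebra} (hy : (y : H →L[ℂ] H) ∈ vnGen (Subtype.val '' S)) {δ : ℝ}
    (hδ : 0 < δ) : ∃ z ∈ StarAlgebra.adjoin ℂ S, tnorm τ (z - y) < δ := by
  obtain ⟨ξ, hξ, hτξ⟩ := hτ.normal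
  -- `τ` is the vector functional of `ξ'`, so that `z ↦ z ξ'` is isometric for the 2-norm
  let ξ' : EllTwo H := ⟨ξ, memℓp_of_summable hξ⟩
  have hnorm : ∀ z : M.toStarSubalgebra, ‖amp (z : H →L[ℂ] H) ξ'‖ = tnorm τ z := by
    intro z
    refine (pow_left_inj₀ (norm_nonneg _) (tnorm_nonneg _) two_ne_zero).1 ?_
    rw [hτ.isTrace.sq_tnorm, sq_norm_ellTwo]
    have h1 := (Complex.hasSum_re (hτξ (star z * z))).tsum_eq
    rw [← h1]
    refine tsum_congr fun i => ?_
    change ‖(z : H →L[ℂ] H) (ξ i)‖ ^ 2 = _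
    have : ((star z * z : M.toStarSubalgebra) : H →L[ℂ] H) (ξ i) =
        star (z : H →L[ℂ] H) ((z : H →L[ℂ] H) (ξ i)) := rfl
    rw [this, ContinuousLinearMap.star_eq_adjoint, ContinuousLinearMap.adjoint_inner_right,
      inner_self_eq_norm_sq_to_K]
    norm_cast
  let V : Submodule ℂ (EllTwo H) :=
    { carrier := {v | ∃ z ∈ StarAlgebra.adjoin ℂ S, v = amp (z : H →L[ℂ] H) ξ'}
      add_mem' := by
        rintro _ _ ⟨z, hz, rfl⟩ ⟨w, hw, rfl⟩
        exact ⟨z + w, add_mem hz hw, by ext i; simp⟩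
      zero_mem' := ⟨0, zero_mem _, by ext i; simp⟩
      smul_mem' := by
        rintro c _ ⟨z, hz, rfl⟩
        exact ⟨c • z, SMulMemClass.smul_mem c hz, by ext i; simp⟩ }
  -- the projection onto the closed cyclic subspace of `ξ'` commutes with the `*`-algebra; hence its
  -- entries commute with `y`, and `y ξ'` belongs to the cyclic subspace
  let K := V.topologicalClosure
  have hK : ∀ a ∈ StarAlgebra.adjoin ℂ S, ∀ v ∈ K, amp (a : H →L[ℂ] H) v ∈ K := by
    intro a ha v hv
    refine map_mem_closure (amp (a : H →L[ℂ] H)).continuous hv ?_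
    rintro _ ⟨z, hz, rfl⟩
    exact ⟨a * z, mul_mem ha hz, by ext i; simp⟩
  have hcomm : ∀ a ∈ StarAlgebra.adjoin ℂ S, ∀ v,
      K.starProjection (amp (a : H →L[ℂ] H) v) = amp (a : H →L[ℂ] H) (K.starProjection v) := by
    intro a ha v
    refine Submodule.eq_starProjection_of_mem_of_inner_eq_zero (hK a ha _
      (Submodule.starProjection_apply_mem K v)) fun w hw => ?_
    rw [← map_sub, inner_amp_left]
    exact (Submodule.mem_orthogonal' _ _).1 (Submodule.sub_starProjection_mem_orthogonal v) _
      (hK _ (star_mem ha) w hw)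
  have hentry : ∀ i j, entry K.starProjection i j * (y : H →L[ℂ] H) =
      (y : H →L[ℂ] H) * entry K.starProjection i j := by
    intro i j
    refine (mem_vnGen.1 hy _ ?_).1
    rintro _ ⟨s, hs, rfl⟩
    have hs' := StarAlgebra.subset_adjoin ℂ S hs
    exact ⟨entry_comm (hcomm s hs') i j, entry_comm (hcomm (star s) (star_mem hs')) i j⟩
  have hξK : ξ' ∈ K := V.le_topologicalClosure ⟨1, one_mem _, by ext i; simp⟩
  have hyK : amp (y : H →L[ℂ] H) ξ' ∈ K := by
    rw [← (Submodule.starProjection_eq_self_iff (K := K)).2 hξK, ← amp_comm_of_entry hentry]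
    exact Submodule.starProjection_apply_mem K _
  obtain ⟨_, ⟨z, hz, rfl⟩, hdist⟩ := Metric.mem_closure_iff.1 hyK δ hδ
  refine ⟨z, hz, ?_⟩
  rw [hτ.isTrace.tnorm_sub_comm, ← hnorm]
  have hsub : amp ((y - z : M.toStarSubalgebra) : H →L[ℂ] H) ξ' =
      amp (y : H →L[ℂ] H) ξ' - amp (z : H →L[ℂ] H) ξ' := by ext i; simp
  rw [hsub, ← dist_eq_norm]
  exact hdist

end Density

/-! ### Kaplansky approximation in the 2-norm -/

section Kaplansky

variable {B : Type*} [CStarAlgebra B]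

/-- The function `t ↦ 2t / (1 + t²)`, bounded by one and Lipschitz for the 2-norm. -/
noncomputable def kapFun (t : ℝ) : ℝ := 2 * (t * (1 + t * t)⁻¹)

lemma continuous_kapFun : Continuous kapFun := by
  unfold kapFun
  refine continuous_const.mul (continuous_id.mul (Continuous.inv₀ (by fun_prop) fun t => ?_))
  nlinarith [mul_self_nonneg t]

lemma abs_kapFun_le (t : ℝ) : |kapFun t| ≤ 1 := by
  have h : 0 < 1 + t * t := by nlinarith [mul_self_nonneg t]
  rw [kapFun, ← div_eq_mul_inv, ← mul_div_assoc, abs_div, abs_of_pos h, div_le_one h, abs_le]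
  constructor <;> nlinarith [sq_nonneg (t + 1), sq_nonneg (t - 1)]

lemma exists_kapFun_inverse : ∃ g : ℝ → ℝ, Continuous g ∧ ∀ t, |t| ≤ 1 → kapFun (g t) = t := by
  refine ⟨fun t => t / (1 + Real.sqrt (1 - t ^ 2)), ?_, fun t ht => ?_⟩
  · refine Continuous.div (by fun_prop) (by fun_prop) fun t => ?_
    positivity
  · have h0 : 0 ≤ 1 - t ^ 2 := by nlinarith [abs_le.1 ht, sq_abs t, abs_nonneg t]
    set c := Real.sqrt (1 - t ^ 2)
    have hc : c ^ 2 = 1 - t ^ 2 := Real.sq_sqrt h0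
    have hc0 : 0 < 1 + c := by positivity
    have h1 : 1 + t / (1 + c) * (t / (1 + c)) = 2 / (1 + c) := by
      field_simp
      nlinarith
    rw [kapFun, h1]
    field_simp
    rfl

lemma exists_resolvent {a : B} (ha : IsSelfAdjoint a) : ∃ r : B, ‖r‖ ≤ 1 ∧ ‖a * r‖ ≤ 1 ∧
    ‖r * a‖ ≤ 1 ∧ (1 + a * a) * r = 1 ∧ r * (1 + a * a) = 1 ∧ cfc kapFun a = (2 : ℝ) • (a * r) ∧
    cfc kapFun a = (2 : ℝ) • (r * a) := by
  let ρ : ℝ → ℝ := fun t => (1 + t * t)⁻¹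
  have hpos : ∀ t : ℝ, 0 < 1 + t * t := fun t => by nlinarith [mul_self_nonneg t]
  have hρ : Continuous ρ := Continuous.inv₀ (by fun_prop) fun t => (hpos t).ne'
  have hid : cfc (fun t : ℝ => t) a = a := cfc_id' ℝ a
  have h1 : cfc (fun t : ℝ => 1 + t * t) a = 1 + a * a := by
    rw [cfc_const_add (1 : ℝ) (fun t => t * t) a (by fun_prop) ha, cfc_mul (fun t : ℝ => t) _ a
      (by fun_prop) (by fun_prop), hid, map_one]
  have h2 : cfc (fun t => (1 + t * t) * ρ t) a = 1 := by
    rw [cfc_congr (g := fun _ => (1 : ℝ)) fun t _ => mul_inv_cancel₀ (hpos t).ne']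
    exact cfc_const_one ℝ a
  have h3 : a * cfc ρ a = cfc (fun t => t * ρ t) a := by
    conv_lhs => rw [← hid]
    rw [hid, cfc_mul (fun t : ℝ => t) ρ a (by fun_prop) hρ.continuousOn, hid]
  have h4 : cfc ρ a * a = cfc (fun t => t * ρ t) a := by
    rw [cfc_congr (g := fun t => ρ t * t) fun t _ => mul_comm _ _,
      cfc_mul ρ (fun t : ℝ => t) a hρ.continuousOn (by fun_prop), hid]
  have h5 : cfc kapFun a = (2 : ℝ) • cfc (fun t => t * ρ t) a := by
    rw [← cfc_smul (2 : ℝ) (fun t => t * ρ t) a ((continuous_id.mul hρ).continuousOn)]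
    rfl
  have hb : ‖cfc (fun t => t * ρ t) a‖ ≤ 1 := by
    refine norm_cfc_le zero_le_one fun t _ => ?_
    have := abs_kapFun_le t
    rw [kapFun, abs_mul] at this
    rw [Real.norm_eq_abs]
    have h2 : |(2 : ℝ)| = 2 := abs_of_pos two_pos
    rw [h2] at this
    linarith [abs_nonneg (t * (1 + t * t)⁻¹)]
  refine ⟨cfc ρ a, ?_, h3 ▸ hb, h4 ▸ hb, ?_, ?_, ?_, ?_⟩
  · refine norm_cfc_le zero_le_one fun t _ => ?_
    rw [Real.norm_of_nonneg (inv_nonneg.2 (hpos t).le)]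
    exact inv_le_one_of_one_le₀ (by nlinarith [mul_self_nonneg t])
  · rw [← h1, ← cfc_mul (fun t : ℝ => 1 + t * t) ρ a (by fun_prop) hρ.continuousOn, h2]
  · rw [← h1, ← cfc_mul ρ (fun t : ℝ => 1 + t * t) a hρ.continuousOn (by fun_prop), ← h2]
    exact cfc_congr fun t _ => mul_comm _ _
  · rw [h3, h5]
  · rw [h4, h5]

/-- The functional calculus of `kapFun` is Lipschitz in the 2-norm. -/
lemma tnorm_kapFun_sub_le {t : B →ₗ[ℂ] ℂ} (ht : IsTrace t) {a b : B} (ha : IsSelfAdjoint a)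
    (hb : IsSelfAdjoint b) : tnorm t (cfc kapFun a - cfc kapFun b) ≤ 4 * tnorm t (a - b) := by
  obtain ⟨r, hr, har, -, h1, -, h2, -⟩ := exists_resolvent ha
  obtain ⟨s, hs, -, hsb, -, h3, -, h4⟩ := exists_resolvent hb
  have e : a * r - s * b = s * (a - b) * r + (s * b) * (b - a) * (a * r) := by
    calc a * r - s * b = (s * (1 + b * b)) * a * r - s * b * ((1 + a * a) * r) := by
          rw [h1, h3, one_mul, mul_one]
      _ = _ := by noncomm_ring
  have e2 : cfc kapFun a - cfc kapFun b = (2 : ℂ) • (a * r - s * b) := by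
    rw [h2, h4, ← smul_sub, ← Complex.coe_smul]; norm_num
  rw [e2, ht.tnorm_smul, e]
  have b1 : tnorm t (s * (a - b) * r) ≤ tnorm t (a - b) := by
    refine (ht.tnorm_mul_mul_le _ _ _).trans ?_
    calc ‖s‖ * tnorm t (a - b) * ‖r‖ ≤ 1 * tnorm t (a - b) * 1 := by
          have := tnorm_nonneg (t := t) (a - b)
          gcongr
      _ = _ := by ring
  have b2 : tnorm t ((s * b) * (b - a) * (a * r)) ≤ tnorm t (a - b) := by
    refine (ht.tnorm_mul_mul_le _ _ _).trans ?_
    rw [ht.tnorm_sub_comm b a]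
    calc ‖s * b‖ * tnorm t (a - b) * ‖a * r‖ ≤ 1 * tnorm t (a - b) * 1 := by
          have := tnorm_nonneg (t := t) (a - b)
          gcongr
      _ = _ := by ring
  have := ht.tnorm_add_le (s * (a - b) * r) ((s * b) * (b - a) * (a * r))
  rw [Complex.norm_ofNat]
  linarith

open Polynomial in
lemma exists_polynomial_kapFun (C : ℝ) {ε : ℝ} (hε : 0 < ε) : ∃ q : ℝ[X],
    (∀ t, |t| ≤ C → |q.eval t| ≤ 1) ∧ ∀ t, |t| ≤ C → |q.eval t - kapFun t| ≤ ε := by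
  obtain ⟨p, hp⟩ := exists_polynomial_near_of_continuousOn (-C) C kapFun
    continuous_kapFun.continuousOn (ε / 2) (half_pos hε)
  have hp' : ∀ t, |t| ≤ C → |p.eval t - kapFun t| ≤ ε / 2 := fun t ht =>
    (hp t (abs_le.1 ht)).le
  have hbd : ∀ t, |t| ≤ C → |p.eval t| ≤ 1 + ε / 2 := fun t ht => by
    calc |p.eval t| = |kapFun t + (p.eval t - kapFun t)| := by ring_nf
      _ ≤ |kapFun t| + |p.eval t - kapFun t| := abs_add_le _ _
      _ ≤ _ := add_le_add (abs_kapFun_le t) (hp' t ht)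
  have hpos : 0 < 1 + ε / 2 := by positivity
  have hev : ∀ t, (Polynomial.C (1 + ε / 2)⁻¹ * p).eval t = (1 + ε / 2)⁻¹ * p.eval t := by simp
  refine ⟨Polynomial.C (1 + ε / 2)⁻¹ * p, fun t ht => ?_, fun t ht => ?_⟩
  · rw [hev, abs_mul, abs_of_pos (inv_pos.2 hpos), inv_mul_le_iff₀ hpos, mul_one]
    exact hbd t ht
  · have h1 : |(1 + ε / 2)⁻¹ * p.eval t - p.eval t| ≤ ε / 2 := by
      have : (1 + ε / 2)⁻¹ * p.eval t - p.eval t = -((1 + ε / 2)⁻¹ * p.eval t * (ε / 2)) := by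
        field_simp; ring
      rw [this, abs_neg, abs_mul, abs_of_pos (half_pos hε), abs_mul, abs_of_pos (inv_pos.2 hpos)]
      refine mul_le_of_le_one_left (half_pos hε).le ?_
      rw [inv_mul_le_iff₀ hpos, mul_one]
      exact hbd t ht
    rw [hev]
    calc _ = |((1 + ε / 2)⁻¹ * p.eval t - p.eval t) + (p.eval t - kapFun t)| := by ring_nf
      _ ≤ _ := abs_add_le _ _
      _ ≤ ε := by linarith [hp' t ht]

open Polynomial in
lemma aeval_map_eq_cfc {b : B} (hb : IsSelfAdjoint b) (q : ℝ[X]) :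
    aeval b (q.map (algebraMap ℝ ℂ)) = cfc (fun t => q.eval t) b := by
  rw [aeval_map_algebraMap, cfc_polynomial q b hb]

open Polynomial in
lemma norm_aeval_le {b : B} (hb : IsSelfAdjoint b) {C D : ℝ} (hbC : ‖b‖ ≤ C) (hD : 0 ≤ D)
    {q : ℝ[X]} (hq : ∀ t, |t| ≤ C → |q.eval t| ≤ D) : ‖aeval b (q.map (algebraMap ℝ ℂ))‖ ≤ D := by
  rw [aeval_map_eq_cfc hb]
  rcases subsingleton_or_nontrivial B with h | h
  · rwa [Subsingleton.elim (cfc _ b) 0, norm_zero]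
  · exact norm_cfc_le hD fun t ht => hq t ((spectrum.norm_le_norm_of_mem ht).trans hbC)

open Polynomial in
lemma norm_aeval_sub_kapFun_le {b : B} (hb : IsSelfAdjoint b) {C ε : ℝ} (hbC : ‖b‖ ≤ C)
    (hε : 0 ≤ ε) {q : ℝ[X]} (hq : ∀ t, |t| ≤ C → |q.eval t - kapFun t| ≤ ε) :
    ‖aeval b (q.map (algebraMap ℝ ℂ)) - cfc kapFun b‖ ≤ ε := by
  rw [aeval_map_eq_cfc hb, ← cfc_sub _ _ b (by fun_prop) continuous_kapFun.continuousOn]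
  rcases subsingleton_or_nontrivial B with h | h
  · rwa [Subsingleton.elim (cfc _ b) 0, norm_zero]
  · exact norm_cfc_le hε fun t ht => hq t ((spectrum.norm_le_norm_of_mem ht).trans hbC)

end Kaplansky

/-! ### Matrix models of a tracial von Neumann algebra -/

section Model

open Filter Topology
open scoped Matrix.Norms.L2Operator

variable {H : Type*} [NormedAddCommGroup H] [InnerProductSpace ℂ H] [CompleteSpace H]

/-- The matrix-valued functions `coord j` are a model of the generators `x j` of `M` along the
filter `l`: they are bounded, the matrix sizes tend to infinity, and all `*`-moments converge. -/
structure IsModel {M : VonNeumannAlgebra H} (τ : M.toStarSubalgebra →ₗ[ℂ] ℂ) {X : ℕ → Type}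
    (l : Filter (Σ k, X k)) {n : ℕ} (coord : Fin n → Sec X) (x : Fin n → M.toStarSubalgebra) :
    Prop where
  trace : IsTracialState M τ
  generates : Generates x M
  size : Tendsto Sigma.fst l atTop
  bdd : ∀ j, IsBddSec (coord j)
  law : ∀ w, Tendsto (fun i : Σ k, X k => ntr (starWord (fun j => coord j i.1 i.2) w)) l
    (𝓝 (τ (starWord x w)))

variable {M : VonNeumannAlgebra H} {τ : M.toStarSubalgebra →ₗ[ℂ] ℂ} {X : ℕ → Type}
  {l : Filter (Σ k, X k)} {n : ℕ} {coord : Fin n → Sec X} {x : Fin n → M.toStarSubalgebra}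

/-- The `*`-algebra generated by the pairs `(coord j, x j)`: it consists of the pairs of values of
the same noncommutative `*`-polynomial. -/
noncomputable def polyPairs (coord : Fin n → Sec X) (x : Fin n → M.toStarSubalgebra) :
    StarSubalgebra ℂ (Sec X × M.toStarSubalgebra) :=
  StarAlgebra.adjoin ℂ (Set.range fun j => (coord j, x j))

lemma IsBddSec.add {F G : Sec X} (hF : IsBddSec F) (hG : IsBddSec G) : IsBddSec (F + G) := by
  obtain ⟨C, hC⟩ := hF
  obtain ⟨D, hD⟩ := hG
  exact ⟨C + D, fun k a => (norm_add_le _ _).trans (add_le_add (hC k a) (hD k a))⟩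

lemma IsBddSec.mul {F G : Sec X} (hF : IsBddSec F) (hG : IsBddSec G) : IsBddSec (F * G) := by
  obtain ⟨C, hC, hC'⟩ := hF.pos
  obtain ⟨D, hD, hD'⟩ := hG.pos
  refine ⟨C * D, fun k a => (norm_mul_le _ _).trans ?_⟩
  gcongr
  · exact hC' k a
  · exact hD' k a

lemma IsBddSec.star {F : Sec X} (hF : IsBddSec F) : IsBddSec (star F) := by
  obtain ⟨C, hC⟩ := hF
  exact ⟨C, fun k a => by rw [Pi.star_apply, Pi.star_apply, norm_star]; exact hC k a⟩

lemma IsBddSec.smul {F : Sec X} (hF : IsBddSec F) (c : ℂ) : IsBddSec (c • F) := by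
  obtain ⟨C, hC⟩ := hF
  refine ⟨‖c‖ * C, fun k a => ?_⟩
  rw [Pi.smul_apply, Pi.smul_apply, norm_smul]
  gcongr
  exact hC k a

lemma isBddSec_one : IsBddSec (1 : Sec X) :=
  ⟨1, fun _ _ => IsTrace.norm_le_one_of_mem_unitary (one_mem _)⟩

lemma IsBddSec.of_mem_polyPairs (hb : ∀ j, IsBddSec (coord j)) {p : Sec X × M.toStarSubalgebra}
    (hp : p ∈ polyPairs coord x) : IsBddSec p.1 := by
  induction hp using StarAlgebra.adjoin_induction with
  | mem p hp => obtain ⟨j, rfl⟩ := hp; exact hb j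
  | algebraMap r =>
    have : (algebraMap ℂ (Sec X × M.toStarSubalgebra) r).1 = r • (1 : Sec X) :=
      Algebra.algebraMap_eq_smul_one r
    rw [this]
    exact isBddSec_one.smul r
  | add p q _ _ hp hq => exact hp.add hq
  | mul p q _ _ hp hq => exact hp.mul hq
  | star p _ hp => exact hp.star

lemma starWord_nil {ι R : Type*} [Monoid R] [Star R] (a : ι → R) : starWord a [] = 1 := rfl

lemma starWord_cons {ι R : Type*} [Monoid R] [Star R] (a : ι → R) (p : ι × Bool)
    (w : List (ι × Bool)) :
    starWord a (p :: w) = (if p.2 then star (a p.1) else a p.1) * starWord a w := by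
  simp [starWord]

lemma starWord_pair (w : List (Fin n × Bool)) :
    starWord (fun j => (coord j, x j)) w =
      (fun k a => starWord (fun j => coord j k a) w, starWord x w) := by
  induction w with
  | nil => rfl
  | cons p w ih =>
    rw [starWord_cons, ih]
    refine Prod.ext ?_ ?_
    · funext k a
      rw [starWord_cons]
      obtain ⟨j, b⟩ := p
      cases b <;> rfl
    · rw [starWord_cons]
      obtain ⟨j, b⟩ := p
      cases b <;> rfl

lemma polyPairs_le_span (p : Sec X × M.toStarSubalgebra) (hp : p ∈ polyPairs coord x) :
    p ∈ Submodule.span ℂ (Set.range fun w => starWord (fun j => (coord j, x j)) w) := by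
  change p ∈ (StarAlgebra.adjoin ℂ (Set.range fun j => (coord j, x j))).toSubalgebra at hp
  rw [StarAlgebra.adjoin_toSubalgebra, ← Subalgebra.mem_toSubmodule, Algebra.adjoin_eq_span] at hp
  refine Submodule.span_mono (fun q hq => ?_) hp
  induction hq using Submonoid.closure_induction_left with
  | one => exact ⟨[], rfl⟩
  | mul_left y hy z _ hz =>
    obtain ⟨w, rfl⟩ := hz
    rcases hy with ⟨j, rfl⟩ | ⟨j, hj⟩
    · exact ⟨(j, false) :: w, by simp [starWord]⟩
    · have : star (coord j, x j) = y := by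
        rw [show (coord j, x j) = star y from hj, star_star]
      exact ⟨(j, true) :: w, by simp only [starWord, List.map_cons, List.prod_cons, if_true, this]⟩

namespace IsModel

lemma tendsto_ntr_of_mem (h : IsModel τ l coord x) {p : Sec X × M.toStarSubalgebra}
    (hp : p ∈ polyPairs coord x) :
    Tendsto (fun i : Σ k, X k => ntrLin i.1 (p.1 i.1 i.2)) l (𝓝 (τ p.2)) := by
  have := polyPairs_le_span p hp
  clear hp
  induction this using Submodule.span_induction with
  | mem p hp' =>
    obtain ⟨w, rfl⟩ := hp'
    beta_reduce
    rw [starWord_pair]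
    exact h.law w
  | zero => simpa using tendsto_const_nhds
  | add p q _ _ hp' hq' => simpa using hp'.add hq'
  | smul c p _ hp' => simpa using hp'.const_mul c

lemma tendsto_hsnorm_of_mem (h : IsModel τ l coord x) {p : Sec X × M.toStarSubalgebra}
    (hp : p ∈ polyPairs coord x) :
    Tendsto (fun i : Σ k, X k => hsnorm (p.1 i.1 i.2)) l (𝓝 (tnorm τ p.2)) := by
  have h1 := h.tendsto_ntr_of_mem (mul_mem (star_mem hp) hp)
  exact ((Complex.continuous_re.tendsto _).comp h1).sqrt

lemma exists_polyPair (x : Fin n → M.toStarSubalgebra) (coord : Fin n → Sec X)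
    {z : M.toStarSubalgebra} (hz : z ∈ StarAlgebra.adjoin ℂ (Set.range x)) :
    ∃ G, (G, z) ∈ polyPairs coord x := by
  induction hz using StarAlgebra.adjoin_induction with
  | mem z hz => obtain ⟨j, rfl⟩ := hz; exact ⟨coord j, StarAlgebra.subset_adjoin _ _ ⟨j, rfl⟩⟩
  | algebraMap r => exact ⟨algebraMap ℂ _ r, (polyPairs coord x).algebraMap_mem r⟩
  | add p q _ _ hp hq =>
    obtain ⟨G, hG⟩ := hp
    obtain ⟨G', hG'⟩ := hq
    exact ⟨G + G', add_mem hG hG'⟩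
  | mul p q _ _ hp hq =>
    obtain ⟨G, hG⟩ := hp
    obtain ⟨G', hG'⟩ := hq
    exact ⟨G * G', mul_mem hG hG'⟩
  | star p _ hp =>
    obtain ⟨G, hG⟩ := hp
    exact ⟨star G, star_mem hG⟩

lemma exists_polyPair_approx (h : IsModel τ l coord x) (y : M.toStarSubalgebra) {δ : ℝ}
    (hδ : 0 < δ) : ∃ p ∈ polyPairs coord x, tnorm τ (p.2 - y) < δ := by
  have hy : (y : H →L[ℂ] H) ∈ vnGen (Subtype.val '' Set.range x) := by
    have : Subtype.val '' Set.range x = Set.range fun i => (x i : H →L[ℂ] H) :=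
      (Set.range_comp _ _).symm
    rw [this, h.generates]
    exact y.2
  obtain ⟨z, hz, hzy⟩ := exists_adjoin_approx h.trace hy hδ
  obtain ⟨G, hG⟩ := exists_polyPair x coord hz
  exact ⟨_, hG, hzy⟩

lemma exists_isSelfAdjoint_polyPair_approx (h : IsModel τ l coord x) {y : M.toStarSubalgebra}
    (hy : IsSelfAdjoint y) {δ : ℝ} (hδ : 0 < δ) :
    ∃ p ∈ polyPairs coord x, IsSelfAdjoint p ∧ tnorm τ (p.2 - y) < δ := by
  obtain ⟨p, hp, hpy⟩ := h.exists_polyPair_approx y hδ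
  have ht := h.trace.isTrace
  refine ⟨(2⁻¹ : ℂ) • (p + star p), SMulMemClass.smul_mem _ (add_mem hp (star_mem hp)), ?_, ?_⟩
  · rw [IsSelfAdjoint, star_smul, star_add, star_star, add_comm]
    simp
  · have e : ((2⁻¹ : ℂ) • (p + star p)).2 - y = (2⁻¹ : ℂ) • ((p.2 - y) + star (p.2 - y)) := by
      have : y = (2⁻¹ : ℂ) • (y + y) := by
        rw [← two_smul ℂ y, smul_smul]; norm_num
      rw [star_sub, hy.star_eq]
      conv_lhs => rw [this]
      rw [Prod.smul_snd, Prod.snd_add, Prod.snd_star, ← smul_sub]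
      congr 1
      abel
    rw [e, ht.tnorm_smul]
    calc _ ≤ ‖(2⁻¹ : ℂ)‖ * (tnorm τ (p.2 - y) + tnorm τ (star (p.2 - y))) := by
          gcongr; exact ht.tnorm_add_le _ _
      _ = tnorm τ (p.2 - y) := by rw [ht.tnorm_star]; norm_num; ring
      _ < δ := hpy

open Polynomial in
/-- **Kaplansky density**, uniformly over the model: a self-adjoint contraction `y` is approximated
in the 2-norm by a `*`-polynomial all of whose values on the model are contractions. -/
lemma exists_contractive_approx (h : IsModel τ l coord x) {y : M.toStarSubalgebra}
    (hy : IsSelfAdjoint y) (hy1 : ‖y‖ ≤ 1) {δ : ℝ} (hδ : 0 < δ) :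
    ∃ p ∈ polyPairs coord x, (∀ k a, ‖p.1 k a‖ ≤ 1) ∧ tnorm τ (p.2 - y) < δ := by
  have ht := h.trace.isTrace
  obtain ⟨g, hg, hgk⟩ := exists_kapFun_inverse
  have hyg : cfc kapFun (cfc g y) = y := by
    rw [← cfc_comp kapFun g y hy continuous_kapFun.continuousOn hg.continuousOn]
    conv_rhs => rw [← cfc_id ℝ y hy]
    refine cfc_congr fun t hts => hgk t ?_
    rcases subsingleton_or_nontrivial M.toStarSubalgebra with hs | hs
    · simp at hts
    · exact (spectrum.norm_le_norm_of_mem hts).trans hy1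
  have hgs : IsSelfAdjoint (cfc g y) := cfc_predicate g y
  obtain ⟨p, hp, hps, hpg⟩ := h.exists_isSelfAdjoint_polyPair_approx hgs
    (show 0 < δ / 8 by positivity)
  obtain ⟨C1, hC1, hC1'⟩ := (IsBddSec.of_mem_polyPairs h.bdd hp).pos
  obtain ⟨q, hq1, hq2⟩ := exists_polynomial_kapFun (max C1 ‖p.2‖) (show 0 < δ / 2 by positivity)
  have hps2 : IsSelfAdjoint p.2 := congrArg Prod.snd hps
  have hps1 : ∀ k a, IsSelfAdjoint (p.1 k a) := fun k a =>
    congrFun (congrFun (congrArg Prod.fst hps) k) a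
  let Q := q.map (algebraMap ℝ ℂ)
  have e2 : (aeval p Q).2 = aeval p.2 Q := (aeval_algHom_apply
    (AlgHom.snd ℂ (Sec X) M.toStarSubalgebra) p Q).symm
  have e1 : ∀ k a, (aeval p Q).1 k a = aeval (p.1 k a) Q := fun k a =>
    (aeval_algHom_apply (((Pi.evalAlgHom ℂ (fun _ : X k => Matrix (Fin k) (Fin k) ℂ) a).comp
      (Pi.evalAlgHom ℂ (fun k => X k → Matrix (Fin k) (Fin k) ℂ) k)).comp
      (AlgHom.fst ℂ (Sec X) M.toStarSubalgebra)) p Q).symm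
  refine ⟨aeval p Q, ?_, fun k a => ?_, ?_⟩
  · have h1 : Algebra.adjoin ℂ {p} ≤ (polyPairs coord x).toSubalgebra :=
      Algebra.adjoin_le (by simpa using hp)
    exact h1 (aeval_mem_adjoin_singleton ℂ p)
  · rw [e1]
    exact norm_aeval_le (hps1 k a) ((hC1' k a).trans (le_max_left _ _)) zero_le_one hq1
  · rw [e2]
    have h1 : ‖aeval p.2 Q - cfc kapFun p.2‖ ≤ δ / 2 :=
      norm_aeval_sub_kapFun_le hps2 (le_max_right _ _) (by positivity) hq2
    have h2 := tnorm_kapFun_sub_le ht hps2 hgs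
    rw [hyg] at h2
    calc _ ≤ tnorm τ (aeval p.2 Q - cfc kapFun p.2) + tnorm τ (cfc kapFun p.2 - y) :=
          ht.tnorm_sub_le_add _ _ _
      _ < δ / 2 + δ / 2 := add_lt_add_of_le_of_lt ((ht.tnorm_le_norm _).trans h1) (by linarith)
      _ = δ := by ring

end IsModel

/-- The bounded matrix-valued function `F` represents the element `y` of `M` in the model: some
`*`-polynomials approximate `y` in `M` and `F` along `l`, both in the 2-norm. -/
def Represents (τ : M.toStarSubalgebra →ₗ[ℂ] ℂ) (l : Filter (Σ k, X k)) (coord : Fin n → Sec X)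
    (x : Fin n → M.toStarSubalgebra) (F : Sec X) (y : M.toStarSubalgebra) : Prop :=
  IsBddSec F ∧ ∀ δ > 0, ∃ p ∈ polyPairs coord x, tnorm τ (p.2 - y) < δ ∧
    ∀ᶠ i in l, hsnorm (p.1 i.1 i.2 - F i.1 i.2) < δ

namespace IsModel

lemma represents_of_mem (h : IsModel τ l coord x) {p : Sec X × M.toStarSubalgebra}
    (hp : p ∈ polyPairs coord x) : Represents τ l coord x p.1 p.2 :=
  ⟨IsBddSec.of_mem_polyPairs h.bdd hp, fun δ hδ => ⟨p, hp, by simpa using hδ,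
    Eventually.of_forall fun i => by simpa using hδ⟩⟩

lemma represents_coord (h : IsModel τ l coord x) (j : Fin n) :
    Represents τ l coord x (coord j) (x j) :=
  h.represents_of_mem (p := (coord j, x j)) (StarAlgebra.subset_adjoin _ _ ⟨j, rfl⟩)

end IsModel

namespace Represents

variable {F F' : Sec X} {y y' : M.toStarSubalgebra}

lemma one (h : IsModel τ l coord x) : Represents τ l coord x 1 1 :=
  h.represents_of_mem (p := 1) (one_mem _)

lemma add (h : IsModel τ l coord x) (hF : Represents τ l coord x F y)
    (hF' : Represents τ l coord x F' y') : Represents τ l coord x (F + F') (y + y') := by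
  refine ⟨hF.1.add hF'.1, fun δ hδ => ?_⟩
  obtain ⟨p, hp, hpy, hpF⟩ := hF.2 _ (half_pos hδ)
  obtain ⟨q, hq, hqy, hqF⟩ := hF'.2 _ (half_pos hδ)
  refine ⟨p + q, add_mem hp hq, ?_, ?_⟩
  · rw [Prod.snd_add, add_sub_add_comm]
    exact (h.trace.isTrace.tnorm_add_le _ _).trans_lt (by linarith)
  · filter_upwards [hpF, hqF] with i h1 h2
    rw [Prod.fst_add, Pi.add_apply, Pi.add_apply, Pi.add_apply, Pi.add_apply, add_sub_add_comm]
    exact ((isTrace_ntrLin _).tnorm_add_le _ _).trans_lt (by linarith)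

lemma smul (h : IsModel τ l coord x) (hF : Represents τ l coord x F y) (c : ℂ) :
    Represents τ l coord x (c • F) (c • y) := by
  refine ⟨hF.1.smul c, fun δ hδ => ?_⟩
  obtain ⟨p, hp, hpy, hpF⟩ := hF.2 (δ / (‖c‖ + 1)) (by positivity)
  have key : ∀ t, 0 ≤ t → t < δ / (‖c‖ + 1) → ‖c‖ * t < δ := fun t ht0 ht => by
    rw [lt_div_iff₀ (by positivity)] at ht
    nlinarith
  refine ⟨c • p, SMulMemClass.smul_mem _ hp, ?_, ?_⟩
  · rw [Prod.smul_snd, ← smul_sub, h.trace.isTrace.tnorm_smul]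
    exact key _ (tnorm_nonneg _) hpy
  · filter_upwards [hpF] with i h1
    rw [Prod.smul_fst, Pi.smul_apply, Pi.smul_apply, Pi.smul_apply, Pi.smul_apply, ← smul_sub,
      hsnorm, (isTrace_ntrLin _).tnorm_smul]
    exact key _ (tnorm_nonneg _) h1

lemma sub (h : IsModel τ l coord x) (hF : Represents τ l coord x F y)
    (hF' : Represents τ l coord x F' y') : Represents τ l coord x (F - F') (y - y') := by
  have := hF.add h (hF'.smul h (-1))
  simpa [← sub_eq_add_neg] using this

lemma star (h : IsModel τ l coord x) (hF : Represents τ l coord x F y) :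
    Represents τ l coord x (star F) (star y) := by
  refine ⟨hF.1.star, fun δ hδ => ?_⟩
  obtain ⟨p, hp, hpy, hpF⟩ := hF.2 δ hδ
  refine ⟨Star.star p, star_mem hp, ?_, ?_⟩
  · rwa [Prod.snd_star, ← star_sub, h.trace.isTrace.tnorm_star]
  · filter_upwards [hpF] with i h1
    rwa [Prod.fst_star, Pi.star_apply, Pi.star_apply, Pi.star_apply, Pi.star_apply, ← star_sub,
      hsnorm, (isTrace_ntrLin _).tnorm_star]

lemma mul (h : IsModel τ l coord x) (hF : Represents τ l coord x F y)
    (hF' : Represents τ l coord x F' y') : Represents τ l coord x (F * F') (y * y') := by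
  refine ⟨hF.1.mul hF'.1, fun δ hδ => ?_⟩
  obtain ⟨C, hC, hFC⟩ := hF.1.pos
  set C' := max C (‖y‖) with hC'
  have hC'0 : 0 < C' := lt_max_of_lt_left hC
  obtain ⟨q, hq, hqy, hqF⟩ := hF'.2 (δ / (2 * C')) (by positivity)
  obtain ⟨D, hD, hqD⟩ := (IsBddSec.of_mem_polyPairs h.bdd hq).pos
  set D' := max D (‖q.2‖) with hD'
  have hD'0 : 0 < D' := lt_max_of_lt_left hD
  obtain ⟨p, hp, hpy, hpF⟩ := hF.2 (δ / (2 * D')) (by positivity)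
  have key : ∀ s t : ℝ, s < δ / (2 * D') → t < δ / (2 * C') → s * D' + C' * t < δ := by
    intro s t hs ht
    rw [lt_div_iff₀ (by positivity)] at hs ht
    linarith
  refine ⟨p * q, mul_mem hp hq, ?_, ?_⟩
  · have ht := h.trace.isTrace
    have e : (p * q).2 - y * y' = (p.2 - y) * q.2 + y * (q.2 - y') := by
      rw [Prod.snd_mul]; noncomm_ring
    rw [e]
    refine lt_of_le_of_lt ?_ (key _ _ hpy hqy)
    refine (ht.tnorm_add_le _ _).trans (add_le_add ((ht.tnorm_mul_le_right _ _).trans ?_)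
      ((ht.tnorm_mul_le_left _ _).trans ?_))
    · exact mul_le_mul_of_nonneg_left (le_max_right _ _) (tnorm_nonneg _)
    · exact mul_le_mul_of_nonneg_right (le_max_right _ _) (tnorm_nonneg _)
  · filter_upwards [hpF, hqF] with i h1 h2
    have ht := isTrace_ntrLin i.1
    have e : (p * q).1 i.1 i.2 - (F * F') i.1 i.2 = (p.1 i.1 i.2 - F i.1 i.2) * q.1 i.1 i.2
        + F i.1 i.2 * (q.1 i.1 i.2 - F' i.1 i.2) := by
      simp only [Prod.fst_mul, Pi.mul_apply]; noncomm_ring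
    rw [e]
    refine lt_of_le_of_lt ?_ (key _ _ h1 h2)
    refine (ht.tnorm_add_le _ _).trans (add_le_add ((ht.tnorm_mul_le_right _ _).trans ?_)
      ((ht.tnorm_mul_le_left _ _).trans ?_))
    · exact mul_le_mul_of_nonneg_left ((hqD _ _).trans (le_max_left _ _)) (tnorm_nonneg _)
    · exact mul_le_mul_of_nonneg_right ((hFC _ _).trans (le_max_left _ _)) (tnorm_nonneg _)

lemma sum (h : IsModel τ l coord x) {ι : Type*} (s : Finset ι) {F : ι → Sec X}
    {y : ι → M.toStarSubalgebra} (hF : ∀ i, Represents τ l coord x (F i) (y i)) :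
    Represents τ l coord x (∑ i ∈ s, F i) (∑ i ∈ s, y i) := by
  classical
  induction s using Finset.induction_on with
  | empty => simpa using h.represents_of_mem (p := 0) (zero_mem _)
  | insert a s ha ih => rw [Finset.sum_insert ha, Finset.sum_insert ha]; exact (hF a).add h ih

lemma tendsto_ntr (h : IsModel τ l coord x) (hF : Represents τ l coord x F y) :
    Tendsto (fun i : Σ k, X k => ntr (F i.1 i.2)) l (𝓝 (τ y)) := by
  rw [Metric.tendsto_nhds]
  intro δ hδ
  obtain ⟨p, hp, hpy, hpF⟩ := hF.2 (δ / 3) (by positivity)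
  filter_upwards [hpF, Metric.tendsto_nhds.1 (h.tendsto_ntr_of_mem hp) (δ / 3) (by positivity)]
    with i h1 h2
  rw [dist_eq_norm] at h2 ⊢
  have h3 : ‖ntrLin i.1 (p.1 i.1 i.2 - F i.1 i.2)‖ < δ / 3 :=
    ((isTrace_ntrLin i.1).norm_apply_le _).trans_lt h1
  have h4 : ‖τ (p.2 - y)‖ < δ / 3 := (h.trace.isTrace.norm_apply_le _).trans_lt hpy
  rw [map_sub] at h3 h4
  rw [← ntrLin_apply]
  calc _ = ‖(ntrLin i.1 (p.1 i.1 i.2) - τ p.2) + (τ p.2 - τ y)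
        - (ntrLin i.1 (p.1 i.1 i.2) - ntrLin i.1 (F i.1 i.2))‖ := by congr 1; ring
    _ ≤ _ := (norm_sub_le _ _).trans (add_le_add_left (norm_add_le _ _) _)
    _ < δ := by linarith

lemma tendsto_hsnorm (h : IsModel τ l coord x) (hF : Represents τ l coord x F y) :
    Tendsto (fun i : Σ k, X k => hsnorm (F i.1 i.2)) l (𝓝 (tnorm τ y)) :=
  ((Complex.continuous_re.tendsto _).comp (((hF.star h).mul h hF).tendsto_ntr h)).sqrt

lemma isNull (h : IsModel τ l coord x) (hF : Represents τ l coord x F 0) : IsNull l F := by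
  simpa [IsNull] using hF.tendsto_hsnorm h

lemma isNull_sub (h : IsModel τ l coord x) (hF : Represents τ l coord x F y)
    (hF' : Represents τ l coord x F' y) : IsNull l (F - F') := by
  have := hF.sub h hF'
  rw [sub_self] at this
  exact this.isNull h

/-- Self-adjoint contractions are represented by diagonal sequences: at each index, the polynomial
approximation is as precise as the index allows. -/
lemma exists_of_norm_le_one (h : IsModel τ l coord x) (hy : IsSelfAdjoint y) (hy1 : ‖y‖ ≤ 1) :
    ∃ F, Represents τ l coord x F y := by
  classical
  have ht := h.trace.isTrace
  choose p hp hp1 hpy using fun r : ℕ => h.exists_contractive_approx hy hy1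
    (δ := (1 / 2 : ℝ) ^ r) (by positivity)
  -- at the index `i`, the first `r` approximations are as close to the `r`-th one as expected
  let V : (Σ k, X k) → ℕ → Prop := fun i r =>
    ∀ r' ≤ r, hsnorm ((p r').1 i.1 i.2 - (p r).1 i.1 i.2) < 3 * (1 / 2 : ℝ) ^ r'
  have hV : ∀ r, ∀ᶠ i in l, V i r := by
    intro r
    have : ∀ r' ∈ Set.Iic r, ∀ᶠ i in l,
        hsnorm ((p r').1 i.1 i.2 - (p r).1 i.1 i.2) < 3 * (1 / 2 : ℝ) ^ r' := by
      intro r' hr'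
      refine (h.tendsto_hsnorm_of_mem (sub_mem (hp r') (hp r))).eventually_lt_const ?_
      have h1 : (1 / 2 : ℝ) ^ r ≤ (1 / 2 : ℝ) ^ r' :=
        pow_le_pow_of_le_one (by norm_num) (by norm_num) hr'
      have h2 := ht.tnorm_sub_le_add (p r').2 y (p r).2
      have h3 := hpy r
      rw [ht.tnorm_sub_comm] at h3
      have h4 := hpy r'
      have h5 : (0 : ℝ) < (1 / 2) ^ r' := by positivity
      rw [Prod.snd_sub]
      linarith
    exact (Filter.eventually_all_finite (Set.finite_Iic r)).2 this
  let r : (Σ k, X k) → ℕ := fun i => Nat.findGreatest (V i) i.1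
  refine ⟨fun k a => (p (r ⟨k, a⟩)).1 k a, ⟨1, fun k a => hp1 _ k a⟩, fun δ hδ => ?_⟩
  obtain ⟨r₀, hr₀⟩ := exists_pow_lt_of_lt_one (show 0 < δ / 3 by positivity)
    (show (1 / 2 : ℝ) < 1 by norm_num)
  refine ⟨p r₀, hp r₀, (hpy r₀).trans (by linarith), ?_⟩
  filter_upwards [hV r₀, h.size.eventually_ge_atTop r₀] with i h1 h2
  have h3 : V i (r i) := Nat.findGreatest_spec (P := V i) h2 h1
  have h4 : r₀ ≤ r i := Nat.le_findGreatest h2 h1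
  exact (h3 r₀ h4).trans (by linarith)

end Represents

/-- Each element of `M` is represented in the model. -/
theorem IsModel.exists_represents (h : IsModel τ l coord x) (y : M.toStarSubalgebra) :
    ∃ F, Represents τ l coord x F y := by
  have key : ∀ a : M.toStarSubalgebra, IsSelfAdjoint a → ∃ F, Represents τ l coord x F a := by
    intro a ha
    have hpos : 0 < ‖a‖ + 1 := by positivity
    obtain ⟨F, hF⟩ := Represents.exists_of_norm_le_one (y := ((‖a‖ + 1 : ℝ) : ℂ)⁻¹ • a) h
      (by rw [IsSelfAdjoint, star_smul, ha.star_eq]; simp) (by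
        rw [norm_smul, norm_inv, Complex.norm_real, Real.norm_of_nonneg hpos.le,
          inv_mul_le_iff₀ hpos]
        linarith)
    refine ⟨((‖a‖ + 1 : ℝ) : ℂ) • F, ?_⟩
    have := hF.smul h ((‖a‖ + 1 : ℝ) : ℂ)
    rwa [smul_smul, mul_inv_cancel₀ (by exact_mod_cast hpos.ne'), one_smul] at this
  obtain ⟨F, hF⟩ := key _ (realPart y).2
  obtain ⟨G, hG⟩ := key _ (imaginaryPart y).2
  refine ⟨F + Complex.I • G, ?_⟩
  have := hF.add h (hG.smul h Complex.I)
  rwa [realPart_add_I_smul_imaginaryPart] at this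

end Model

/-! ### Small projections in diffuse von Neumann algebras -/

section Projections

open Filter Topology

variable {H : Type*} [NormedAddCommGroup H] [InnerProductSpace ℂ H] [CompleteSpace H]

/-- A chain of projections converges strongly to its supremum. -/
lemma exists_sup_projection {ι : Type*} [Nonempty ι] {p : ι → H →L[ℂ] H}
    (hp : ∀ i, IsStarProjection (p i)) (hchain : ∀ i j, p j * p i = p i ∨ p i * p j = p j) :
    ∃ e, IsStarProjection e ∧ (∀ i, e * p i = p i) ∧
      ∃ f : Filter ι, f.NeBot ∧ ∀ v, Tendsto (fun i => p i v) f (𝓝 (e v)) := by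
  let _ : Preorder ι :=
    { le := fun i j => p j * p i = p i
      le_refl := fun i => (hp i).isIdempotentElem
      le_trans := fun i j k (h1 : p j * p i = p i) (h2 : p k * p j = p j) =>
        show p k * p i = p i by rw [← h1, ← mul_assoc, h2] }
  have : IsDirectedOrder ι := ⟨fun i j => (hchain i j).elim (fun h => ⟨j, h, le_refl j⟩)
    fun h => ⟨i, le_refl i, h⟩⟩
  have hU := fun i => _root_.isStarProjection_iff_eq_starProjection_range.1 (hp i)
  let U : ι → Submodule ℂ H := fun i => (p i).range
  have hproj : ∀ i, (U i).HasOrthogonalProjection := fun i => (hU i).1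
  have hpU : ∀ i, p i = (U i).starProjection := fun i => (hU i).2
  have hUm : Monotone U := by
    rintro i j hij _ ⟨v, rfl⟩
    exact ⟨p i v, congrArg (fun f : H →L[ℂ] H => f v) hij⟩
  refine ⟨(⨆ i, U i).topologicalClosure.starProjection, isStarProjection_starProjection,
    fun i => ?_, atTop, inferInstance, fun v => ?_⟩
  · ext v
    refine Submodule.starProjection_eq_self_iff.2 ?_
    exact Submodule.le_topologicalClosure _ (le_iSup U i ⟨v, rfl⟩)
  · have := Submodule.starProjection_tendsto_closure_iSup U hUm v
    exact this.congr fun i => by rw [← hpU]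

lemma mem_of_tendsto_apply {A : VonNeumannAlgebra H} {ι : Type*} {f : Filter ι} [f.NeBot]
    {p : ι → H →L[ℂ] H} {e : H →L[ℂ] H} (hp : ∀ i, p i ∈ A)
    (he : ∀ v, Tendsto (fun i => p i v) f (𝓝 (e v))) : e ∈ A := by
  rw [← VonNeumannAlgebra.commutant_commutant A, VonNeumannAlgebra.mem_commutant_iff]
  intro z hz
  rw [VonNeumannAlgebra.mem_commutant_iff] at hz
  ext v
  have h1 : Tendsto (fun i => z (p i v)) f (𝓝 (z (e v))) := (z.continuous.tendsto _).comp (he v)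
  refine tendsto_nhds_unique h1 ((he (z v)).congr fun i => ?_)
  exact congrArg (fun f : H →L[ℂ] H => f v) (hz _ (hp i))

variable {M : VonNeumannAlgebra H} {τ : M.toStarSubalgebra →ₗ[ℂ] ℂ}

lemma IsTracialState.re_projection (hτ : IsTracialState M τ) {p : M.toStarSubalgebra}
    (hp : IsStarProjection p) : (τ p).re = tnorm τ p ^ 2 := by
  rw [hτ.isTrace.sq_tnorm, hp.isSelfAdjoint.star_eq, hp.isIdempotentElem.eq]

lemma IsTracialState.eq_zero_of_re_le (hτ : IsTracialState M τ) {p : M.toStarSubalgebra}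
    (hp : IsStarProjection p) (h : (τ p).re ≤ 0) : p = 0 := by
  refine hτ.faithful p ?_
  rw [hτ.re_projection hp] at h
  have h0 : tnorm τ p ^ 2 = 0 := le_antisymm h (by positivity)
  rw [hτ.isTrace.apply_star_mul_self, h0, Complex.ofReal_zero]

/-- Normality of the trace, for increasing nets of projections. -/
lemma IsTracialState.re_le_of_tendsto (hτ : IsTracialState M τ) {ι : Type*} {f : Filter ι}
    [f.NeBot] {p : ι → M.toStarSubalgebra} {e : M.toStarSubalgebra} {θ : ℝ}
    (hp : ∀ i, IsStarProjection (p i)) (he' : IsStarProjection e)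
    (he : ∀ v, Tendsto (fun i => (p i : H →L[ℂ] H) v) f (𝓝 ((e : H →L[ℂ] H) v)))
    (hθ : ∀ i, (τ (p i)).re ≤ θ) : (τ e).re ≤ θ := by
  obtain ⟨ξ, -, hξ⟩ := hτ.normal
  have hsum : ∀ q : M.toStarSubalgebra, IsStarProjection q →
      HasSum (fun i => ‖(q : H →L[ℂ] H) (ξ i)‖ ^ 2) (τ q).re := by
    intro q hq
    refine (Complex.hasSum_re (hξ q)).congr_fun fun i => ?_
    have h1 : (q : H →L[ℂ] H) = star (q : H →L[ℂ] H) * (q : H →L[ℂ] H) := by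
      have : q = star q * q := by rw [hq.isSelfAdjoint.star_eq, hq.isIdempotentElem.eq]
      exact congrArg Subtype.val this
    conv_rhs => rw [h1]
    rw [mul_apply_eq_comp, ContinuousLinearMap.star_eq_adjoint,
      ContinuousLinearMap.adjoint_inner_right, inner_self_eq_norm_sq_to_K]
    norm_cast
  refine hasSum_le_of_sum_le (hsum e he') fun s => ?_
  refine le_of_tendsto (f := fun i => ∑ j ∈ s, ‖(p i : H →L[ℂ] H) (ξ j)‖ ^ 2) (x := f)
    (tendsto_finsetSum s fun j _ => ((he (ξ j)).norm).pow 2) (Eventually.of_forall fun i => ?_)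
  exact (sum_le_hasSum s (fun _ _ => by positivity) (hsum _ (hp i))).trans (hθ i)

lemma isStarProjection_coe {p : M.toStarSubalgebra} :
    IsStarProjection (p : H →L[ℂ] H) ↔ IsStarProjection p := by
  rw [isStarProjection_iff', isStarProjection_iff', Subtype.ext_iff, Subtype.ext_iff]
  rfl

variable {A : VonNeumannAlgebra H}

lemma IsDiffuse.exists_half (τ : M.toStarSubalgebra →ₗ[ℂ] ℂ) (hAM : A ≤ M) (hA : IsDiffuse A)
    {p : M.toStarSubalgebra} (hpA : (p : H →L[ℂ] H) ∈ A) (hp : IsStarProjection p) (h0 : p ≠ 0) :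
    ∃ q : M.toStarSubalgebra, (q : H →L[ℂ] H) ∈ A ∧ IsStarProjection q ∧ q ≠ 0 ∧ p * q = q ∧
      (τ q).re ≤ (τ p).re / 2 := by
  obtain ⟨q', hqA, hq, hpq, hq0, hqp⟩ := hA p hpA (isStarProjection_coe.2 hp)
    (fun h => h0 (Subtype.ext h))
  lift q' to M.toStarSubalgebra using hAM hqA with q
  rw [isStarProjection_coe] at hq
  have hpq' : p * q = q := Subtype.ext hpq
  rcases le_total (τ q).re ((τ p).re / 2) with h | h
  · exact ⟨q, hqA, hq, fun h => hq0 (by rw [h]; rfl), hpq', h⟩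
  · refine ⟨p - q, sub_mem hpA hqA, hq.sub_of_mul_eq_right hp hpq', fun h => hqp ?_, ?_, ?_⟩
    · rw [sub_eq_zero.1 h]
    · rw [mul_sub, hp.isIdempotentElem.eq, hpq']
    · rw [map_sub, Complex.sub_re]; linarith

lemma IsDiffuse.exists_small (τ : M.toStarSubalgebra →ₗ[ℂ] ℂ) (hAM : A ≤ M) (hA : IsDiffuse A)
    {p : M.toStarSubalgebra} (hpA : (p : H →L[ℂ] H) ∈ A) (hp : IsStarProjection p) (h0 : p ≠ 0)
    {θ : ℝ} (hθ : 0 < θ) :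
    ∃ q : M.toStarSubalgebra, (q : H →L[ℂ] H) ∈ A ∧ IsStarProjection q ∧ q ≠ 0 ∧ p * q = q ∧
      (τ q).re ≤ θ := by
  have key : ∀ r : ℕ, ∃ q : M.toStarSubalgebra, (q : H →L[ℂ] H) ∈ A ∧ IsStarProjection q ∧
      q ≠ 0 ∧ p * q = q ∧ (τ q).re ≤ (1 / 2) ^ r * (τ p).re := by
    intro r
    induction r with
    | zero => exact ⟨p, hpA, hp, h0, hp.isIdempotentElem, by simp⟩
    | succ r ih =>
      obtain ⟨q, hqA, hq, hq0, hpq, hr⟩ := ih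
      obtain ⟨q', hqA', hq', hq0', hqq, hr'⟩ := hA.exists_half τ hAM hqA hq hq0
      refine ⟨q', hqA', hq', hq0', ?_, hr'.trans ?_⟩
      · rw [← hqq, ← mul_assoc, hpq]
      · rw [pow_succ]; linarith
  have hlim : Tendsto (fun r : ℕ => (1 / 2 : ℝ) ^ r * (τ p).re) atTop (𝓝 (0 * (τ p).re)) :=
    (tendsto_pow_atTop_nhds_zero_of_lt_one (by norm_num) (by norm_num)).mul_const _
  rw [zero_mul] at hlim
  obtain ⟨r, hr⟩ := (hlim.eventually_lt_const hθ).exists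
  obtain ⟨q, hqA, hq, hq0, hpq, hq1⟩ := key r
  exact ⟨q, hqA, hq, hq0, hpq, hq1.trans hr.le⟩

/-- Below a projection `e` of a diffuse algebra there is a projection of trace exactly `θ`, unless
`e` itself has smaller trace: a maximal projection of trace at most `θ`. -/
lemma IsDiffuse.exists_re_eq (hτ : IsTracialState M τ) (hAM : A ≤ M) (hA : IsDiffuse A)
    {e : M.toStarSubalgebra} (heA : (e : H →L[ℂ] H) ∈ A) (he : IsStarProjection e) {θ : ℝ}
    (hθ : 0 ≤ θ) :
    ∃ m : M.toStarSubalgebra, (m : H →L[ℂ] H) ∈ A ∧ IsStarProjection m ∧ e * m = m ∧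
      (τ m).re ≤ θ ∧ (m = e ∨ (τ m).re = θ) := by
  -- Zorn's lemma for the projections below `e` of trace at most `θ`
  let P := {m : M.toStarSubalgebra // (m : H →L[ℂ] H) ∈ A ∧ IsStarProjection m ∧ e * m = m ∧
    (τ m).re ≤ θ}
  have htrans : ∀ {a b c : P}, b.1 * a.1 = a.1 → c.1 * b.1 = b.1 → c.1 * a.1 = a.1 := by
    intro a b c h1 h2
    rw [← h1, ← mul_assoc, h2]
  have hchain : ∀ c : Set P, IsChain (fun p q : P => q.1 * p.1 = p.1) c →
      ∃ ub : P, ∀ a ∈ c, ub.1 * a.1 = a.1 := by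
    intro c hc
    rcases c.eq_empty_or_nonempty with rfl | hne
    · exact ⟨⟨0, zero_mem A, IsStarProjection.zero _, mul_zero _, by simpa using hθ⟩, by simp⟩
    have : Nonempty c := hne.to_subtype
    obtain ⟨s, hs, hsup, f, hf, hlim⟩ := exists_sup_projection (ι := c)
      (p := fun i => (i.1.1 : H →L[ℂ] H)) (fun i => isStarProjection_coe.2 i.1.2.2.1) (fun i j => by
        by_cases hij : i = j
        · rw [hij]; exact Or.inl (isStarProjection_coe.2 j.1.2.2.1).isIdempotentElem
        · exact (hc i.2 j.2 fun h => hij (Subtype.ext h)).imp (congrArg Subtype.val)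
            (congrArg Subtype.val))
    have hsA : s ∈ A := mem_of_tendsto_apply (fun i : c => i.1.2.1) hlim
    lift s to M.toStarSubalgebra using hAM hsA with s'
    rw [isStarProjection_coe] at hs
    refine ⟨⟨s', hsA, hs, Subtype.ext ?_, ?_⟩, fun a ha => Subtype.ext (hsup ⟨a, ha⟩)⟩
    · ext v
      refine tendsto_nhds_unique (((e : H →L[ℂ] H).continuous.tendsto _).comp (hlim v))
        ((hlim v).congr fun i => ?_)
      exact (congrArg (fun f : M.toStarSubalgebra => (f : H →L[ℂ] H) v) i.1.2.2.2.1).symm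
    · exact hτ.re_le_of_tendsto (fun i : c => i.1.2.2.1) hs hlim fun i => i.1.2.2.2.2
  obtain ⟨m, hm⟩ := exists_maximal_of_chains_bounded (r := fun p q : P => q.1 * p.1 = p.1)
    hchain htrans
  obtain ⟨hmA, hmp, hem, hmθ⟩ := m.2
  refine ⟨m.1, hmA, hmp, hem, hmθ, ?_⟩
  -- otherwise a small projection below `e - m` can be added to `m`
  by_contra! hcon
  have hem' : m.1 * e = m.1 := by
    have := congrArg star hem
    rwa [star_mul, he.isSelfAdjoint.star_eq, hmp.isSelfAdjoint.star_eq] at this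
  obtain ⟨q, hqA, hq, hq0, hle, hqθ⟩ := hA.exists_small τ hAM (sub_mem heA hmA)
    (p := e - m.1) (hmp.sub_of_mul_eq_right he hem) (sub_ne_zero.2 hcon.1.symm)
    (sub_pos.2 (lt_of_le_of_ne hmθ hcon.2))
  have hmq : m.1 * q = 0 := by
    rw [← hle, ← mul_assoc, mul_sub, hem', hmp.isIdempotentElem.eq, sub_self, zero_mul]
  have hqm : q * m.1 = 0 := by
    have := congrArg star hmq
    rwa [star_mul, hq.isSelfAdjoint.star_eq, hmp.isSelfAdjoint.star_eq, star_zero] at this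
  have heq : e * q = q := by
    rw [sub_mul, hmq, sub_zero] at hle
    exact hle
  have := hm ⟨m.1 + q, add_mem hmA hqA, hmp.add hq hmq, by rw [mul_add, hem, heq], by
    rw [map_add, Complex.add_re]; linarith⟩ (by
      change (m.1 + q) * m.1 = m.1
      rw [add_mul, hmp.isIdempotentElem.eq, hqm, add_zero])
  change m.1 * (m.1 + q) = m.1 + q at this
  rw [mul_add, hmq, hmp.isIdempotentElem.eq, add_zero] at this
  exact hq0 (by simpa using this.symm)

/-- A diffuse algebra contains partitions of unity into projections of small trace. -/
theorem IsDiffuse.exists_partition (hτ : IsTracialState M τ) (hAM : A ≤ M) (hA : IsDiffuse A)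
    {θ : ℝ} (hθ : 0 < θ) : ∃ (N : ℕ) (p : Fin N → M.toStarSubalgebra),
      (∀ j, (p j : H →L[ℂ] H) ∈ A) ∧ (∀ j, IsStarProjection (p j)) ∧
      (∀ i j, i ≠ j → p i * p j = 0) ∧ ∑ j, p j = 1 ∧ ∀ j, (τ (p j)).re ≤ θ := by
  -- projections of trace exactly `θ` are split off until the rest has smaller trace; the remaining
  -- pieces are zero
  have key : ∀ (N : ℕ) (e : M.toStarSubalgebra), (e : H →L[ℂ] H) ∈ A → IsStarProjection e →
      (τ e).re ≤ N * θ → ∃ p : Fin N → M.toStarSubalgebra, (∀ j, (p j : H →L[ℂ] H) ∈ A) ∧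
      (∀ j, IsStarProjection (p j)) ∧ (∀ i j, i ≠ j → p i * p j = 0) ∧ ∑ j, p j = e ∧
      (∀ j, (τ (p j)).re ≤ θ) ∧ ∀ j, e * p j = p j := by
    intro N
    induction N with
    | zero =>
      intro e _ he h
      refine ⟨Fin.elim0, fun j => j.elim0, fun j => j.elim0, fun j => j.elim0, ?_,
        fun j => j.elim0, fun j => j.elim0⟩
      rw [hτ.eq_zero_of_re_le he (by simpa using h)]
      simp
    | succ N ih =>
      intro e heA he h
      obtain ⟨m, hmA, hm, hem, hmθ, hor⟩ := hA.exists_re_eq hτ hAM heA he hθ.le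
      have hme : m * e = m := by
        have := congrArg star hem
        rwa [star_mul, he.isSelfAdjoint.star_eq, hm.isSelfAdjoint.star_eq] at this
      obtain ⟨p, hpA, hp, hpp, hsum, hpθ, hle⟩ := ih (e - m) (sub_mem heA hmA)
        (hm.sub_of_mul_eq_right he hem) (by
          rcases hor with rfl | h'
          · simpa using by positivity
          · rw [map_sub, Complex.sub_re, h']
            push_cast at h
            linarith)
      have hmp : ∀ j, m * p j = 0 := fun j => by
        rw [← hle, ← mul_assoc, mul_sub, hme, hm.isIdempotentElem.eq, sub_self, zero_mul]
      have hpm : ∀ j, p j * m = 0 := fun j => by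
        have := congrArg star (hmp j)
        rwa [star_mul, (hp j).isSelfAdjoint.star_eq, hm.isSelfAdjoint.star_eq, star_zero] at this
      refine ⟨Fin.cons m p, ?_, ?_, ?_, ?_, ?_, ?_⟩
      · exact Fin.cases hmA hpA
      · exact Fin.cases hm hp
      · refine Fin.cases (Fin.cases (by simp) fun j _ => hmp j) fun i =>
          Fin.cases (fun _ => hpm i) fun j hij => hpp i j fun h => hij (by rw [h])
      · rw [Fin.sum_univ_succ]
        simp [hsum]
      · exact Fin.cases hmθ hpθ
      · refine Fin.cases hem fun j => ?_
        have := hle j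
        rwa [sub_mul, hmp, sub_zero] at this
  obtain ⟨N, hN⟩ := exists_nat_ge (1 / θ)
  obtain ⟨p, hpA, hp, hpp, hsum, hpθ, -⟩ := key N 1 (one_mem A) (IsStarProjection.one _) (by
    rw [hτ.map_one, Complex.one_re]
    rwa [div_le_iff₀ hθ] at hN)
  exact ⟨N, p, hpA, hp, hpp, hsum, hpθ⟩

/-- The range projection of an element of a von Neumann algebra. -/
lemma exists_range_projection {F : H →L[ℂ] H} (hF : F ∈ A) : ∃ r ∈ A, IsStarProjection r ∧
    r * F = F ∧ ∀ G : H →L[ℂ] H, G * F = 0 → G * r = 0 := by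
  let K : Submodule ℂ H := F.range.topologicalClosure
  have hmem : ∀ v, F v ∈ K := fun v => Submodule.le_topologicalClosure _ ⟨v, rfl⟩
  refine ⟨K.starProjection, ?_, isStarProjection_starProjection, ?_, fun G hG => ?_⟩
  · rw [VonNeumannAlgebra.IsStarProjection.mem_iff isStarProjection_starProjection]
    intro y hy
    have hr : (K.starProjection).range = K := Submodule.range_starProjection K
    rw [hr]
    intro v hv
    refine map_mem_closure y.continuous hv ?_
    rintro _ ⟨w, rfl⟩
    rw [VonNeumannAlgebra.mem_commutant_iff] at hy
    exact ⟨y w, congrArg (fun f : H →L[ℂ] H => f w) (hy F hF)⟩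
  · ext v
    exact Submodule.starProjection_eq_self_iff.2 (hmem v)
  · ext v
    have h1 : K ≤ LinearMap.ker (G : H →ₗ[ℂ] H) := by
      refine Submodule.topologicalClosure_minimal _ ?_ G.isClosed_ker
      rintro _ ⟨w, rfl⟩
      exact congrArg (fun f : H →L[ℂ] H => f w) hG
    exact h1 (Submodule.starProjection_apply_mem K v)

/-- The compression of an abelian von Neumann algebra by a minimal projection `p` consists of
operators with definite quadratic forms: the positive and negative part of `b` have disjoint range
projections below `p`. -/
lemma re_inner_definite_of_minimal (hcomm : ∀ a ∈ A, ∀ b ∈ A, a * b = b * a) {p : H →L[ℂ] H}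
    (hpA : p ∈ A) (hp : IsStarProjection p)
    (hmin : ∀ q ∈ A, IsStarProjection q → p * q = q → q ≠ 0 → q = p) {b : H →L[ℂ] H}
    (hbA : b ∈ A) (hb : IsSelfAdjoint b) :
    (∀ v, p v = v → 0 ≤ (inner ℂ v (b v)).re) ∨ (∀ v, p v = v → (inner ℂ v (b v)).re ≤ 0) := by
  have hmem : ∀ f : ℝ → ℝ, cfc f b ∈ A := by
    intro f
    rw [← VonNeumannAlgebra.commutant_commutant A, VonNeumannAlgebra.mem_commutant_iff]
    intro z hz
    rw [VonNeumannAlgebra.mem_commutant_iff] at hz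
    exact (Commute.cfc_real (show Commute b z from hz b hbA) f).symm
  -- `b = f - g` with `f`, `g` nonnegative and `g f = 0`; the range projection `r` of `p f` is `0`
  -- or `p`
  set f := cfc (fun t : ℝ => max t 0) b with hf
  set g := cfc (fun t : ℝ => max (-t) 0) b with hg
  have hgf : g * f = 0 := by
    rw [hf, hg, ← cfc_mul (fun t : ℝ => max (-t) 0) (fun t : ℝ => max t 0) b
      (by fun_prop) (by fun_prop), ← cfc_const_zero ℝ b]
    refine cfc_congr fun t _ => ?_
    rcases le_total t 0 with h | h <;> simp [h]
  have hbfg : b = f - g := by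
    rw [hf, hg, ← cfc_sub (fun t : ℝ => max t 0) (fun t : ℝ => max (-t) 0) b
      (by fun_prop) (by fun_prop)]
    conv_lhs => rw [← cfc_id ℝ b]
    refine cfc_congr fun t _ => ?_
    rcases le_total t 0 with h | h <;> simp [h]
  have hf0 : 0 ≤ f := cfc_nonneg fun t _ => le_max_right _ _
  have hg0 : 0 ≤ g := cfc_nonneg fun t _ => le_max_right _ _
  have hpos : ∀ T : H →L[ℂ] H, 0 ≤ T → ∀ v, 0 ≤ (inner ℂ v (T v)).re := fun T hT v =>
    ((ContinuousLinearMap.nonneg_iff_isPositive T).1 hT).re_inner_nonneg_right v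
  obtain ⟨r, hrA, hr, hrf, hrG⟩ := exists_range_projection (mul_mem hpA (hmem fun t => max t 0))
  have hpr : p * r = r := by
    have h1 := hrG (1 - p) (by
      rw [sub_mul, one_mul, ← mul_assoc, hp.isIdempotentElem.eq, sub_self])
    rw [sub_mul, one_mul, sub_eq_zero] at h1
    exact h1.symm
  have hgr : g * r = 0 := hrG g (by
    rw [← mul_assoc, hcomm g (hmem _) p hpA, mul_assoc, hgf, mul_zero])
  by_cases h0 : r = 0
  · right
    intro v hv
    have hfv : f v = 0 := by
      have h1 : f * p = 0 := by
        rw [hcomm f (hmem _) p hpA]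
        change r * (p * f) = p * f at hrf
        rw [← hrf, h0, zero_mul]
      have := congrArg (fun T : H →L[ℂ] H => T v) h1
      simpa [hv] using this
    rw [hbfg]
    have := hpos g hg0 v
    simp only [sub_apply, hfv, zero_sub, inner_neg_right, Complex.neg_re]
    linarith
  · left
    intro v hv
    have hgv : g v = 0 := by
      rw [hmin r hrA hr hpr h0] at hgr
      have := congrArg (fun T : H →L[ℂ] H => T v) hgr
      simpa [hv] using this
    rw [hbfg]
    simpa [hgv] using hpos f hf0 v

/-- A minimal projection of an abelian von Neumann algebra compresses it to scalars: by definiteness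
of the forms of `a - t` for all real `t`, the Rayleigh quotient of `a` is constant on the range of
`p`. -/
lemma exists_smul_of_minimal (hcomm : ∀ a ∈ A, ∀ b ∈ A, a * b = b * a) {p : H →L[ℂ] H}
    (hpA : p ∈ A) (hp : IsStarProjection p)
    (hmin : ∀ q ∈ A, IsStarProjection q → p * q = q → q ≠ 0 → q = p) {a : H →L[ℂ] H}
    (haA : a ∈ A) (ha : IsSelfAdjoint a) (hp0 : p ≠ 0) : ∃ c : ℂ, a * p = c • p := by
  obtain ⟨v₀, hv₀⟩ : ∃ v, p v ≠ 0 := by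
    by_contra! h
    exact hp0 (ContinuousLinearMap.ext h)
  have hpp : ∀ v, p (p v) = p v := fun v => congrArg (fun T : H →L[ℂ] H => T v) hp.isIdempotentElem
  have hform : ∀ (t : ℝ) v, (inner ℂ v ((a - (t : ℂ) • (1 : H →L[ℂ] H)) v)).re =
      (inner ℂ v (a v)).re - t * ‖v‖ ^ 2 := by
    intro t v
    simp only [sub_apply, smul_apply, one_apply_eq_self, inner_sub_right, inner_smul_right,
      inner_self_eq_norm_sq_to_K, Complex.sub_re]
    rw [Complex.re_ofReal_mul]
    norm_cast
  have hsa : ∀ t : ℝ, IsSelfAdjoint (a - (t : ℂ) • (1 : H →L[ℂ] H)) := fun t => by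
    rw [IsSelfAdjoint, star_sub, star_smul, star_one, ha.star_eq]
    simp
  have hA' : ∀ t : ℝ, a - (t : ℂ) • (1 : H →L[ℂ] H) ∈ A := fun t =>
    sub_mem haA (show _ ∈ A.toStarSubalgebra from SMulMemClass.smul_mem _ (one_mem _))
  have hlt : ∀ v w, p v = v → p w = w → (inner ℂ v (a v)).re * ‖w‖ ^ 2 ≤
      (inner ℂ w (a w)).re * ‖v‖ ^ 2 := by
    intro v w hv hw
    by_contra! hcon
    have hv0 : v ≠ 0 := by rintro rfl; simp at hcon
    have hw0 : w ≠ 0 := by rintro rfl; simp at hcon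
    have hv1 : 0 < ‖v‖ ^ 2 := by positivity
    have hw1 : 0 < ‖w‖ ^ 2 := by positivity
    have h1 : (inner ℂ w (a w)).re / ‖w‖ ^ 2 < (inner ℂ v (a v)).re / ‖v‖ ^ 2 := by
      rwa [div_lt_div_iff₀ hw1 hv1]
    -- for `t` between two Rayleigh quotients, `a - t` would have an indefinite form
    obtain ⟨t, ht1, ht2⟩ := exists_between h1
    rw [div_lt_iff₀ hw1] at ht1
    rw [lt_div_iff₀ hv1] at ht2
    rcases re_inner_definite_of_minimal hcomm hpA hp hmin (hA' t) (hsa t) with h | h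
    · have := h w hw
      rw [hform] at this
      linarith
    · have := h v hv
      rw [hform] at this
      linarith
  have hn : 0 < ‖p v₀‖ ^ 2 := by positivity
  set c : ℝ := (inner ℂ (p v₀) (a (p v₀))).re / ‖p v₀‖ ^ 2 with hc
  refine ⟨c, ?_⟩
  have hzero : ∀ v, p v = v → (inner ℂ v ((a - (c : ℂ) • (1 : H →L[ℂ] H)) v)).re = 0 := by
    intro v hv
    rw [hform, hc, sub_eq_zero, div_mul_eq_mul_div, eq_div_iff hn.ne']
    exact le_antisymm (hlt _ _ hv (hpp v₀)) (hlt _ _ (hpp v₀) hv)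
  have hT : p * (a - (c : ℂ) • (1 : H →L[ℂ] H)) * p = 0 := by
    refine ContinuousLinearMap.coe_injective ((inner_map_self_eq_zero _).1 fun v => ?_)
    have h1 := hzero (p v) (hpp v)
    have hsym := (hsa c).isSymmetric
    have h2 : inner ℂ ((p * (a - (c : ℂ) • (1 : H →L[ℂ] H)) * p) v) v =
        inner ℂ ((a - (c : ℂ) • (1 : H →L[ℂ] H)) (p v)) (p v) :=
      hp.isSelfAdjoint.isSymmetric _ _
    have h3 : inner ℂ ((a - (c : ℂ) • (1 : H →L[ℂ] H)) (p v)) (p v) =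
        inner ℂ (p v) ((a - (c : ℂ) • (1 : H →L[ℂ] H)) (p v)) := hsym _ _
    refine h2.trans (h3.trans (Complex.ext h1 (Complex.conj_eq_iff_im.1 ?_)))
    rw [inner_conj_symm, h3]
  rw [hcomm p hpA _ (hA' c), mul_assoc, hp.isIdempotentElem.eq, sub_mul, smul_one_mul,
    sub_eq_zero] at hT
  exact hT

/-- A maximal abelian subalgebra of a diffuse algebra is diffuse: a minimal projection of the
subalgebra would be minimal in the whole algebra. -/
theorem isDiffuse_of_masa (hM : IsDiffuse M) (hAM : A ≤ M)
    (hmasa : ∀ x ∈ M, x ∈ A ↔ ∀ a ∈ A, x * a = a * x) : IsDiffuse A := by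
  have hcomm : ∀ a ∈ A, ∀ b ∈ A, a * b = b * a := fun a ha => (hmasa a (hAM ha)).1 ha
  intro p hpA hp hp0
  by_contra! hmin
  obtain ⟨q, hqM, hq, hpq, hq0, hqp⟩ := hM p (hAM hpA) hp hp0
  have hqp' : q * p = q := by
    have := congrArg star hpq
    rwa [star_mul, hp.isSelfAdjoint.star_eq, hq.isSelfAdjoint.star_eq] at this
  have hsa : ∀ a ∈ A, IsSelfAdjoint a → q * a = a * q := by
    intro a haA ha
    obtain ⟨c, hc⟩ := exists_smul_of_minimal hcomm hpA hp hmin haA ha hp0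
    have hc' : p * a = c • p := by rw [hcomm p hpA a haA, hc]
    rw [← hpq, ← mul_assoc a, hc, smul_mul_assoc, hpq]
    conv_lhs => rw [← hqp', mul_assoc, hc', mul_smul_comm, hqp']
  -- `q` commutes with `A`, hence lies in `A`, against the minimality of `p` in `A`
  refine hqp (hmin q ((hmasa q hqM).2 fun a ha => ?_) hq hpq hq0)
  have hsmul : ∀ (c : ℂ) {b : H →L[ℂ] H}, b ∈ A → c • b ∈ A := fun c b hb =>
    A.toStarSubalgebra.toSubalgebra.smul_mem hb c
  have h1 : (realPart a : H →L[ℂ] H) ∈ A := by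
    rw [realPart_apply_coe, ← Complex.coe_smul]
    exact hsmul _ (add_mem ha (star_mem ha))
  have h2 : (imaginaryPart a : H →L[ℂ] H) ∈ A := by
    rw [imaginaryPart_apply_coe, ← Complex.coe_smul]
    exact hsmul _ (hsmul _ (sub_mem ha (star_mem ha)))
  rw [← realPart_add_I_smul_imaginaryPart a, mul_add, add_mul, mul_smul_comm, smul_mul_assoc,
    hsa _ h1 (realPart a).2, hsa _ h2 (imaginaryPart a).2]

end Projections

/-! ### Orbit-smallness of von Neumann subalgebras -/

section Subalgebras

open Filter Topology
open scoped Matrix.Norms.L2Operator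

variable {H : Type*} [NormedAddCommGroup H] [InnerProductSpace ℂ H] [CompleteSpace H]
  {M : VonNeumannAlgebra H} {τ : M.toStarSubalgebra →ₗ[ℂ] ℂ} {X : ℕ → Type}
  {l : Filter (Σ k, X k)} {n : ℕ} {coord : Fin n → Sec X} {x : Fin n → M.toStarSubalgebra}

/-- The matrix-valued functions which represent elements of `S`. -/
def repSet (τ : M.toStarSubalgebra →ₗ[ℂ] ℂ) (l : Filter (Σ k, X k)) (coord : Fin n → Sec X)
    (x : Fin n → M.toStarSubalgebra) (S : Set M.toStarSubalgebra) : Set (Sec X) :=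
  {F | ∃ y ∈ S, Represents τ l coord x F y}

/-- The elements of a von Neumann algebra on `H` which belong to `M`. -/
def elementsOf (M N : VonNeumannAlgebra H) : Set M.toStarSubalgebra := {y | (y : H →L[ℂ] H) ∈ N}

lemma repSet_mono {S T : Set M.toStarSubalgebra} (h : S ⊆ T) :
    repSet τ l coord x S ⊆ repSet τ l coord x T := fun _ ⟨y, hy, hF⟩ => ⟨y, h hy, hF⟩

lemma controlled_of_mem_adjoin (h : IsModel τ l coord x) {S : Set M.toStarSubalgebra}
    {z : M.toStarSubalgebra} (hz : z ∈ StarAlgebra.adjoin ℂ S) :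
    ∃ G, Represents τ l coord x G z ∧ Controlled l (repSet τ l coord x S) G := by
  induction hz using StarAlgebra.adjoin_induction with
  | mem z hz =>
    obtain ⟨F, hF⟩ := h.exists_represents z
    exact ⟨F, hF, controlled_of_mem ⟨z, hz, hF⟩⟩
  | algebraMap r =>
    rw [Algebra.algebraMap_eq_smul_one]
    exact ⟨r • 1, (Represents.one h).smul h r, controlled_one.smul r⟩
  | add p q _ _ hp hq =>
    obtain ⟨F, hF, hFc⟩ := hp
    obtain ⟨G, hG, hGc⟩ := hq
    exact ⟨F + G, hF.add h hG, hFc.add hGc⟩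
  | mul p q _ _ hp hq =>
    obtain ⟨F, hF, hFc⟩ := hp
    obtain ⟨G, hG, hGc⟩ := hq
    exact ⟨F * G, hF.mul h hG, hFc.mul hGc hF.1 hG.1⟩
  | star p _ hp =>
    obtain ⟨F, hF, hFc⟩ := hp
    exact ⟨star F, hF.star h, controlled_star hFc⟩

/-- Orbit-smallness passes from a set to the von Neumann algebra which it generates. -/
lemma small_repSet_vnGen (h : IsModel τ l coord x) {S T : Set M.toStarSubalgebra}
    (hS : Small l (repSet τ l coord x S))
    (hT : ∀ y ∈ T, (y : H →L[ℂ] H) ∈ vnGen (Subtype.val '' S)) :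
    Small l (repSet τ l coord x T) := by
  refine hS.of_controlled ?_
  rintro F ⟨y, hy, hF⟩
  refine Controlled.of_approx fun δ hδ => ?_
  obtain ⟨z, hz, hzy⟩ := exists_adjoin_approx h.trace (hT y hy) hδ
  obtain ⟨G, hG, hGc⟩ := controlled_of_mem_adjoin h hz
  refine ⟨G, hGc, ((hF.sub h hG).tendsto_hsnorm h).eventually_lt_const ?_⟩
  rwa [h.trace.isTrace.tnorm_sub_comm]

lemma small_repSet_of_finite_subsets {S : Set M.toStarSubalgebra}
    (h : ∀ S' ⊆ S, S'.Finite → Small l (repSet τ l coord x S')) :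
    Small l (repSet τ l coord x S) := by
  refine small_of_finite_subsets fun T hT hf => ?_
  have hT' : ∀ F : Sec X, ∃ y, F ∈ T → y ∈ S ∧ Represents τ l coord x F y := fun F => by
    by_cases hF : F ∈ T
    · obtain ⟨y, hy⟩ := hT hF
      exact ⟨y, fun _ => hy⟩
    · exact ⟨0, fun h => absurd h hF⟩
  choose y hy using hT'
  exact (h (y '' T) (Set.image_subset_iff.2 fun F hF => (hy F hF).1) (hf.image y)).mono
    fun F hF => ⟨y F, ⟨F, hF, rfl⟩, (hy F hF).2⟩

/-- Orbit-smallness is preserved when elements `y = ∑ j, p_j y q_j` are adjoined, where `p` and `q`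
are families of small Hilbert–Schmidt type. -/
lemma small_repSet_union (h : IsModel τ l coord x) {S T : Set M.toStarSubalgebra}
    (hST : ∀ θ > 0, ∃ (N : ℕ) (p q : Fin N → M.toStarSubalgebra),
      Small l (repSet τ l coord x (S ∪ (Set.range p ∪ Set.range q))) ∧
      (∀ y ∈ T, ∑ j, p j * y * q j = y) ∧
      ∑ j, ∑ j', ‖τ (star (p j') * p j)‖ * ‖τ (q j * star (q j'))‖ ≤ θ) :
    Small l (repSet τ l coord x (S ∪ T)) := by
  refine small_of_finite_subsets fun T' hT' hf => ?_
  have hsplit : T' = (T' ∩ repSet τ l coord x S) ∪ (T' \ repSet τ l coord x S) :=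
    (Set.inter_union_sdiff _ _).symm
  obtain ⟨m, Y, -, hY⟩ := (hf.sdiff (t := repSet τ l coord x S)).fin_param
  have hYT : ∀ r, ∃ y ∈ T, Represents τ l coord x (Y r) y := by
    intro r
    have hr : Y r ∈ T' \ repSet τ l coord x S := hY ▸ Set.mem_range_self r
    obtain ⟨y, hy | hy, hr'⟩ := hT' hr.1
    · exact absurd ⟨y, hy, hr'⟩ hr.2
    · exact ⟨y, hy, hr'⟩
  choose y hyT hyY using hYT
  rw [hsplit, ← hY]
  refine small_union_of_sandwich (hf.inter_of_left _) Y (fun r => (hyY r).1) fun θ hθ => ?_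
  obtain ⟨N, p, q, hsm, hpq, hsum⟩ := hST (θ / 2) (half_pos hθ)
  choose P hP using fun j => h.exists_represents (p j)
  choose Q hQ using fun j => h.exists_represents (q j)
  refine ⟨N, P, Q, fun j => (hP j).1, fun j => (hQ j).1, hsm.mono ?_, fun r => ?_, ?_⟩
  · rintro F (hF | ⟨j, rfl⟩ | ⟨j, rfl⟩)
    · exact repSet_mono Set.subset_union_left hF.2
    · exact ⟨p j, Or.inr (Or.inl ⟨j, rfl⟩), hP j⟩
    · exact ⟨q j, Or.inr (Or.inr ⟨j, rfl⟩), hQ j⟩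
  · refine Represents.isNull_sub h (hyY r) ?_
    have := Represents.sum h Finset.univ fun j => ((hP j).mul h (hyY r)).mul h (hQ j)
    rwa [hpq _ (hyT r)] at this
  · have hlim : Tendsto (fun i : Σ k, X k => ∑ j, ∑ j', ‖ntr (star (P j' i.1 i.2) * P j i.1 i.2)‖ *
        ‖ntr (Q j i.1 i.2 * star (Q j' i.1 i.2))‖) l
        (𝓝 (∑ j, ∑ j', ‖τ (star (p j') * p j)‖ * ‖τ (q j * star (q j'))‖)) :=
      tendsto_finsetSum _ fun j _ => tendsto_finsetSum _ fun j' _ =>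
        ((((hP j').star h).mul h (hP j)).tendsto_ntr h).norm.mul
          (((hQ j).mul h ((hQ j').star h)).tendsto_ntr h).norm
    exact (hlim.eventually_lt_const (hsum.trans_lt (half_lt_self hθ))).mono fun _ hi => hi.le

/-- A single self-adjoint element is orbit-small. -/
lemma small_repSet_singleton (h : IsModel τ l coord x) {a : M.toStarSubalgebra}
    (ha : IsSelfAdjoint a) : Small l (repSet τ l coord x {a}) := by
  obtain ⟨F, hF⟩ := h.exists_represents a
  have hF' := (hF.add h (hF.star h)).smul h (2⁻¹ : ℂ)
  rw [ha.star_eq, ← two_smul ℂ a, smul_smul, inv_mul_cancel₀ two_ne_zero, one_smul] at hF'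
  have hsa : ∀ k i, (((2⁻¹ : ℂ) • (F + star F)) k i).IsHermitian := fun k i => by
    change star ((2⁻¹ : ℂ) • (F k i + star (F k i))) = (2⁻¹ : ℂ) • (F k i + star (F k i))
    rw [star_smul, star_add, star_star, add_comm]
    simp
  refine (small_singleton_of_isHermitian h.size hsa hF'.1).of_controlled ?_
  rintro G ⟨y, rfl, hG⟩
  exact (controlled_of_mem (Set.mem_singleton _)).of_isNull (hG.isNull_sub h hF')

/-- A finite partition of unity into projections lies in the von Neumann algebra generated by a
single self-adjoint element, `∑ j, j p_j`. -/
lemma mem_vnGen_of_partition {N : ℕ} {p : Fin N → H →L[ℂ] H} (hp : ∀ j, p j * p j = p j)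
    (hpp : ∀ i j, i ≠ j → p i * p j = 0) (hsum : ∑ j, p j = 1) (j : Fin N) :
    p j ∈ vnGen {∑ i : Fin N, (i : ℂ) • p i} := by
  set a := ∑ i : Fin N, (i : ℂ) • p i with ha
  have hpa : ∀ i, p i * a = (i : ℂ) • p i := fun i => by
    rw [ha, Finset.mul_sum, Finset.sum_eq_single i]
    · rw [mul_smul_comm, hp]
    · intro b _ hb
      rw [mul_smul_comm, hpp i b hb.symm, smul_zero]
    · simp
  have hap : ∀ i, a * p i = (i : ℂ) • p i := fun i => by
    rw [ha, Finset.sum_mul, Finset.sum_eq_single i]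
    · rw [smul_mul_assoc, hp]
    · intro b _ hb
      rw [smul_mul_assoc, hpp b i hb, smul_zero]
    · simp
  have key : ∀ z, a * z = z * a → z * p j = p j * z := by
    intro z hz
    -- `a` acts as the distinct scalars `i`, `i'` on the two sides of `p i * z * p i'`
    have h0 : ∀ i i', i ≠ i' → p i * z * p i' = 0 := by
      intro i i' hii
      have h1 : (i : ℂ) • (p i * z * p i') = (i' : ℂ) • (p i * z * p i') := by
        calc (i : ℂ) • (p i * z * p i') = (p i * a) * z * p i' := by
              rw [hpa, smul_mul_assoc, smul_mul_assoc]
          _ = p i * z * (a * p i') := by rw [mul_assoc (p i) a, hz]; noncomm_ring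
          _ = _ := by rw [hap, mul_smul_comm]
      rw [← sub_eq_zero, ← sub_smul, smul_eq_zero, sub_eq_zero] at h1
      refine h1.resolve_left fun h => hii (Fin.ext ?_)
      exact_mod_cast h
    have h1 : z * p j = p j * z * p j := by
      calc z * p j = (∑ i, p i) * z * p j := by rw [hsum, one_mul]
        _ = _ := by
          rw [Finset.sum_mul, Finset.sum_mul, Finset.sum_eq_single j]
          · exact fun b _ hb => h0 b j hb
          · simp
    have h2 : p j * z = p j * z * p j := by
      calc p j * z = p j * z * ∑ i, p i := by rw [hsum, mul_one]
        _ = _ := by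
          rw [Finset.mul_sum, Finset.sum_eq_single j]
          · exact fun b _ hb => h0 j b hb.symm
          · simp
    rw [h1, ← h2]
  refine mem_vnGen.2 fun z hz => ?_
  obtain ⟨h1, h2⟩ := hz a rfl
  refine ⟨key z h1, key (star z) ?_⟩
  have := congrArg star h2
  simpa using this.symm

lemma sum_trace_le_of_partition (hτ : IsTracialState M τ) {N : ℕ} {p q : Fin N → M.toStarSubalgebra}
    (hp : ∀ j, IsStarProjection (p j)) (hpp : ∀ i j, i ≠ j → p i * p j = 0) (hsum : ∑ j, p j = 1)
    {θ : ℝ} (hpθ : ∀ j, (τ (p j)).re ≤ θ) (hq : ∀ j, τ (q j * star (q j)) = τ (p j)) :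
    ∑ j, ∑ j', ‖τ (star (p j') * p j)‖ * ‖τ (q j * star (q j'))‖ ≤ θ := by
  have hnorm : ∀ j, ‖τ (p j)‖ = (τ (p j)).re := fun j => by
    have h1 : p j = star (p j) * p j := by
      rw [(hp j).isSelfAdjoint.star_eq, (hp j).isIdempotentElem.eq]
    rw [hτ.re_projection (hp j)]
    conv_lhs => rw [h1, hτ.isTrace.apply_star_mul_self, Complex.norm_real]
    exact Real.norm_of_nonneg (by positivity)
  have hone : ∑ j, (τ (p j)).re = 1 := by
    rw [← Complex.re_sum, ← map_sum, hsum, hτ.map_one, Complex.one_re]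
  calc ∑ j, ∑ j', ‖τ (star (p j') * p j)‖ * ‖τ (q j * star (q j'))‖
      = ∑ j, (τ (p j)).re * (τ (p j)).re := by
        refine Finset.sum_congr rfl fun j _ => ?_
        rw [Finset.sum_eq_single j]
        · rw [hq, (hp j).isSelfAdjoint.star_eq, (hp j).isIdempotentElem.eq, hnorm]
        · intro b _ hb
          rw [(hp b).isSelfAdjoint.star_eq, hpp b j hb, map_zero, norm_zero, zero_mul]
        · simp
    _ ≤ ∑ j, θ * (τ (p j)).re := by
        gcongr with j
        · rw [← hnorm]; exact norm_nonneg _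
        · exact hpθ j
    _ = θ := by rw [← Finset.mul_sum, hone, mul_one]

/-- An abelian diffuse subalgebra is orbit-small. -/
theorem small_repSet_of_abelian (h : IsModel τ l coord x) {A : VonNeumannAlgebra H} (hAM : A ≤ M)
    (hA : IsDiffuse A) (hcomm : ∀ a ∈ A, ∀ b ∈ A, a * b = b * a) :
    Small l (repSet τ l coord x (elementsOf M A)) := by
  have := small_repSet_union h (S := ∅) (T := elementsOf M A) fun θ hθ => ?_
  · rwa [Set.empty_union] at this
  obtain ⟨N, p, hpA, hp, hpp, hsum, hpθ⟩ := hA.exists_partition h.trace hAM hθ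
  have hval : ∀ j, (p j : H →L[ℂ] H) * p j = p j := fun j =>
    congrArg Subtype.val (hp j).isIdempotentElem
  refine ⟨N, p, p, ?_, fun y hy => ?_, ?_⟩
  · have hsa : IsSelfAdjoint (∑ i : Fin N, (i : ℂ) • p i) := by
      rw [IsSelfAdjoint, star_sum]
      refine Finset.sum_congr rfl fun i _ => ?_
      rw [star_smul, (hp i).isSelfAdjoint.star_eq]
      simp
    refine small_repSet_vnGen h (small_repSet_singleton h hsa) ?_
    rw [Set.empty_union, Set.union_self, Set.image_singleton]
    rintro _ ⟨j, rfl⟩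
    have := mem_vnGen_of_partition (p := fun j => (p j : H →L[ℂ] H)) hval
      (fun i j hij => congrArg Subtype.val (hpp i j hij))
      (by have := congrArg Subtype.val hsum; simpa using this) j
    simpa using this
  · have : ∀ j, p j * y * p j = p j * y := fun j => by
      have e : y * p j = p j * y := Subtype.ext (hcomm _ hy _ (hpA j))
      rw [mul_assoc, e, ← mul_assoc, (hp j).isIdempotentElem.eq]
    rw [Finset.sum_congr rfl fun j _ => this j, ← Finset.sum_mul, hsum, one_mul]
  · refine sum_trace_le_of_partition h.trace hp hpp hsum hpθ fun j => ?_
    rw [(hp j).isSelfAdjoint.star_eq, (hp j).isIdempotentElem.eq]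

/-- **Adjoining a normalizing unitary.** If `u* N u ⊆ N` and `p` is a partition of unity in `N`,
then `u = ∑ j, p_j u (u* p_j u)`. -/
lemma small_repSet_insert (h : IsModel τ l coord x) {A N : VonNeumannAlgebra H} (hAM : A ≤ M)
    (hA : IsDiffuse A) (hAN : A ≤ N) {S : Set M.toStarSubalgebra} (hNS : elementsOf M N ⊆ S)
    (hS : Small l (repSet τ l coord x S)) {u : M.toStarSubalgebra}
    (hu : (u : H →L[ℂ] H) ∈ unitary (H →L[ℂ] H))
    (huN : ∀ a ∈ N, star (u : H →L[ℂ] H) * a * u ∈ N) :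
    Small l (repSet τ l coord x (insert u S)) := by
  rw [Set.insert_eq, Set.union_comm]
  refine small_repSet_union h fun θ hθ => ?_
  obtain ⟨N', p, hpA, hp, hpp, hsum, hpθ⟩ := hA.exists_partition h.trace hAM hθ
  have hu2 : u * star u = 1 := Subtype.ext (Unitary.mul_star_self_of_mem hu)
  refine ⟨N', p, fun j => star u * p j * u, hS.mono (repSet_mono ?_), ?_, ?_⟩
  · rintro y (hy | ⟨j, rfl⟩ | ⟨j, rfl⟩)
    · exact hy
    · exact hNS (hAN (hpA j))
    · exact hNS (huN _ (hAN (hpA j)))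
  · rintro y rfl
    have : ∀ j, p j * y * (star y * p j * y) = p j * y := fun j => by
      calc p j * y * (star y * p j * y) = p j * (y * star y) * p j * y := by noncomm_ring
        _ = p j * p j * y := by rw [hu2, mul_one]
        _ = _ := by rw [(hp j).isIdempotentElem.eq]
    rw [Finset.sum_congr rfl fun j _ => this j, ← Finset.sum_mul, hsum, one_mul]
  · refine sum_trace_le_of_partition h.trace hp hpp hsum hpθ fun j => ?_
    have : star u * p j * u * star (star u * p j * u) = star u * p j * u := by
      rw [star_mul, star_mul, star_star, (hp j).isSelfAdjoint.star_eq]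
      calc star u * p j * u * (star u * (p j * u)) = star u * p j * (u * star u) * p j * u := by
            noncomm_ring
        _ = star u * (p j * p j) * u := by rw [hu2, mul_one]; noncomm_ring
        _ = _ := by rw [(hp j).isIdempotentElem.eq]
    rw [this, h.trace.tracial, ← mul_assoc, hu2, one_mul]

/-- Orbit-smallness passes to the normalizer algebra. -/
theorem small_repSet_normalizerAlgebra (h : IsModel τ l coord x) {A N : VonNeumannAlgebra H}
    (hAM : A ≤ M) (hA : IsDiffuse A) (hAN : A ≤ N)
    (hN : Small l (repSet τ l coord x (elementsOf M N))) :
    Small l (repSet τ l coord x (elementsOf M (normalizerAlgebra M N))) := by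
  let U : Set M.toStarSubalgebra := {u | (u : H →L[ℂ] H) ∈ unitary (H →L[ℂ] H) ∧
    ∀ a ∈ N, star (u : H →L[ℂ] H) * a * u ∈ N}
  have key : ∀ U' : Set M.toStarSubalgebra, U'.Finite → U' ⊆ U →
      Small l (repSet τ l coord x (U' ∪ elementsOf M N)) := by
    intro U' hf
    induction U', hf using Set.Finite.induction_on with
    | empty => intro _; rwa [Set.empty_union]
    | @insert u U' _ _ ih =>
      intro hU'
      rw [Set.insert_union]
      exact small_repSet_insert h hAM hA hAN Set.subset_union_right
        (ih ((Set.subset_insert _ _).trans hU')) (hU' (Set.mem_insert _ _)).1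
        (hU' (Set.mem_insert _ _)).2
  have hU : Small l (repSet τ l coord x U) := small_repSet_of_finite_subsets fun U' hU' hf =>
    (key U' hf hU').mono (repSet_mono Set.subset_union_left)
  refine small_repSet_vnGen h hU fun y hy => vnGen_mono ?_ hy
  rintro u ⟨huM, hu⟩
  exact ⟨⟨u, huM⟩, hu, rfl⟩

lemma normalizerAlgebra_le {N : VonNeumannAlgebra H} : normalizerAlgebra M N ≤ M :=
  vnGen_le fun _ hu => hu.1

lemma le_normalizerAlgebra {N : VonNeumannAlgebra H} (hNM : N ≤ M) :
    N ≤ normalizerAlgebra M N := by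
  intro y hy
  have hspan : (⟨y, hy⟩ : N.toStarSubalgebra) ∈
      Submodule.span ℂ (unitary N.toStarSubalgebra : Set N.toStarSubalgebra) := by
    rw [CStarAlgebra.span_unitary]; trivial
  have key : ∀ z : N.toStarSubalgebra,
      z ∈ Submodule.span ℂ (unitary N.toStarSubalgebra : Set N.toStarSubalgebra) →
      (z : H →L[ℂ] H) ∈ normalizerAlgebra M N := by
    intro z hz
    induction hz using Submodule.span_induction with
    | mem u hu =>
      refine subset_vnGen _ ⟨hNM u.2, ?_, fun a ha => mul_mem (mul_mem (star_mem u.2) ha) u.2⟩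
      rw [SetLike.mem_coe, Unitary.mem_iff] at hu
      rw [Unitary.mem_iff]
      exact ⟨congrArg Subtype.val hu.1, congrArg Subtype.val hu.2⟩
    | zero => exact zero_mem (normalizerAlgebra M N)
    | add u v _ _ hu hv => exact add_mem hu hv
    | smul c u _ hu => exact (normalizerAlgebra M N).toStarSubalgebra.toSubalgebra.smul_mem hu c
  exact key _ hspan

/-- If `M` is an iterated normalizer algebra of an orbit-small diffuse subalgebra, then `M` is
orbit-small. -/
theorem small_repSet_iteratedNormalizer (h : IsModel τ l coord x) {A : VonNeumannAlgebra H}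
    (hAM : A ≤ M) (hA : IsDiffuse A)
    (hsm : Small l (repSet τ l coord x (elementsOf M A))) (k : ℕ∞) :
    Small l (repSet τ l coord x (elementsOf M (iteratedNormalizer M A k))) := by
  have hle : ∀ r : ℕ, A ≤ (normalizerAlgebra M)^[r] A ∧ (normalizerAlgebra M)^[r] A ≤ M ∧
      Small l (repSet τ l coord x (elementsOf M ((normalizerAlgebra M)^[r] A))) := by
    intro r
    induction r with
    | zero => exact ⟨le_rfl, hAM, hsm⟩
    | succ r ih =>
      rw [Function.iterate_succ_apply']
      exact ⟨ih.1.trans (le_normalizerAlgebra ih.2.1), normalizerAlgebra_le,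
        small_repSet_normalizerAlgebra h hAM hA ih.1 ih.2.2⟩
  have hmono : Monotone fun r : ℕ => (normalizerAlgebra M)^[r] A :=
    monotone_nat_of_le_succ fun r => by
      rw [Function.iterate_succ_apply']
      exact le_normalizerAlgebra (hle r).2.1
  induction k using WithTop.recTopCoe with
  | coe r => exact (hle r).2.2
  | top =>
    let S : Set M.toStarSubalgebra := ⋃ r : ℕ, elementsOf M ((normalizerAlgebra M)^[r] A)
    have hS : Small l (repSet τ l coord x S) := by
      refine small_repSet_of_finite_subsets fun S' hS' hf => ?_
      obtain ⟨r, hr⟩ : ∃ r : ℕ, S' ⊆ elementsOf M ((normalizerAlgebra M)^[r] A) := by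
        have hd : Directed (· ⊆ ·) fun r : ℕ => elementsOf M ((normalizerAlgebra M)^[r] A) :=
          directed_of_isDirected_le fun r r' hrr y hy => hmono hrr hy
        have hS'' : ((hf.toFinset : Finset M.toStarSubalgebra) : Set M.toStarSubalgebra) ⊆ S := by
          rwa [Set.Finite.coe_toFinset]
        obtain ⟨r, hr⟩ := hd.exists_mem_subset_of_finset_subset_biUnion hS''
        exact ⟨r, by rwa [Set.Finite.coe_toFinset] at hr⟩
      exact (hle r).2.2.mono (repSet_mono hr)
    refine small_repSet_vnGen h hS fun y hy => vnGen_mono ?_ hy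
    refine Set.iUnion₂_subset fun r _ z hz => ?_
    exact ⟨⟨z, (hle r).2.1 hz⟩, Set.mem_iUnion.2 ⟨r, hz⟩, rfl⟩

end Subalgebras

/-! ### Vanishing upper free orbit-dimension and orbit-smallness -/

section OrbitDimension

open Filter Topology
open scoped Matrix.Norms.L2Operator ENNReal

lemma exists_cover_of_log_lt {ι : Type*} [Fintype ι] {k : ℕ}
    {Γ : Set (ι → Matrix (Fin k) (Fin k) ℂ)} {ω c : ℝ}
    (h : (ENNReal.log (orbitCoveringNumber Γ ω : ℝ≥0∞)).toENNReal ≤ ENNReal.ofReal c) (hc : 0 ≤ c) :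
    ∃ F : Finset (ι → Matrix (Fin k) (Fin k) ℂ), (F : Set _) ⊆ Γ ∧
      Γ ⊆ (⋃ B ∈ F, orbitBall B ω) ∧ (F.card : ℝ) ≤ Real.exp c := by
  have h1 : ENNReal.log (orbitCoveringNumber Γ ω : ℝ≥0∞) ≤ (c : EReal) := by
    refine (le_max_right 0 _).trans ?_
    rw [← EReal.coe_toENNReal_eq_max]
    refine (EReal.coe_ennreal_le_coe_ennreal_iff.2 h).trans ?_
    rw [EReal.coe_ennreal_ofReal, max_eq_left hc]
  have h2 : (orbitCoveringNumber Γ ω : ℝ≥0∞) ≤ ENNReal.ofReal (Real.exp c) := by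
    rw [← ENNReal.log_le_log_iff, ENNReal.log_ofReal_of_pos (Real.exp_pos c), Real.log_exp]
    exact h1
  have h3 : orbitCoveringNumber Γ ω ≠ ⊤ := by
    intro h
    rw [h] at h2
    exact absurd h2 (by simp)
  obtain ⟨N, hN⟩ := ENat.ne_top_iff_exists.1 h3
  have h4 : orbitCoveringNumber Γ ω < (N + 1 : ℕ) := by
    rw [← hN]; exact_mod_cast Nat.lt_succ_self N
  unfold orbitCoveringNumber at h4
  simp only [iInf_lt_iff] at h4
  obtain ⟨F, hF, hcov, hcard⟩ := h4
  refine ⟨F, hF, hcov, ?_⟩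
  rw [← hN] at h2
  have h5 : F.card ≤ N := Nat.lt_succ_iff.1 (by exact_mod_cast hcard)
  have h6 : ((N : ℝ≥0∞)) ≤ ENNReal.ofReal (Real.exp c) := by simpa using h2
  rw [← ENNReal.ofReal_natCast, ENNReal.ofReal_le_ofReal_iff (Real.exp_pos c).le] at h6
  exact (Nat.cast_le.2 h5).trans h6

lemma log_orbitCoveringNumber_le {ι : Type*} [Fintype ι] {k : ℕ}
    {Γ : Set (ι → Matrix (Fin k) (Fin k) ℂ)} {ω c : ℝ}
    {F : Finset (ι → Matrix (Fin k) (Fin k) ℂ)} (hF : (F : Set _) ⊆ Γ)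
    (hcov : Γ ⊆ ⋃ B ∈ F, orbitBall B ω) (hcard : (F.card : ℝ) ≤ Real.exp c) :
    (ENNReal.log (orbitCoveringNumber Γ ω : ℝ≥0∞)).toENNReal ≤ ENNReal.ofReal c := by
  have h1 : orbitCoveringNumber Γ ω ≤ F.card := iInf₂_le_of_le F hF (iInf_le _ hcov)
  have h2 : (orbitCoveringNumber Γ ω : ℝ≥0∞) ≤ ENNReal.ofReal (Real.exp c) := by
    calc (orbitCoveringNumber Γ ω : ℝ≥0∞) ≤ ((F.card : ℕ∞) : ℝ≥0∞) := by exact_mod_cast h1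
      _ = ENNReal.ofReal (F.card : ℝ) := by simp
      _ ≤ _ := ENNReal.ofReal_le_ofReal hcard
  rw [← EReal.real_coe_toENNReal]
  refine EReal.toENNReal_le_toENNReal ?_
  rw [← Real.log_exp c, ← ENNReal.log_ofReal_of_pos (Real.exp_pos c)]
  exact ENNReal.log_le_log h2

/-- If the orbit-dimension at scale `ω` vanishes, some microstate spaces are covered by
`exp(η k²)` orbit-balls of radius `ω`. -/
lemma exists_cover_of_orbitDimAt_eq_zero {ι : Type*} [Fintype ι] {law : List (ι × Bool) → ℂ}
    {ω R η : ℝ} (h : orbitDimAt law ω R = 0) (hω : 0 < ω) (hω1 : ω < 1) (hη : 0 < η) :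
    ∃ (m : ℕ) (ε : ℝ), 0 < ε ∧ ∀ᶠ k : ℕ in atTop, ∃ F : Finset (ι → Matrix (Fin k) (Fin k) ℂ),
      (F : Set _) ⊆ microstates law R m k ε ∧
      microstates law R m k ε ⊆ (⋃ B ∈ F, orbitBall B ω) ∧
      (F.card : ℝ) ≤ Real.exp (η * (k : ℝ) ^ 2) := by
  have hL : 0 < -Real.log ω := neg_pos.2 (Real.log_neg hω hω1)
  have h1 : orbitDimAt law ω R < ENNReal.ofReal (η / (-Real.log ω)) := by
    rw [h]; exact ENNReal.ofReal_pos.2 (by positivity)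
  unfold orbitDimAt at h1
  simp only [iInf_lt_iff] at h1
  obtain ⟨m, ε, hε, h1⟩ := h1
  refine ⟨m, ε, hε, ?_⟩
  filter_upwards [eventually_lt_of_limsup_lt h1, eventually_ge_atTop 1] with k hk hk1
  refine exists_cover_of_log_lt ?_ (by positivity)
  have hk0 : (0 : ℝ) < (k : ℝ) ^ 2 * (-Real.log ω) := by
    have : (0 : ℝ) < k := by exact_mod_cast hk1
    positivity
  rw [ENNReal.div_lt_iff (Or.inl (ENNReal.ofReal_pos.2 hk0).ne') (Or.inl ENNReal.ofReal_ne_top),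
    ← ENNReal.ofReal_mul (by positivity)] at hk
  refine hk.le.trans (ENNReal.ofReal_le_ofReal (le_of_eq ?_))
  rw [mul_comm ((k : ℝ) ^ 2), ← mul_assoc, div_mul_cancel₀ _ hL.ne']

lemma orbitDimAt_eq_zero {ι : Type*} [Fintype ι] {law : List (ι × Bool) → ℂ}
    {ω R : ℝ} (hω : 0 < ω) (hω1 : ω < 1)
    (h : ∀ η > 0, ∃ (m : ℕ) (ε : ℝ), 0 < ε ∧ ∀ᶠ k : ℕ in atTop,
      ∃ F : Finset (ι → Matrix (Fin k) (Fin k) ℂ), (F : Set _) ⊆ microstates law R m k ε ∧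
        microstates law R m k ε ⊆ (⋃ B ∈ F, orbitBall B ω) ∧
        (F.card : ℝ) ≤ Real.exp (η * (k : ℝ) ^ 2)) : orbitDimAt law ω R = 0 := by
  have hL : 0 < -Real.log ω := neg_pos.2 (Real.log_neg hω hω1)
  have key : ∀ c : ℝ, 0 < c → orbitDimAt law ω R ≤ ENNReal.ofReal c := by
    intro c hc
    obtain ⟨m, ε, hε, hk⟩ := h (c * (-Real.log ω)) (by positivity)
    refine iInf_le_of_le m (iInf₂_le_of_le ε hε (limsup_le_of_le (by isBoundedDefault) ?_))
    filter_upwards [hk, eventually_ge_atTop 1] with k ⟨F, hF, hcov, hcard⟩ hk1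
    have hk0 : (0 : ℝ) < (k : ℝ) ^ 2 * (-Real.log ω) := by
      have : (0 : ℝ) < k := by exact_mod_cast hk1
      positivity
    rw [ENNReal.div_le_iff (ENNReal.ofReal_pos.2 hk0).ne' ENNReal.ofReal_ne_top,
      ← ENNReal.ofReal_mul hc.le]
    refine (log_orbitCoveringNumber_le hF hcov hcard).trans (ENNReal.ofReal_le_ofReal (le_of_eq ?_))
    ring
  refine le_antisymm (le_of_forall_gt fun b hb => ?_) zero_le
  rcases eq_or_ne b ⊤ with rfl | hb'
  · exact (key 1 one_pos).trans_lt ENNReal.ofReal_lt_top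
  · have hb1 : 0 < b.toReal := ENNReal.toReal_pos hb.ne' hb'
    refine (key (b.toReal / 2) (by positivity)).trans_lt ?_
    rw [ENNReal.ofReal_lt_iff_lt_toReal (by positivity) hb']
    linarith

variable {H : Type*} [NormedAddCommGroup H] [InnerProductSpace ℂ H] [CompleteSpace H]
  {M : VonNeumannAlgebra H} {τ : M.toStarSubalgebra →ₗ[ℂ] ℂ}

lemma orbitDimAt_eq_zero_of_upperOrbitDim {A : VonNeumannAlgebra H} (h : upperOrbitDim τ A = 0)
    {n : ℕ} {a : Fin n → M.toStarSubalgebra} (ha : Generates a A) {ω R : ℝ} (hω : 0 < ω)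
    (hω1 : ω < 1) (hR : 0 < R) : orbitDimAt (fun w => τ (starWord a w)) ω R = 0 := by
  refine le_antisymm ?_ zero_le
  rw [← h]
  refine le_trans ?_ (le_iSup_of_le n (le_iSup₂_of_le a ha le_rfl))
  exact le_iSup₂_of_le ω hω (le_iSup_of_le hω1 (le_iSup₂_of_le R hR le_rfl))

section FromOrbitDim

variable {X : ℕ → Type} {l : Filter (Σ k, X k)} {n : ℕ} {coord : Fin n → Sec X}
  {x : Fin n → M.toStarSubalgebra}

lemma Represents.starWord (h : IsModel τ l coord x) {m : ℕ} {F : Fin m → Sec X}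
    {a : Fin m → M.toStarSubalgebra} (hF : ∀ j, Represents τ l coord x (F j) (a j))
    (w : List (Fin m × Bool)) :
    Represents τ l coord x (fun k i => starWord (fun j => F j k i) w) (starWord a w) := by
  induction w with
  | nil => exact Represents.one h
  | cons p w ih =>
    obtain ⟨j, b⟩ := p
    simp only [starWord_cons]
    cases b
    · exact (hF j).mul h ih
    · exact ((hF j).star h).mul h ih

/-- Elements represented in a model have microstates: their representatives. -/
lemma eventually_mem_microstates (h : IsModel τ l coord x) {m : ℕ} {F : Fin m → Sec X}
    {a : Fin m → M.toStarSubalgebra} (hF : ∀ j, Represents τ l coord x (F j) (a j)) {R : ℝ}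
    (hR : ∀ j k i, ‖F j k i‖ ≤ R) (q : ℕ) {ε : ℝ} (hε : 0 < ε) :
    ∀ᶠ i in l, (fun j => F j i.1 i.2 : Fin m → Matrix (Fin i.1) (Fin i.1) ℂ) ∈
      microstates (fun w => τ (starWord a w)) R q i.1 ε := by
  have h1 : ∀ w ∈ {w : List (Fin m × Bool) | w.length ≤ q}, ∀ᶠ i in l,
      ‖ntr (starWord (fun j => F j i.1 i.2) w) - τ (starWord a w)‖ < ε := by
    intro w _
    have := Metric.tendsto_nhds.1 ((Represents.starWord h hF w).tendsto_ntr h) ε hε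
    simpa only [dist_eq_norm] using this
  have hfin : {w : List (Fin m × Bool) | w.length ≤ q}.Finite := List.finite_length_le _ q
  filter_upwards [(Filter.eventually_all_finite hfin).2 h1] with i hi
  exact ⟨fun j => hR j _ _, fun w _ hw => hi w hw⟩

lemma hsnorm_sub_conj_lt {k : ℕ} {A A' B W W' : Matrix (Fin k) (Fin k) ℂ} {ω : ℝ}
    (hW : W ∈ Matrix.unitaryGroup (Fin k) ℂ) (hW' : W' ∈ Matrix.unitaryGroup (Fin k) ℂ)
    (h : hsnorm (A - W * B * star W) < ω) (h' : hsnorm (A' - W' * B * star W') < ω) :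
    hsnorm (A - (W * star W') * A' * star (W * star W')) < 2 * ω := by
  have ht := isTrace_ntrLin k
  have hmem : W * star W' ∈ Matrix.unitaryGroup (Fin k) ℂ := mul_mem hW (Unitary.star_mem hW')
  have hW1 : star W' * W' = 1 := Unitary.star_mul_self_of_mem hW'
  rw [hsnorm, ← ht.tnorm_conj_unitary hmem] at h'
  have e : (W * star W') * (A' - W' * B * star W') * star (W * star W') =
      (W * star W') * A' * star (W * star W') - W * B * star W := by
    rw [star_mul, star_star]
    calc _ = (W * star W') * A' * (W' * star W)
          - W * (star W' * W') * B * (star W' * W') * star W := by noncomm_ring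
      _ = _ := by rw [hW1, mul_one, mul_one]
  rw [e] at h'
  have h3 := ht.tnorm_sub_le_add A (W * B * star W) ((W * star W') * A' * star (W * star W'))
  rw [ht.tnorm_sub_comm (W * B * star W)] at h3
  exact h3.trans_lt (by linarith)

/-- A finitely generated subalgebra of vanishing upper free orbit-dimension is orbit-small: the
classes are the orbit-balls which cover its microstate spaces. -/
theorem small_repSet_of_upperOrbitDim (h : IsModel τ l coord x) {A : VonNeumannAlgebra H}
    (hAM : A ≤ M) (hfg : IsFinitelyGenerated A) (hA : upperOrbitDim τ A = 0) :
    Small l (repSet τ l coord x (elementsOf M A)) := by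
  classical
  obtain ⟨S, hSf, hSA⟩ := hfg
  obtain ⟨m, a', -, ha'⟩ := hSf.fin_param
  have haA : ∀ j, a' j ∈ A := fun j => hSA ▸ subset_vnGen S (ha' ▸ Set.mem_range_self j)
  let a : Fin m → M.toStarSubalgebra := fun j => ⟨a' j, hAM (haA j)⟩
  have hgen : Generates a A := by
    change vnGen (Set.range a') = A
    rw [ha', hSA]
  choose F hF using fun j => h.exists_represents (a j)
  obtain ⟨R, hR, hFR⟩ := exists_uniform_bound fun j => (hF j).1
  have hsmall : Small l (Set.range F) := by
    intro T hT _ ω₀ hω₀ η hη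
    set ω := min (ω₀ / 2) (1 / 2) with hω
    have hω0 : 0 < ω := by positivity
    have hω1 : ω < 1 := (min_le_right _ _).trans_lt (by norm_num)
    obtain ⟨q, ε, hε, hcov⟩ := exists_cover_of_orbitDimAt_eq_zero
      (orbitDimAt_eq_zero_of_upperOrbitDim hA hgen hω0 hω1 hR) hω0 hω1 hη
    refine ⟨_, inter_mem (h.size.eventually hcov) (eventually_mem_microstates h hF hFR q hε),
      fun k => ?_⟩
    -- without an index in the given member of `l` there is nothing to partition
    by_cases hex : ∃ i : X k, (∃ E : Finset (Fin m → Matrix (Fin k) (Fin k) ℂ),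
        (E : Set _) ⊆ microstates (fun w => τ (starWord a w)) R q k ε ∧
        microstates (fun w => τ (starWord a w)) R q k ε ⊆ (⋃ B ∈ E, orbitBall B ω) ∧
        (E.card : ℝ) ≤ Real.exp (η * (k : ℝ) ^ 2)) ∧
        (fun j => F j k i) ∈ microstates (fun w => τ (starWord a w)) R q k ε
    · obtain ⟨i₀, ⟨E, hE, hEcov, hcard⟩, hi₀⟩ := hex
      have hball : ∀ i : X k, ∃ B : E,
          (fun j => F j k i) ∈ microstates (fun w => τ (starWord a w)) R q k ε →
            (fun j => F j k i) ∈ orbitBall B.1 ω := by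
        have key : ∀ i : X k, (fun j => F j k i) ∈ microstates (fun w => τ (starWord a w)) R q k ε →
            ∃ B : E, (fun j => F j k i) ∈ orbitBall B.1 ω := by
          intro i hi
          have := hEcov hi
          simp only [Set.mem_iUnion] at this
          obtain ⟨B, hB, hB'⟩ := this
          exact ⟨⟨B, hB⟩, hB'⟩
        intro i
        by_cases hi : (fun j => F j k i) ∈ microstates (fun w => τ (starWord a w)) R q k ε
        · obtain ⟨B, hB⟩ := key i hi
          exact ⟨B, fun _ => hB⟩
        · obtain ⟨B, -⟩ := key i₀ hi₀
          exact ⟨B, fun h => absurd h hi⟩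
      choose c hc using hball
      refine ⟨E, inferInstance, c, by rwa [Fintype.card_coe], fun i i' hi hi' hii => ?_⟩
      obtain ⟨W, hW, hWB⟩ := hc i hi.2
      obtain ⟨W', hW', hWB'⟩ := hc i' hi'.2
      refine ⟨W * star W', mul_mem hW (Unitary.star_mem hW'), fun G hG => ?_⟩
      obtain ⟨j, rfl⟩ := hT hG
      have h1 := (hsnorm_le_norm2 _ j).trans_lt hWB
      have h2 := (hsnorm_le_norm2 _ j).trans_lt hWB'
      rw [← hii] at h2
      have h3 := hsnorm_sub_conj_lt hW hW' h1 h2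
      have h4 : ω ≤ ω₀ / 2 := min_le_left _ _
      linarith
    · push Not at hex
      refine ⟨Unit, inferInstance, fun _ => (), by simpa using by positivity, fun i _ hi => ?_⟩
      exact absurd hi.2 (hex i hi.1)
  have hsmall' : Small l (repSet τ l coord x (Set.range a)) := by
    refine hsmall.of_controlled ?_
    rintro G ⟨_, ⟨j, rfl⟩, hG⟩
    exact (controlled_of_mem (Set.mem_range_self j)).of_isNull (hG.isNull_sub h (hF j))
  refine small_repSet_vnGen h hsmall' fun y hy => ?_
  have e : Subtype.val '' Set.range a = Set.range fun j => (a j : H →L[ℂ] H) :=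
    (Set.range_comp _ _).symm
  rw [e]
  exact (show (y : H →L[ℂ] H) ∈ vnGen (Set.range fun j => (a j : H →L[ℂ] H)) from
    (show vnGen (Set.range fun j => (a j : H →L[ℂ] H)) = A from hgen) ▸ hy)

end FromOrbitDim

section MicrostateModel

/-- The tuples of `k × k` matrices of operator norm at most `R`. -/
def BallTuples (n : ℕ) (R : ℝ) (k : ℕ) : Type :=
  {A : Fin n → Matrix (Fin k) (Fin k) ℂ // ∀ j, opNorm (A j) ≤ R}

/-- The coordinate functions on `BallTuples`. -/
def ballCoord (n : ℕ) (R : ℝ) (j : Fin n) : Sec (BallTuples n R) := fun _ A => A.1 j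

/-- The microstates of size at least `r` which approximate the moments up to order `r` with
precision `1 / (r + 1)`. -/
def fineMicrostates {n : ℕ} (law : List (Fin n × Bool) → ℂ) (R : ℝ) (r : ℕ) :
    Set (Σ k, BallTuples n R k) :=
  {i | r ≤ i.1 ∧ 1 ≤ i.1 ∧ i.2.1 ∈ microstates law R r i.1 (1 / ((r : ℝ) + 1))}

/-- The filter of finer and finer microstates of larger and larger size. -/
def microstateFilter {n : ℕ} (law : List (Fin n × Bool) → ℂ) (R : ℝ) :
    Filter (Σ k, BallTuples n R k) :=
  ⨅ r : ℕ, 𝓟 (fineMicrostates law R r)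

variable {n : ℕ} {law : List (Fin n × Bool) → ℂ} {R : ℝ}

lemma microstates_anti {m m' k : ℕ} {ε ε' : ℝ} (hm : m ≤ m') (hε : ε' ≤ ε) :
    microstates law R m' k ε' ⊆ microstates law R m k ε := fun _ hA =>
  ⟨hA.1, fun w hw hw' => (hA.2 w hw (hw'.trans hm)).trans_le hε⟩

lemma mem_microstateFilter {U : Set (Σ k, BallTuples n R k)} :
    U ∈ microstateFilter law R ↔ ∃ r, fineMicrostates law R r ⊆ U := by
  have hanti : Antitone (fineMicrostates law R) := fun r r' hrr i hi =>
    ⟨hrr.trans hi.1, hi.2.1, microstates_anti hrr (by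
      have : (r : ℝ) ≤ r' := by exact_mod_cast hrr
      gcongr) hi.2.2⟩
  rw [microstateFilter, mem_iInf_of_directed]
  · simp only [mem_principal]
  · exact directed_of_isDirected_le fun r r' hrr => principal_mono.2 (hanti hrr)

lemma isModel_microstates (hτ : IsTracialState M τ) {x : Fin n → M.toStarSubalgebra}
    (hx : Generates x M) (R : ℝ) : IsModel τ (microstateFilter (fun w => τ (starWord x w)) R)
      (ballCoord n R) x where
  trace := hτ
  generates := hx
  size := tendsto_atTop.2 fun r => mem_microstateFilter.2 ⟨r, fun _ hi => hi.1⟩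
  bdd j := ⟨R, fun _ A => A.2 j⟩
  law w := by
    refine Metric.tendsto_nhds.2 fun ε hε => ?_
    obtain ⟨r, hr⟩ := exists_nat_one_div_lt hε
    refine mem_microstateFilter.2 ⟨max r w.length, fun i hi => ?_⟩
    rw [Set.mem_ofPred_eq, dist_eq_norm]
    rcases w.eq_nil_or_concat with rfl | hw
    · have h1 : ntr (1 : Matrix (Fin i.1) (Fin i.1) ℂ) = 1 := ntr_one (by have := hi.2.1; omega)
      rw [starWord_nil, starWord_nil, h1, hτ.map_one, sub_self, norm_zero]
      exact hε
    · have hw1 : 1 ≤ w.length := by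
        obtain ⟨w', b, rfl⟩ := hw
        simp
      refine (hi.2.2.2 w hw1 (le_max_right _ _)).trans_le (le_trans ?_ hr.le)
      have : (r : ℝ) ≤ (max r w.length : ℕ) := by exact_mod_cast le_max_left _ _
      gcongr

/-- If `M` is orbit-small in each of its models, then its upper free orbit-dimension vanishes. -/
theorem upperOrbitDim_eq_zero_of_small (hτ : IsTracialState M τ)
    (h : ∀ (n : ℕ) (x : Fin n → M.toStarSubalgebra) (X : ℕ → Type) (l : Filter (Σ k, X k))
      (coord : Fin n → Sec X), IsModel τ l coord x →
        Small l (repSet τ l coord x (elementsOf M M))) : upperOrbitDim τ M = 0 := by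
  classical
  refine le_antisymm (iSup_le fun n => iSup₂_le fun x hx => iSup₂_le fun ω hω => iSup_le fun hω1 =>
    iSup₂_le fun R hR => le_of_eq (orbitDimAt_eq_zero hω hω1 fun η hη => ?_)) zero_le
  have hmod := isModel_microstates hτ hx R
  have hsm := h _ _ _ _ _ hmod
  -- the norm of a tuple is at most the sum of the norms of its `n` entries
  set ω' := ω / (n + 1) with hω'
  obtain ⟨U, hU, hcls⟩ := hsm (Set.range (ballCoord n R))
    (by rintro _ ⟨j, rfl⟩; exact ⟨x j, (x j).2, hmod.represents_coord j⟩) (Set.finite_range _) ω'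
    (by positivity) η hη
  obtain ⟨r, hr⟩ := mem_microstateFilter.1 hU
  refine ⟨r, 1 / ((r : ℝ) + 1), by positivity, ?_⟩
  filter_upwards [eventually_ge_atTop (max r 1)] with k hk
  set Γ := microstates (fun w => τ (starWord x w)) R r k (1 / ((r : ℝ) + 1)) with hΓ
  obtain ⟨κ, _, c, hcard, hc⟩ := hcls k
  let b : Γ → BallTuples n R k := fun A => ⟨A.1, A.2.1⟩
  have hbU : ∀ A : Γ, (⟨k, b A⟩ : Σ k, BallTuples n R k) ∈ U := fun A =>
    hr ⟨(le_max_left _ _).trans hk, (le_max_right _ _).trans hk, A.2⟩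
  -- one centre is chosen in each class that meets the microstate space
  have hrep : ∀ t : Set.range fun A : Γ => c (b A), ∃ A : Γ, c (b A) = t := fun t => t.2
  choose rep hrep using hrep
  refine ⟨Finset.univ.image fun t => (rep t : Fin n → Matrix (Fin k) (Fin k) ℂ), ?_, ?_, ?_⟩
  · intro A hA
    simp only [Finset.coe_image, Set.mem_image] at hA
    obtain ⟨t, -, rfl⟩ := hA
    exact (rep t).2
  · intro A hA
    let t : Set.range fun A : Γ => c (b A) := ⟨c (b ⟨A, hA⟩), ⟨A, hA⟩, rfl⟩
    simp only [Set.mem_iUnion]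
    refine ⟨rep t, Finset.mem_image_of_mem _ (Finset.mem_univ t), ?_⟩
    obtain ⟨W, hW, hWT⟩ := hc (b ⟨A, hA⟩) (b (rep t)) (hbU _) (hbU _) (hrep t).symm
    refine ⟨W, hW, (norm2_le_sum _).trans_lt ?_⟩
    calc ∑ j, hsnorm (A j - W * (rep t).1 j * star W) ≤ ∑ _j : Fin n, ω' :=
          Finset.sum_le_sum fun j _ => (hWT (ballCoord n R j) ⟨j, rfl⟩).le
      _ = n * ω' := by simp
      _ < ω := by
        rw [hω', mul_div_assoc', div_lt_iff₀ (by positivity)]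
        nlinarith
  · refine le_trans ?_ hcard
    have h1 : (Finset.univ.image fun t => (rep t : Fin n → Matrix (Fin k) (Fin k) ℂ)).card ≤
        Fintype.card κ := by
      refine Finset.card_image_le.trans ?_
      rw [Finset.card_univ]
      exact Fintype.card_subtype_le _
    exact_mod_cast h1

end MicrostateModel

end OrbitDimension

/-! ### Volumes of sets of self-adjoint matrices -/

section Volume

open MeasureTheory Module
open scoped ENNReal Matrix.Norms.L2Operator

/-- A Gaussian bound for the volume of a ball: `exp(s (r² - ‖w‖²)) ≥ 1` on the ball. -/
lemma volume_closedBall_le {V : Type*} [NormedAddCommGroup V] [InnerProductSpace ℝ V]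
    [FiniteDimensional ℝ V] [MeasurableSpace V] [BorelSpace V] (v : V) (r : ℝ) {s : ℝ}
    (hs : 0 < s) : volume (Metric.closedBall v r) ≤
      ENNReal.ofReal (Real.exp (s * r ^ 2) * (Real.pi / s) ^ ((finrank ℝ V : ℝ) / 2)) := by
  rcases lt_or_ge r 0 with hr | hr
  · rw [Metric.closedBall_eq_empty.2 hr]
    simp
  have hI := GaussianFourier.integral_rexp_neg_mul_sq_norm (V := V) hs
  have hpos : 0 < (Real.pi / s) ^ ((finrank ℝ V : ℝ) / 2) :=
    Real.rpow_pos_of_pos (by positivity) _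
  have hint : Integrable fun w : V => Real.exp (-s * ‖w‖ ^ 2) := by
    by_contra h
    rw [integral_undef h] at hI
    exact hpos.ne hI
  have h1 := mul_meas_ge_le_lintegral (μ := (volume : Measure V))
    (f := fun w : V => ENNReal.ofReal (Real.exp (-s * ‖w‖ ^ 2))) (by fun_prop)
    (ENNReal.ofReal (Real.exp (-s * r ^ 2)))
  rw [← ofReal_integral_eq_lintegral_ofReal hint
    (Filter.Eventually.of_forall fun _ => (Real.exp_pos _).le), hI] at h1
  have h2 : Metric.closedBall (0 : V) r ⊆ {w : V | ENNReal.ofReal (Real.exp (-s * r ^ 2)) ≤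
      ENNReal.ofReal (Real.exp (-s * ‖w‖ ^ 2))} := by
    intro w hw
    rw [mem_closedBall_zero_iff] at hw
    refine ENNReal.ofReal_le_ofReal (Real.exp_le_exp.2 ?_)
    have : ‖w‖ ^ 2 ≤ r ^ 2 := by gcongr
    nlinarith
  rw [Measure.addHaar_closedBall_center]
  have h3 : ENNReal.ofReal (Real.exp (-s * r ^ 2)) * volume (Metric.closedBall (0 : V) r) ≤
      ENNReal.ofReal ((Real.pi / s) ^ ((finrank ℝ V : ℝ) / 2)) :=
    (by gcongr : _ ≤ _).trans h1
  calc volume (Metric.closedBall (0 : V) r)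
      = ENNReal.ofReal (Real.exp (s * r ^ 2)) *
        (ENNReal.ofReal (Real.exp (-s * r ^ 2)) * volume (Metric.closedBall (0 : V) r)) := by
        rw [← mul_assoc, ← ENNReal.ofReal_mul (Real.exp_pos _).le, ← Real.exp_add]
        simp
    _ ≤ _ := by
        rw [ENNReal.ofReal_mul (Real.exp_pos _).le]
        gcongr

/-- A set which is partitioned into classes of diameter at most `r`. -/
lemma volume_le_of_classes {V κ : Type*} [NormedAddCommGroup V] [InnerProductSpace ℝ V]
    [FiniteDimensional ℝ V] [MeasurableSpace V] [BorelSpace V] [Fintype κ] {S : Set V} {r s : ℝ}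
    (c : S → κ) (hc : ∀ v w : S, c v = c w → ‖(v : V) - w‖ ≤ r) (hs : 0 < s) :
    volume S ≤ Fintype.card κ *
      ENNReal.ofReal (Real.exp (s * r ^ 2) * (Real.pi / s) ^ ((finrank ℝ V : ℝ) / 2)) := by
  have h1 : S ⊆ ⋃ t : κ, {v : V | ∃ h : v ∈ S, c ⟨v, h⟩ = t} := fun v hv =>
    Set.mem_iUnion.2 ⟨c ⟨v, hv⟩, hv, rfl⟩
  refine (measure_mono h1).trans ((measure_iUnion_fintype_le _ _).trans ?_)
  rw [← nsmul_eq_mul, ← Finset.card_univ, ← Finset.sum_const]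
  refine Finset.sum_le_sum fun t _ => ?_
  rcases Set.eq_empty_or_nonempty {v : V | ∃ h : v ∈ S, c ⟨v, h⟩ = t} with he | ⟨w, hw, hwt⟩
  · rw [he, measure_empty]
    exact zero_le
  · refine (measure_mono ?_).trans (volume_closedBall_le w r hs)
    rintro v ⟨hv, hvt⟩
    rw [mem_closedBall_iff_norm]
    exact hc ⟨v, hv⟩ ⟨w, hw⟩ (hvt.trans hwt.symm)

lemma finrank_hermTuples (n k : ℕ) : finrank ℝ (hermTuples n k) = n * k ^ 2 := by
  let σ : EuclideanSpace ℂ (Fin n × Fin k × Fin k) →ₗ[ℝ] EuclideanSpace ℂ (Fin n × Fin k × Fin k) :=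
    { toFun := fun v => WithLp.toLp 2 fun p => star (v (p.1, p.2.2, p.2.1))
      map_add' := fun v w => by ext p; simp
      map_smul' := fun t v => by ext p; simp }
  rw [finrank_fixedPoints_conj σ (fun v => by ext p; simp [σ]) (fun v => by ext p; simp [σ])
    (hermTuples n k) (fun v => ⟨fun hv => by ext ⟨j, a, b⟩; simp [σ, hv j a b],
      fun hv j a b => congrArg (fun u : EuclideanSpace ℂ (Fin n × Fin k × Fin k) => u (j, b, a))
        hv.symm⟩)]
  rw [finrank_euclideanSpace]
  simp [sq]

lemma sq_norm_sub_hermTuples {n k : ℕ} (hk : k ≠ 0) (v w : hermTuples n k) :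
    ‖v - w‖ ^ 2 = k * ∑ j, hsnorm (toMatrices v j - toMatrices w j) ^ 2 := by
  have hk' : (k : ℝ) ≠ 0 := by exact_mod_cast hk
  rw [Submodule.coe_norm, EuclideanSpace.norm_sq_eq, Finset.mul_sum, Fintype.sum_prod_type]
  refine Finset.sum_congr rfl fun j _ => ?_
  rw [sq_hsnorm, ← mul_assoc, mul_inv_cancel₀ hk', one_mul, Fintype.sum_prod_type]
  rfl

end Volume

/-! ### Free entropy dimension -/

section Entropy

open Filter Topology MeasureTheory
open scoped ENNReal Matrix.Norms.L2Operator

variable {n : ℕ}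

/-- The law of `(x + ε s, s)` approximates that of `x`, evaluated at `b - ε s`: the product is
expanded into `2 ^ |w|` words. -/
lemma norm_ntr_sub_law_le {φ : FreeAlgebra ℂ (Fin n ⊕ Fin n) →ₗ[ℂ] ℂ} {ε δ : ℝ} {m k : ℕ}
    {A : Fin n ⊕ Fin n → Matrix (Fin k) (Fin k) ℂ} (hε : 0 ≤ ε) (hε1 : ε ≤ 1)
    (hA : ∀ w : List (Fin n ⊕ Fin n), 1 ≤ w.length → w.length ≤ m →
      ‖ntr (w.map A).prod - perturbedLaw φ ε w‖ < δ) (w : List (Fin n)) :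
    ∀ u : List (Fin n ⊕ Fin n), 1 ≤ u.length + w.length → u.length + w.length ≤ m →
      ‖ntrLin k ((u.map A).prod *
          (w.map fun j => A (Sum.inl j) - (ε : ℂ) • A (Sum.inr j)).prod) -
        φ ((u.map (Sum.elim (fun i => varX i + (ε : ℂ) • varS i) varS)).prod *
          (w.map varX).prod)‖ ≤ 2 ^ w.length * δ := by
  induction w with
  | nil =>
    intro u hu1 hum
    have := (hA u (by simpa using hu1) (by simpa using hum)).le
    simpa [perturbedLaw, ntrLin_apply] using this
  | cons j w ih =>
    intro u hu1 hum
    rw [List.length_cons] at hum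
    have h1 := ih (u ++ [Sum.inl j]) (by simp; omega) (by simp; omega)
    have h2 := ih (u ++ [Sum.inr j]) (by simp; omega) (by simp; omega)
    simp only [List.map_append, List.prod_append, List.map_cons, List.map_nil, List.prod_cons,
      List.prod_nil, mul_one, Sum.elim_inl, Sum.elim_inr] at h1 h2
    set PA := (u.map A).prod
    set QA := (w.map fun j => A (Sum.inl j) - (ε : ℂ) • A (Sum.inr j)).prod
    set PF := (u.map (Sum.elim (fun i => varX i + (ε : ℂ) • varS i) varS)).prod
    set QF := (w.map varX).prod
    have e1 : PA * ((A (Sum.inl j) - (ε : ℂ) • A (Sum.inr j)) * QA) =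
        PA * A (Sum.inl j) * QA - (ε : ℂ) • (PA * A (Sum.inr j) * QA) := by
      rw [sub_mul, mul_sub, smul_mul_assoc, mul_smul_comm, mul_assoc, mul_assoc]
    have e2 : PF * (varX j * QF) = PF * (varX j + (ε : ℂ) • varS j) * QF -
        (ε : ℂ) • (PF * varS j * QF) := by
      rw [mul_add, add_mul, mul_smul_comm, smul_mul_assoc, add_sub_cancel_right, mul_assoc]
    rw [List.map_cons, List.prod_cons, List.map_cons, List.prod_cons, e1, e2, map_sub, map_sub,
      map_smul, map_smul]
    calc _ = ‖(ntrLin k (PA * A (Sum.inl j) * QA) - φ (PF * (varX j + (ε : ℂ) • varS j) * QF)) -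
          (ε : ℂ) • (ntrLin k (PA * A (Sum.inr j) * QA) - φ (PF * varS j * QF))‖ := by
          congr 1; rw [smul_sub]; abel
      _ ≤ 2 ^ w.length * δ + 1 * (2 ^ w.length * δ) := by
          refine (norm_sub_le _ _).trans (add_le_add h1 ?_)
          rw [norm_smul, Complex.norm_real, Real.norm_of_nonneg hε]
          gcongr
      _ = _ := by rw [List.length_cons, pow_succ]; ring

lemma starWord_of_isSelfAdjoint {ι R : Type*} [Monoid R] [Star R] {a : ι → R}
    (ha : ∀ i, IsSelfAdjoint (a i)) (w : List (ι × Bool)) :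
    starWord a w = ((w.map Prod.fst).map a).prod := by
  rw [starWord, List.map_map]
  congr 1
  refine List.map_congr_left fun p _ => ?_
  rw [(ha p.1).star_eq, ite_self]
  rfl

variable {B : Type*} [Ring B] [Algebra ℂ B] {τ : B →ₗ[ℂ] ℂ} {x : Fin n → B}
  {φ : FreeAlgebra ℂ (Fin n ⊕ Fin n) →ₗ[ℂ] ℂ}

lemma IsSemicircularExtension.apply_prod_varX (hφ : IsSemicircularExtension τ x φ)
    (w : List (Fin n)) : φ (w.map varX).prod = τ (w.map x).prod := by
  have h := hφ.law_x (w.map (FreeAlgebra.ι ℂ)).prod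
  rw [map_list_prod (FreeAlgebra.lift ℂ varX), map_list_prod (FreeAlgebra.lift ℂ x), List.map_map,
    List.map_map] at h
  have e1 : (⇑(FreeAlgebra.lift ℂ (varX (n := n))) ∘ FreeAlgebra.ι ℂ) = varX := by
    ext i; simp
  have e2 : (⇑(FreeAlgebra.lift ℂ x) ∘ FreeAlgebra.ι ℂ) = x := by
    ext i; simp
  rwa [e1, e2] at h

/-- If `(b, s)` is a microstate of `(x + ε s, s)`, then `b - ε s` is one of `x`. -/
lemma sub_smul_mem_microstates [Star B] (hφ : IsSemicircularExtension τ x φ)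
    (hx : ∀ j, IsSelfAdjoint (x j)) {ε δ δ' R : ℝ} {m k : ℕ} (hε : 0 ≤ ε) (hε1 : ε ≤ 1)
    (hδ0 : 0 ≤ δ) (hδ : 2 ^ m * δ < δ') {b s : Fin n → Matrix (Fin k) (Fin k) ℂ}
    (h : Sum.elim b s ∈ saMicrostates (perturbedLaw φ ε) R m k δ) :
    (fun j => b j - (ε : ℂ) • s j) ∈
      microstates (fun w => τ (starWord x w)) (2 * R) m k δ' := by
  have hb : ∀ j, (b j).IsHermitian ∧ opNorm (b j) ≤ R := fun j => h.1 (Sum.inl j)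
  have hs : ∀ j, (s j).IsHermitian ∧ opNorm (s j) ≤ R := fun j => h.1 (Sum.inr j)
  have hsa : ∀ j, IsSelfAdjoint (b j - (ε : ℂ) • s j) := fun j => by
    have h1 : star (b j) = b j := (hb j).1
    have h2 : star (s j) = s j := (hs j).1
    rw [IsSelfAdjoint, star_sub, star_smul, h1, h2]
    simp
  refine ⟨fun j => ?_, fun w hw1 hwm => ?_⟩
  · have h1 := (hb j).2
    have h2 := (hs j).2
    rw [opNorm_eq_norm] at h1 h2 ⊢
    calc ‖b j - (ε : ℂ) • s j‖ ≤ ‖b j‖ + ε * ‖s j‖ := by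
          refine (norm_sub_le _ _).trans ?_
          rw [norm_smul, Complex.norm_real, Real.norm_of_nonneg hε]
      _ ≤ R + 1 * R := by gcongr
      _ = 2 * R := by ring
  · beta_reduce
    rw [starWord_of_isSelfAdjoint hsa, starWord_of_isSelfAdjoint hx, ← hφ.apply_prod_varX]
    have h1 := norm_ntr_sub_law_le hε hε1 h.2 (w.map Prod.fst) [] (by simpa using hw1)
      (by simpa using hwm)
    simp only [List.map_nil, List.prod_nil, one_mul, Sum.elim_inl, Sum.elim_inr, ntrLin_apply,
      List.length_map] at h1
    refine (h1.trans ?_).trans_lt hδ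
    gcongr
    norm_num

lemma hsnorm_le_of_mem_microstates {law : List (Fin n × Bool) → ℂ} {R δ : ℝ} {m k : ℕ}
    (hm : 2 ≤ m) (hδ : δ ≤ 1) {A : Fin n → Matrix (Fin k) (Fin k) ℂ}
    (hA : A ∈ microstates law R m k δ) (j : Fin n) :
    hsnorm (A j) ≤ 1 + ∑ i, ‖law [(i, true), (i, false)]‖ := by
  have h1 := hA.2 [(j, true), (j, false)] (by simp) (by simpa using hm)
  have e : starWord A [(j, true), (j, false)] = star (A j) * A j := by simp [starWord]
  rw [e] at h1
  set K := 1 + ∑ i, ‖law [(i, true), (i, false)]‖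
  have h2 : ‖law [(j, true), (j, false)]‖ ≤ ∑ i, ‖law [(i, true), (i, false)]‖ :=
    Finset.single_le_sum (f := fun i => ‖law [(i, true), (i, false)]‖)
      (fun _ _ => norm_nonneg _) (Finset.mem_univ j)
  have hK : 1 ≤ K := by
    have : 0 ≤ ‖law [(j, true), (j, false)]‖ := norm_nonneg _
    linarith
  have h3 : hsnorm (A j) ^ 2 ≤ K := by
    rw [hsnorm, (isTrace_ntrLin k).sq_tnorm, ntrLin_apply]
    have h4 : ‖ntr (star (A j) * A j)‖ ≤ ‖ntr (star (A j) * A j) - law [(j, true), (j, false)]‖ +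
        ‖law [(j, true), (j, false)]‖ := by
      simpa using norm_add_le (ntr (star (A j) * A j) - law [(j, true), (j, false)])
        (law [(j, true), (j, false)])
    have h5 := Complex.re_le_norm (ntr (star (A j) * A j))
    linarith
  have h6 : 0 ≤ hsnorm (A j) := tnorm_nonneg _
  nlinarith

lemma hsnorm_le_two_of_mem_saMicrostates (hφ : IsSemicircularExtension τ x φ) {ε δ R : ℝ}
    {m k : ℕ} (hm : 2 ≤ m) (hδ : δ ≤ 1) {b s : Fin n → Matrix (Fin k) (Fin k) ℂ}
    (h : Sum.elim b s ∈ saMicrostates (perturbedLaw φ ε) R m k δ) (j : Fin n) :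
    hsnorm (s j) ≤ 2 := by
  have h1 := h.2 [Sum.inr j, Sum.inr j] (by simp) (by simpa using hm)
  have hs : star (s j) = s j := (h.1 (Sum.inr j)).1
  have h2 : perturbedLaw φ ε [Sum.inr j, Sum.inr j] = 1 := by
    have := hφ.semicircular_even j 1
    simp only [perturbedLaw, List.map_cons, List.map_nil, List.prod_cons, List.prod_nil, mul_one,
      Sum.elim_inr]
    rw [← sq]
    simpa using this
  simp only [List.map_cons, List.map_nil, List.prod_cons, List.prod_nil, mul_one, Sum.elim_inr]
    at h1
  rw [h2] at h1
  have h3 : hsnorm (s j) ^ 2 ≤ 2 := by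
    rw [hsnorm, (isTrace_ntrLin k).sq_tnorm, ntrLin_apply, hs]
    have h4 := norm_add_le (ntr (s j * s j) - 1) 1
    rw [sub_add_cancel, norm_one] at h4
    have h5 := Complex.re_le_norm (ntr (s j * s j))
    linarith
  nlinarith [tnorm_nonneg (t := ntrLin k) (s j)]

/-- Points of a common orbit-ball whose conjugating unitaries are close. -/
lemma hsnorm_sub_le_of_orbit {k : ℕ} {X X' Z W W' : Matrix (Fin k) (Fin k) ℂ} {ε K : ℝ}
    (hW : W ∈ Matrix.unitaryGroup (Fin k) ℂ) (hW' : W' ∈ Matrix.unitaryGroup (Fin k) ℂ)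
    (h : hsnorm (X - W * Z * star W) < ε) (h' : hsnorm (X' - W' * Z * star W') < ε)
    (hWW : ‖W - W'‖ ≤ ε) (hε1 : ε ≤ 1) (hX : hsnorm X ≤ K) :
    hsnorm (X - X') ≤ (2 * K + 4) * ε := by
  have ht := isTrace_ntrLin k
  have hε : 0 ≤ ε := (norm_nonneg _).trans hWW
  have hZ : hsnorm Z ≤ K + 1 := by
    rw [hsnorm, ← ht.tnorm_conj_unitary hW]
    have := ht.tnorm_sub_le X (X - W * Z * star W)
    rw [sub_sub_cancel] at this
    linarith
  have hZ0 : 0 ≤ hsnorm Z := tnorm_nonneg _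
  have hW1 := IsTrace.norm_le_one_of_mem_unitary hW
  have hW1' := IsTrace.norm_le_one_of_mem_unitary hW'
  have h1 : hsnorm ((W - W') * Z * star W) ≤ ε * (K + 1) * 1 := by
    refine (ht.tnorm_mul_mul_le _ _ _).trans ?_
    rw [norm_star]
    have : 0 ≤ K + 1 := hZ0.trans hZ
    gcongr
  have h2 : hsnorm (W' * Z * star (W - W')) ≤ 1 * (K + 1) * ε := by
    refine (ht.tnorm_mul_mul_le _ _ _).trans ?_
    rw [norm_star]
    have : 0 ≤ K + 1 := hZ0.trans hZ
    gcongr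
  have h3 := ht.tnorm_sub_le_add X (W * Z * star W) X'
  have h4 := ht.tnorm_sub_le_add (W * Z * star W) (W' * Z * star W') X'
  rw [ht.tnorm_sub_comm (W' * Z * star W')] at h4
  have e : W * Z * star W - W' * Z * star W' =
      (W - W') * Z * star W + W' * Z * star (W - W') := by
    rw [star_sub]; noncomm_ring
  have h5 := ht.tnorm_add_le ((W - W') * Z * star W) (W' * Z * star (W - W'))
  rw [e] at h4
  simp only [hsnorm] at *
  nlinarith

/-- If the upper free orbit-dimension of `x` vanishes, the microstate spaces of `(x + ε s : s)` have
small volume. The bound is the product of the number of `ε`-orbit-balls that cover the microstate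
space of `x`, the size of an `ε`-net of the unitary group, and the volume of a ball of radius
proportional to `ε √k`. -/
theorem exists_volume_bound [Star B] (hφ : IsSemicircularExtension τ x φ)
    (hx : ∀ j, IsSelfAdjoint (x j))
    (hK : ∀ ω R, 0 < ω → ω < 1 → 0 < R → orbitDimAt (fun w => τ (starWord x w)) ω R = 0) :
    ∃ C > 0, ∃ c > 0, ∀ ε R : ℝ, 0 < ε → ε < 1 → 0 < R → ∃ (m : ℕ) (δ : ℝ), 0 < δ ∧
      ∀ᶠ k : ℕ in atTop, microstateVolume (perturbedLaw φ ε) R m k δ ≤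
        ENNReal.ofReal (Real.exp ((k : ℝ) ^ 2) * (1 + C / ε) ^ (k ^ 2) *
          (Real.exp (n * c ^ 2 * (k : ℝ) ^ 2) *
            (Real.pi / (k / ε ^ 2)) ^ ((n * (k : ℝ) ^ 2) / 2))) := by
  classical
  obtain ⟨C, hC, hnet⟩ := exists_partition_unitary
  -- `K` bounds the 2-norms of the microstates of `x`, independently of `R`
  set K := 1 + ∑ i, ‖τ (starWord x [(i, true), (i, false)])‖ with hKdef
  have hK0 : 0 < K := by positivity
  refine ⟨C, hC, 2 * K + 8, by positivity, fun ε R hε hε1 hR => ?_⟩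
  obtain ⟨m₀, δ₀, hδ₀, hcov⟩ := exists_cover_of_orbitDimAt_eq_zero
    (hK ε (2 * R) hε hε1 (by positivity)) hε hε1 one_pos
  set m := max m₀ 2 with hm
  set δ' := min δ₀ 1 with hδ'
  have hδ'0 : 0 < δ' := by positivity
  -- a word of length at most `m` in `b - ε s` is a sum of at most `2 ^ m` words in `b` and `s`
  set δ := δ' / 2 ^ (m + 1) with hδ
  have hδ0 : 0 < δ := by positivity
  have hδδ : 2 ^ m * δ < δ' := by
    rw [hδ, mul_div_assoc', div_lt_iff₀ (by positivity), pow_succ]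
    have : (0 : ℝ) < 2 ^ m := by positivity
    nlinarith
  have hδ1 : δ ≤ 1 := by
    have h1 : (1 : ℝ) ≤ 2 ^ m := one_le_pow₀ (by norm_num)
    have h2 : δ' ≤ 1 := min_le_right _ _
    nlinarith
  refine ⟨m, δ, hδ0, ?_⟩
  filter_upwards [hcov, eventually_ge_atTop 1] with k ⟨E, hE, hEcov, hcard⟩ hk1
  have hk0 : k ≠ 0 := by omega
  have hkpos : (0 : ℝ) < k := by exact_mod_cast hk1
  obtain ⟨N, net, hN, hnet⟩ := hnet k ε hε
  set S := {v : hermTuples n k | ∃ b : Fin n → Matrix (Fin k) (Fin k) ℂ,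
    Sum.elim (toMatrices v) b ∈ saMicrostates (perturbedLaw φ ε) R m k δ} with hS
  choose s hs using fun v : S => v.2
  have hmem : ∀ v : S, (fun j => toMatrices v.1 j - (ε : ℂ) • s v j) ∈
      microstates (fun w => τ (starWord x w)) (2 * R) m k δ' := fun v =>
    sub_smul_mem_microstates hφ hx hε.le hε1.le hδ0.le hδδ (hs v)
  have hball : ∀ v : S, ∃ Z ∈ E, ∃ W ∈ Matrix.unitaryGroup (Fin k) ℂ,
      norm2 (fun j => (toMatrices v.1 j - (ε : ℂ) • s v j) - W * Z j * star W) < ε := by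
    intro v
    have := hEcov (microstates_anti (le_max_left _ _) (min_le_left _ _) (hmem v))
    simp only [Set.mem_iUnion] at this
    obtain ⟨Z, hZ, W, hW, hlt⟩ := this
    exact ⟨Z, hZ, W, hW, hlt⟩
  choose Z hZ W hW hlt using hball
  -- the class of a microstate: the centre of its orbit-ball, and the net class of its unitary
  let cls : S → E × Fin N := fun v => (⟨Z v, hZ v⟩, net (W v))
  set r := Real.sqrt (k * n * ((2 * K + 8) * ε) ^ 2) with hr
  have hcls : ∀ v w : S, cls v = cls w → ‖(v : hermTuples n k) - w‖ ≤ r := by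
    intro v w hvw
    have hZvw : Z v = Z w := congrArg (fun t : E × Fin N => t.1.1) hvw
    have hWvw := hnet _ _ (hW v) (hW w) (congrArg Prod.snd hvw)
    have hj : ∀ j, hsnorm (toMatrices v.1 j - toMatrices w.1 j) ≤ (2 * K + 8) * ε := by
      intro j
      have ht := isTrace_ntrLin k
      have h1 := (hsnorm_le_norm2 _ j).trans_lt (hlt v)
      have h2 := (hsnorm_le_norm2 _ j).trans_lt (hlt w)
      rw [← hZvw] at h2
      have h3 := hsnorm_sub_le_of_orbit (hW v) (hW w) h1 h2 hWvw hε1.le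
        (hsnorm_le_of_mem_microstates (le_max_right _ _) (min_le_right _ _) (hmem v) j)
      have h4 := hsnorm_le_two_of_mem_saMicrostates hφ (le_max_right _ _) hδ1 (hs v) j
      have h5 := hsnorm_le_two_of_mem_saMicrostates hφ (le_max_right _ _) hδ1 (hs w) j
      have h6 : hsnorm ((ε : ℂ) • (s v j - s w j)) ≤ ε * (2 + 2) := by
        rw [hsnorm, ht.tnorm_smul, Complex.norm_real, Real.norm_of_nonneg hε.le]
        gcongr
        exact (ht.tnorm_sub_le _ _).trans (add_le_add h4 h5)
      have e : toMatrices v.1 j - toMatrices w.1 j =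
          ((toMatrices v.1 j - (ε : ℂ) • s v j) - (toMatrices w.1 j - (ε : ℂ) • s w j)) +
            (ε : ℂ) • (s v j - s w j) := by
        rw [smul_sub]; abel
      rw [e]
      refine (ht.tnorm_add_le _ _).trans ((add_le_add h3 h6).trans (le_of_eq ?_))
      rw [← hKdef]
      ring
    refine Real.le_sqrt_of_sq_le ?_
    rw [sq_norm_sub_hermTuples hk0, mul_assoc]
    refine mul_le_mul_of_nonneg_left ?_ hkpos.le
    calc ∑ j, hsnorm (toMatrices v.1 j - toMatrices w.1 j) ^ 2
        ≤ ∑ _j : Fin n, ((2 * K + 8) * ε) ^ 2 := by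
          gcongr with j
          · exact tnorm_nonneg _
          · exact hj j
      _ = n * ((2 * K + 8) * ε) ^ 2 := by simp
  have hvol := volume_le_of_classes cls hcls (show (0 : ℝ) < k / ε ^ 2 by positivity)
  refine hvol.trans ?_
  rw [finrank_hermTuples, Fintype.card_prod, Fintype.card_coe, Fintype.card_fin]
  -- the Gaussian parameter `k / ε²` is the inverse square of the radius, up to the dimension `k²`
  have hexp : (k / ε ^ 2) * r ^ 2 = n * (2 * K + 8) ^ 2 * (k : ℝ) ^ 2 := by
    rw [hr, Real.sq_sqrt (by positivity)]
    field_simp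
  rw [hexp, ← ENNReal.ofReal_natCast, ← ENNReal.ofReal_mul (by positivity)]
  refine ENNReal.ofReal_le_ofReal ?_
  push_cast
  have hcard' : (E.card : ℝ) ≤ Real.exp ((k : ℝ) ^ 2) := by simpa using hcard
  have hpow : 0 ≤ (Real.pi / (k / ε ^ 2)) ^ ((n * (k : ℝ) ^ 2) / 2) :=
    Real.rpow_nonneg (by positivity) _
  gcongr

/-- The bound of `exists_volume_bound` on the scale of free entropy. -/
lemma log_volume_bound {k : ℕ} (hk : 1 ≤ k) {C c ε : ℝ} (hC : 0 < C) (hε : 0 < ε) (hε1 : ε < 1)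
    {v : ℝ≥0∞} (hv : v ≤ ENNReal.ofReal (Real.exp ((k : ℝ) ^ 2) * (1 + C / ε) ^ (k ^ 2) *
      (Real.exp (n * c ^ 2 * (k : ℝ) ^ 2) *
        (Real.pi / (k / ε ^ 2)) ^ ((n * (k : ℝ) ^ 2) / 2)))) :
    ENNReal.log v / (((k : ℝ) ^ 2 : ℝ) : EReal) + (((n : ℝ) / 2 * Real.log k : ℝ) : EReal) ≤
      ((1 + Real.log (1 + C) + n * c ^ 2 + n / 2 * Real.log Real.pi + (1 - n) * |Real.log ε| : ℝ) :
        EReal) := by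
  have hkpos : (0 : ℝ) < k := by exact_mod_cast hk
  have hlogε : |Real.log ε| = -Real.log ε := abs_of_neg (Real.log_neg hε hε1)
  have hpi := Real.pi_pos
  have hrp : 0 < (Real.pi / (k / ε ^ 2)) ^ ((n * (k : ℝ) ^ 2) / 2) :=
    Real.rpow_pos_of_pos (by positivity) _
  have hpos : 0 < Real.exp ((k : ℝ) ^ 2) * (1 + C / ε) ^ (k ^ 2) *
      (Real.exp (n * c ^ 2 * (k : ℝ) ^ 2) *
        (Real.pi / (k / ε ^ 2)) ^ ((n * (k : ℝ) ^ 2) / 2)) := by positivity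
  have h1 := ENNReal.log_le_log hv
  rw [ENNReal.log_ofReal_of_pos hpos] at h1
  have h2 : Real.log (Real.exp ((k : ℝ) ^ 2) * (1 + C / ε) ^ (k ^ 2) *
      (Real.exp (n * c ^ 2 * (k : ℝ) ^ 2) *
        (Real.pi / (k / ε ^ 2)) ^ ((n * (k : ℝ) ^ 2) / 2))) =
      (k : ℝ) ^ 2 + (k : ℝ) ^ 2 * Real.log (1 + C / ε) + (n * c ^ 2 * (k : ℝ) ^ 2 +
        (n * (k : ℝ) ^ 2) / 2 * (Real.log Real.pi - (Real.log k - 2 * Real.log ε))) := by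
    rw [Real.log_mul (by positivity) (by positivity), Real.log_mul (by positivity) (by positivity),
      Real.log_mul (by positivity) hrp.ne', Real.log_exp, Real.log_exp, Real.log_pow,
      Real.log_rpow (by positivity), Real.log_div (by positivity) (by positivity),
      Real.log_div (by positivity) (by positivity), Real.log_pow]
    push_cast
    ring
  have h3 : Real.log (1 + C / ε) ≤ Real.log (1 + C) - Real.log ε := by
    rw [← Real.log_div (by positivity) (by positivity)]
    refine Real.log_le_log (by positivity) ?_
    rw [add_div]
    gcongr
    rw [le_div_iff₀ hε]
    linarith
  rw [h2] at h1
  have h4 := EReal.div_le_div_right_of_nonneg (c := (((k : ℝ) ^ 2 : ℝ) : EReal))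
    (by exact_mod_cast sq_nonneg (k : ℝ)) h1
  refine (add_le_add_left h4 _).trans ?_
  rw [← EReal.coe_div, ← EReal.coe_add, EReal.coe_le_coe_iff, hlogε]
  have h5 : ((k : ℝ) ^ 2 + (k : ℝ) ^ 2 * Real.log (1 + C / ε) + (n * c ^ 2 * (k : ℝ) ^ 2 +
      (n * (k : ℝ) ^ 2) / 2 * (Real.log Real.pi - (Real.log k - 2 * Real.log ε)))) / (k : ℝ) ^ 2 =
      1 + Real.log (1 + C / ε) + (n * c ^ 2 +
        n / 2 * (Real.log Real.pi - (Real.log k - 2 * Real.log ε))) := by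
    field_simp
  rw [h5]
  linarith

/-- A self-adjoint tuple of vanishing upper free orbit-dimension has free entropy dimension at
most one. -/
theorem freeEntropyDimTuple_le_one [Star B] (hx : ∀ j, IsSelfAdjoint (x j))
    (hK : ∀ ω R, 0 < ω → ω < 1 → 0 < R → orbitDimAt (fun w => τ (starWord x w)) ω R = 0) :
    freeEntropyDimTuple τ x ≤ 1 := by
  refine iSup₂_le fun φ hφ => ?_
  obtain ⟨C, hC, c, -, hvol⟩ := exists_volume_bound hφ hx hK
  set D := 1 + Real.log (1 + C) + n * c ^ 2 + n / 2 * Real.log Real.pi with hD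
  -- the constants do not depend on `R`, over which `χ` takes a supremum
  have hχ : ∀ ε : ℝ, 0 < ε → ε < 1 →
      freeEntropy (perturbedLaw φ ε) ≤ ((D + (1 - n) * |Real.log ε| : ℝ) : EReal) := by
    intro ε hε hε1
    refine iSup₂_le fun R hR => ?_
    obtain ⟨m, δ, hδ, hk⟩ := hvol ε R hε hε1 hR
    refine iInf_le_of_le m (iInf₂_le_of_le δ hδ (limsup_le_of_le (by isBoundedDefault) ?_))
    filter_upwards [hk, eventually_ge_atTop 1] with k hk hk1
    exact log_volume_bound hk1 hC hε hε1 hk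
  have hlim : Tendsto (fun ε : ℝ => ((D / |Real.log ε| + (1 - n) : ℝ) : EReal)) (𝓝[>] 0)
      (𝓝 (((1 - n : ℝ)) : EReal)) := by
    have h1 : Tendsto (fun ε : ℝ => |Real.log ε|) (𝓝[>] 0) atTop :=
      tendsto_abs_atBot_atTop.comp Real.tendsto_log_nhdsGT_zero
    have h2 := (h1.const_div_atTop D).add_const (1 - n : ℝ)
    rw [zero_add] at h2
    exact (continuous_coe_real_ereal.tendsto _).comp h2
  have hsup : limsup (fun ε : ℝ => freeEntropy (perturbedLaw φ ε) / ((|Real.log ε| : ℝ) : EReal))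
      (𝓝[>] 0) ≤ ((1 - n : ℝ) : EReal) := by
    rw [← hlim.limsup_eq]
    refine limsup_le_limsup ?_ (by isBoundedDefault) (by isBoundedDefault)
    filter_upwards [Ioo_mem_nhdsGT (show (0 : ℝ) < 1 by norm_num)] with ε hε
    have hlog : 0 < |Real.log ε| := abs_pos.2 (Real.log_neg hε.1 hε.2).ne
    have h1 := EReal.div_le_div_right_of_nonneg (c := ((|Real.log ε| : ℝ) : EReal))
      (by exact_mod_cast hlog.le) (hχ ε hε.1 hε.2)
    refine h1.trans (le_of_eq ?_)
    rw [← EReal.coe_div, add_div, mul_div_cancel_right₀ _ hlog.ne']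
  calc (n : EReal) + _ ≤ ((n : ℝ) : EReal) + ((1 - n : ℝ) : EReal) := add_le_add le_rfl hsup
    _ = 1 := by
      rw [← EReal.coe_add, add_sub_cancel]
      rfl

end Entropy

/-! ### Factors with many normalizers -/

section Conclusion

variable {H : Type*} [NormedAddCommGroup H] [InnerProductSpace ℂ H] [CompleteSpace H]
  {M : VonNeumannAlgebra H} {τ : M.toStarSubalgebra →ₗ[ℂ] ℂ}

lemma freeEntropyDim_le_one (h : upperOrbitDim τ M = 0) : freeEntropyDim τ M ≤ 1 :=
  iSup_le fun _ => iSup_le fun _ => iSup_le fun hx => iSup_le fun hgen =>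
    freeEntropyDimTuple_le_one hx fun _ _ hω hω1 hR =>
      orbitDimAt_eq_zero_of_upperOrbitDim h hgen hω hω1 hR

end Conclusion

end FreeOrbit

theorem corollary2 {H : Type*} [NormedAddCommGroup H] [InnerProductSpace ℂ H] [CompleteSpace H]
    (M : VonNeumannAlgebra H) (hM : FreeOrbit.IsTypeII1Factor M)
    (τ : M.toStarSubalgebra →ₗ[ℂ] ℂ) (hτ : FreeOrbit.IsTracialState M τ) :
    (∀ A : VonNeumannAlgebra H, A ≤ M → FreeOrbit.IsDiffuse A →
      FreeOrbit.IsFinitelyGenerated A → FreeOrbit.upperOrbitDim τ A = 0 →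
      ∀ k : ℕ∞, 1 ≤ k → M = FreeOrbit.iteratedNormalizer M A k →
        FreeOrbit.upperOrbitDim τ M = 0 ∧ FreeOrbit.freeEntropyDim τ M ≤ 1) ∧
    (∀ A : VonNeumannAlgebra H, FreeOrbit.IsCartan M A →
      FreeOrbit.upperOrbitDim τ M = 0 ∧ FreeOrbit.freeEntropyDim τ M ≤ 1) := by
  refine ⟨fun A hAM hA hfg hA0 k _ hk => ?_, fun A hA => ?_⟩
  · have h0 : FreeOrbit.upperOrbitDim τ M = 0 :=
      FreeOrbit.upperOrbitDim_eq_zero_of_small hτ fun n x X l coord h =>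
        (FreeOrbit.small_repSet_iteratedNormalizer h hAM hA
          (FreeOrbit.small_repSet_of_upperOrbitDim h hAM hfg hA0) k).mono
          (FreeOrbit.repSet_mono fun y hy => hk.le hy)
    exact ⟨h0, FreeOrbit.freeEntropyDim_le_one h0⟩
  · have hd : FreeOrbit.IsDiffuse A :=
      FreeOrbit.isDiffuse_of_masa hM.no_minimal hA.le hA.masa
    have h0 : FreeOrbit.upperOrbitDim τ M = 0 :=
      FreeOrbit.upperOrbitDim_eq_zero_of_small hτ fun n x X l coord h =>
        (FreeOrbit.small_repSet_normalizerAlgebra h hA.le hd le_rfl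
          (FreeOrbit.small_repSet_of_abelian h hA.le hd
            fun a ha => ((hA.masa a (hA.le ha)).1 ha))).mono
          (FreeOrbit.repSet_mono fun y hy => hA.regular.ge hy)
    exact ⟨h0, FreeOrbit.freeEntropyDim_le_one h0⟩
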